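/- Let $n\ge 2$ and $\Omega=\mathbb{R}^n\times(0,\infty)$, with points $(x,z)$. All functions are complex valued. Let $H=L^2(\Omega, z\,dx\,dz)$, let $$b(\varphi,\eta)=\int_\Omega\Big(z\,\partial_z\varphi\,\partial_z\bar\eta+z^{-1/n}\,\nabla\varphi\cdot\nabla\bar\eta\Big)\,dx\,dz ,$$ where $\nabla$ is the gradient in $x$ and derivatives are weak derivatives on $\Omega$, let $$\mathcal{E}=\{\varphi\in H^1_{loc}(\Omega)\cap H:\ b(\varphi,\varphi)<\infty\},\qquad \|\varphi\|_{\mathcal E}^2=b(\varphi,\varphi)+\|\varphi\|_H^2,$$ and let $$D=\{\varphi\in\mathcal{E}:\ \exists\, C>0\ \forall\,\eta\in\mathcal{E},\ |b(\varphi,\eta)|\le C\|\eta\|_H\}$$ be the domain of the self-adjoint operator $A$ on $H$ associated with the form $b$ on $\mathcal E$; formally $A\varphi=-\frac1z\partial_z(z\,\partial_z\varphi)-z^{-1-1/n}\Delta\varphi$. Let $f\in D$ and $g\in\mathcal{E}$, and let $\phi\in C([0,\infty);\mathcal{E})\cap C^1([0,\infty);H)$ be the solution of the Cauchy problem $$\partial_{tt}\phi+A\phi=0,\qquad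 \phi(0,\cdot)=f,\qquad \partial_t\phi(0,\cdot)=g,$$ where the equation is understood in the dual of $\mathcal E$: for every $\eta\in\mathcal E$ and $t\ge0$, $\frac{d}{dt}\langle\partial_t\phi(t),\eta\rangle_H=-b(\phi(t),\eta)$. For $z>0$ let $\phi(t,\cdot,z)$ be the trace of $\phi(t,\cdot)$ on the hyperplane $\mathbb{R}^n\times\{z\}$, i.e. the value at $z$ of the $L^2(\mathbb{R}^n)$-continuous version of $z\mapsto\phi(t,\cdot,z)$ on $(0,\infty)$. Then, for each $t\ge 0$, the boundary trace $\phi(t,\cdot,0)=\lim_{z\to0^+}\phi(t,\cdot,z)$ exists in $L^2(\mathbb{R}^n)$ and belongs to the Sobolev space $H^{\frac{2n}{n-1}}(\mathbb{R}^n)$; moreover $$\phi(\cdot,\cdot,0)\in C\big([0,\infty);H^{\frac{2n}{n-1}}(\mathbb{R}^n)\big).$$ -/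

import Mathlib

open MeasureTheory Set Filter Topology
open scoped ContDiff SchwartzMap

namespace TaubWave

noncomputable section

/-- The horizontal space `ℝⁿ`, with its Euclidean norm and Lebesgue measure. -/
abbrev Horizontal (n : ℕ) : Type := EuclideanSpace ℝ (Fin n)

/-- The ambient space `ℝⁿ × ℝ`; a point is written `p = (x, z)`. Its `volume` is the product
Lebesgue measure `dx dz`. -/
abbrev Ambient (n : ℕ) : Type := Horizontal n × ℝ

/-- The half space `Ω = ℝⁿ × (0, ∞)`. -/
def halfSpace (n : ℕ) : Set (Ambient n) := {p | 0 < p.2}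

/-- The measure `z dx dz` on `Ω` (extended by zero). -/
def weightedMeasure (n : ℕ) : Measure (Ambient n) :=
  ((volume : Measure (Ambient n)).restrict (halfSpace n)).withDensity
    (fun p => ENNReal.ofReal p.2)

/-- The Hilbert space `H = L²(Ω, z dx dz)` of complex valued functions. -/
abbrev H (n : ℕ) : Type := Lp ℂ 2 (weightedMeasure n)

/-- The space `L²(ℝⁿ)` of complex valued functions. -/
abbrev L2Horizontal (n : ℕ) : Type := Lp ℂ 2 (volume : Measure (Horizontal n))

/-- The `i`-th horizontal coordinate direction. -/
def horizontalDir (n : ℕ) (i : Fin n) : Ambient n := (EuclideanSpace.single i 1, 0)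

/-- The vertical coordinate direction. -/
def verticalDir (n : ℕ) : Ambient n := (0, 1)

/-- `ψ ∈ L²_loc(Ω)`. -/
def IsL2Loc (n : ℕ) (ψ : Ambient n → ℂ) : Prop :=
  ∀ K : Set (Ambient n), IsCompact K → K ⊆ halfSpace n →
    MemLp ψ 2 ((volume : Measure (Ambient n)).restrict K)

/-- `η ∈ C₀^∞(Ω)`: smooth with compact support contained in the open half space. -/
def IsTestFunction (n : ℕ) (η : Ambient n → ℝ) : Prop :=
  ContDiff ℝ ∞ η ∧ HasCompactSupport η ∧ tsupport η ⊆ halfSpace n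

/-- `ψ ∈ L²_loc(Ω)` is the weak derivative of `φ` on `Ω` in the direction `v`. -/
def IsWeakDeriv (n : ℕ) (v : Ambient n) (φ ψ : Ambient n → ℂ) : Prop :=
  IsL2Loc n ψ ∧ ∀ η : Ambient n → ℝ, IsTestFunction n η →
    ∫ p in halfSpace n, φ p * ((fderiv ℝ η p v : ℝ) : ℂ) =
      - ∫ p in halfSpace n, ψ p * ((η p : ℝ) : ℂ)

/-- `φ ∈ H¹_loc(Ω)`. -/
def IsH1Loc (n : ℕ) (φ : Ambient n → ℂ) : Prop :=
  IsL2Loc n φ ∧ (∃ ψ, IsWeakDeriv n (verticalDir n) φ ψ) ∧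
    ∀ i : Fin n, ∃ ψ, IsWeakDeriv n (horizontalDir n i) φ ψ

open Classical in
/-- The weak derivative of `φ` on `Ω` in the direction `v`, which is unique almost everywhere on
`Ω`; the value is `0` if there is none. -/
def weakDeriv (n : ℕ) (v : Ambient n) (φ : Ambient n → ℂ) : Ambient n → ℂ :=
  if h : ∃ ψ, IsWeakDeriv n v φ ψ then h.choose else 0

/-- The quadratic form `b(φ, φ) = ∫_Ω (z |∂_z φ|² + z^{-1/n} |∇φ|²) dx dz ∈ [0, ∞]`. -/
def energyIntegral (n : ℕ) (φ : Ambient n → ℂ) : ENNReal :=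
  ∫⁻ p in halfSpace n,
    (ENNReal.ofReal p.2 * ‖weakDeriv n (verticalDir n) φ p‖ₑ ^ 2
      + ENNReal.ofReal (p.2 ^ (-(1 / (n : ℝ)))) *
          ∑ i : Fin n, ‖weakDeriv n (horizontalDir n i) φ p‖ₑ ^ 2)

/-- The energy space `ℰ = {φ ∈ H¹_loc(Ω) ∩ H : b(φ, φ) < ∞}`. -/
def energySpace (n : ℕ) : Set (H n) :=
  {φ | IsH1Loc n φ ∧ energyIntegral n φ < ⊤}

/-- The sesquilinear form
`b(φ, η) = ∫_Ω (z ∂_z φ conj(∂_z η) + z^{-1/n} ∇φ · conj(∇η)) dx dz`, used for `φ, η ∈ ℰ`,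
where the integral converges absolutely. -/
def energyForm (n : ℕ) (φ η : H n) : ℂ :=
  ∫ p in halfSpace n,
    ((p.2 : ℂ) * (weakDeriv n (verticalDir n) φ p
          * starRingEnd ℂ (weakDeriv n (verticalDir n) η p))
      + ((p.2 ^ (-(1 / (n : ℝ))) : ℝ) : ℂ) *
          ∑ i : Fin n, weakDeriv n (horizontalDir n i) φ p
            * starRingEnd ℂ (weakDeriv n (horizontalDir n i) η p))

/-- The norm `‖φ‖_ℰ = (b(φ, φ) + ‖φ‖_H²)^{1/2}` of the energy space. -/
def energyNorm (n : ℕ) (φ : H n) : ℝ :=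
  Real.sqrt ((energyForm n φ φ).re + ‖φ‖ ^ 2)

/-- The domain `D = {φ ∈ ℰ : ∃ C > 0, ∀ η ∈ ℰ, |b(φ, η)| ≤ C ‖η‖_H}` of the self-adjoint
operator `A` that is associated with the form `b` on `ℰ`. -/
def operatorDomain (n : ℕ) : Set (H n) :=
  {φ | φ ∈ energySpace n ∧
    ∃ C : ℝ, 0 < C ∧ ∀ η ∈ energySpace n, ‖energyForm n φ η‖ ≤ C * ‖η‖}

/-- `φ` is a solution of the Cauchy problem `∂_tt φ + A φ = 0`, `φ(0) = f`, `∂_t φ(0) = g` in the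
class `C([0, ∞); ℰ) ∩ C¹([0, ∞); H)`. The equation holds in the dual of `ℰ`, that is, after
pairing with each `η ∈ ℰ`, where `A φ` acts by `b(φ, ·)`. Values at negative times play no role;
`inner ℂ η ψ` is the `H`-inner product `⟨ψ, η⟩`, linear in `ψ`. -/
def IsSolution (n : ℕ) (f g : H n) (φ : ℝ → H n) : Prop :=
  (∀ t : ℝ, 0 ≤ t → φ t ∈ energySpace n) ∧
  (∀ t₀ : ℝ, 0 ≤ t₀ →
    Tendsto (fun t => energyNorm n (φ t - φ t₀)) (𝓝[Ici 0] t₀) (𝓝 0)) ∧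
  φ 0 = f ∧
  ∃ φ' : ℝ → H n,
    (∀ t : ℝ, 0 ≤ t → HasDerivWithinAt φ (φ' t) (Ici 0) t) ∧
    ContinuousOn φ' (Ici 0) ∧
    φ' 0 = g ∧
    ∀ η ∈ energySpace n, ∀ t : ℝ, 0 ≤ t →
      HasDerivWithinAt (fun s => inner ℂ η (φ' s)) (-energyForm n (φ t) η) (Ici 0) t

/-- `u z`, for `z > 0`, is the trace of `φ` on the hyperplane `Γ_z = ℝⁿ × {z}`: the family `u` is
the (unique) `L²(ℝⁿ)`-continuous version of `z ↦ φ(·, z)` on `(0, ∞)`. -/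
def IsSliceTrace (n : ℕ) (φ : H n) (u : ℝ → L2Horizontal n) : Prop :=
  ContinuousOn u (Ioi 0) ∧
  ∀ᵐ z ∂((volume : Measure ℝ).restrict (Ioi 0)),
    (fun x : Horizontal n => φ (x, z)) =ᵐ[volume] u z

/-- `τ = φ(·, 0)` is the trace of `φ` on `∂Ω`: the limit in `L²(ℝⁿ)`, as `z → 0⁺`, of the traces
of `φ` on the hyperplanes `Γ_z`. -/
def IsBoundaryTrace (n : ℕ) (φ : H n) (τ : L2Horizontal n) : Prop :=
  ∃ u : ℝ → L2Horizontal n, IsSliceTrace n φ u ∧ Tendsto u (𝓝[>] 0) (𝓝 τ)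

/-- The boundary trace is unique. -/
theorem IsBoundaryTrace.unique {n : ℕ} {φ : H n} {τ₁ τ₂ : L2Horizontal n}
    (h₁ : IsBoundaryTrace n φ τ₁) (h₂ : IsBoundaryTrace n φ τ₂) : τ₁ = τ₂ := by
  obtain ⟨u, ⟨hu, hu'⟩, hτ₁⟩ := h₁
  obtain ⟨v, ⟨hv, hv'⟩, hτ₂⟩ := h₂
  have hae : u =ᵐ[(volume : Measure ℝ).restrict (Ioi 0)] v := by
    filter_upwards [hu', hv'] with z hz hz'
    exact Lp.ext (hz.symm.trans hz')
  have heq : EqOn u v (Ioi 0) := Measure.eqOn_open_of_ae_eq hae isOpen_Ioi hu hv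
  refine tendsto_nhds_unique hτ₁ (hτ₂.congr' ?_)
  filter_upwards [self_mem_nhdsWithin] with z hz
  exact (heq hz).symm

/-- `T` is continuous on `S` with values in the Sobolev space `H^s(ℝⁿ)`, whose norm is
`‖τ‖ = ‖Λ^s τ‖` in `L²(ℝⁿ)` where `Λ^s` is the Fourier multiplier `(1 + |ξ|²)^{s/2}`:
`Λ^s (T t)` is in `L²(ℝⁿ)` for `t ∈ S` and depends continuously on `t ∈ S`. -/
def IsSobolevContinuousOn (n : ℕ) (s : ℝ) (T : ℝ → L2Horizontal n) (S : Set ℝ) : Prop :=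
  ∃ U : ℝ → L2Horizontal n, ContinuousOn U S ∧
    ∀ t ∈ S, TemperedDistribution.besselPotential (Horizontal n) ℂ s
      (T t : 𝓢'(Horizontal n, ℂ)) = (U t : 𝓢'(Horizontal n, ℂ))

end

end TaubWave

/-! Let `j` be the embedding of the energy space into `H`. The energy norm squared is `b` plus the
`H` norm squared, so `J = j j*` is `(1 + A)⁻¹` and the domain of `A` is contained in the range of
`J` (`exists_eq_of_mem_operatorDomain`). The theorem then splits into an evolution statement, `φ(t)
= J θ(t)` with `θ` continuous into `H` (`exists_continuousOn_preimage`), and an elliptic statement: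
the boundary trace of `J h` exists, and in the Sobolev norm it depends continuously on `h ∈ H`
(`exists_continuous_boundaryTrace`).

Evolution. Formally `‖Aφ‖² + ⟨Aφ', φ'⟩` is conserved, but it is not known beforehand to be finite.
Since `A = J⁻¹(1 - J)`, it is replaced by `‖(1 - J)J P(J) φ‖² + ⟨(1 - J)J P(J) Jφ', P(J) Jφ'⟩`,
which is finite and conserved for every real polynomial `P`. Polynomials that behave like `J⁻²` come
from the mean ergodic theorem for the contraction `1 - J`, so no spectral calculus is needed. The
resulting estimates are linear in `P`, so the regularized `Aφ` form a uniform Cauchy sequence in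
`t`. Their limit is continuous in `t`, and adding `φ` gives `θ`.

Elliptic part. With `F = Aφ` and `ν = 1/n`, the Fourier transform in `x` gives `z V' = Q`, `Q' =
z^(-ν) (2π|ξ|)² V - z F`. Finiteness of `∫ z⁻¹ |Q|²` forces the flux `Q` to vanish at `z = 0`
(`RadialSystem.tendsto_Q`), so no boundary condition has to be imposed. The potential term acts at
the depth `ℓ` with `ℓ^(ν - 1) ~ |ξ|²`, that is `ℓ ~ |ξ|^(-2n/(n-1))`, and scaling predicts `|V(0)|²
≤ C ℓ² ∫ z |F|²`. This is `RadialSystem.norm_sq_le_of_coercive`. It is proved by testing the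
equation with `V` times `log(1 + ℓ²/z²)`. That weight has the singularity of a Green function at
`0`, which produces the boundary value, and it is a supersolution for the potential, so the error of
the commutation is absorbed by coercivity.

Summing over dyadic annuli with Plancherel costs nothing: the Sobolev weight on the annulus `|ξ| ~
2^j` is of size `ℓ_j^(-2)`, which is where the exponent `2n/(n-1)` comes from. Frequencies `|ξ| < 1`
are controlled by the energy (`RadialSystem.norm_limit_sq_le`). The same bound at height `δ > 0` has
`ℓ² + δ²` in place of `ℓ²`. It makes the high frequencies small uniformly near the boundary, so the
slices converge in `L²` (`exists_tendsto_of_bands`).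

The ordinary differential equation is never posed for a single `ξ`. It is posed for functions of `z`
with values in `L²`, obtained by cutting the transformed slices to a bounded set of frequencies, on
which `-Δ` acts as a bounded multiplication operator `K`. -/

namespace TaubWave

noncomputable section

/-! ### Mean ergodic approximation of the identity by multiples of an operator -/

section AbstractWave

open Polynomial

variable {K : Type*} [NormedAddCommGroup K] [InnerProductSpace ℂ K]

/-- The real polynomial `1 - (k + 1)⁻¹ ∑ i ≤ k, (1 - X) ^ i`. -/
def ergodicPoly (k : ℕ) : ℝ[X] :=
  1 - C ((k + 1 : ℝ)⁻¹) * ∑ i ∈ Finset.range (k + 1), (1 - X) ^ i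

theorem X_dvd_ergodicPoly (k : ℕ) : X ∣ ergodicPoly k := by
  rw [X_dvd_iff, coeff_zero_eq_eval_zero]
  have : (k : ℝ) + 1 ≠ 0 := by positivity
  simp [ergodicPoly, eval_finsetSum, this]

/-- The quotient of `ergodicPoly k` by `X`. -/
def ergodicQuot (k : ℕ) : ℝ[X] := (X_dvd_ergodicPoly k).choose

theorem X_mul_ergodicQuot (k : ℕ) : X * ergodicQuot k = ergodicPoly k :=
  (X_dvd_ergodicPoly k).choose_spec.symm

theorem aeval_commute (T : K →L[ℂ] K) (p q : ℝ[X]) (x : K) :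
    aeval T p (aeval T q x) = aeval T q (aeval T p x) := by
  rw [← mul_apply_eq_comp, ← mul_apply_eq_comp, ← map_mul, ← map_mul,
    mul_comm]

/-- Symmetry passes to polynomials because the coefficients are real. -/
theorem aeval_inner_comm (T : K →L[ℂ] K) (hT : ∀ x y, inner ℂ (T x) y = inner ℂ x (T y))
    (p : ℝ[X]) (x y : K) : inner ℂ (aeval T p x) y = inner ℂ x (aeval T p y) := by
  induction p using Polynomial.induction_on generalizing x y with
  | C a => simp [Algebra.algebraMap_eq_smul_one, inner_smul_left_eq_smul, inner_smul_right_eq_smul]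
  | add p q hp hq => simp [inner_add_left, hp, hq]
  | monomial n a h =>
    have : C a * X ^ (n + 1) = (C a * X ^ n) * (X : ℝ[X]) := by ring
    have h2 := aeval_commute T (C a * X ^ n) X y
    rw [aeval_X] at h2
    rw [this, map_mul, aeval_X, mul_apply_eq_comp, mul_apply_eq_comp, h, hT, h2]

theorem aeval_intertwine {E : Type*} [NormedAddCommGroup E] [InnerProductSpace ℂ E]
    (S : E →L[ℂ] E) (T : K →L[ℂ] K) (j : E →L[ℂ] K) (h : ∀ x, j (S x) = T (j x))
    (p : ℝ[X]) (x : E) : j (aeval S p x) = aeval T p (j x) := by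
  induction p using Polynomial.induction_on generalizing x with
  | C a =>
    have : ∀ (a : ℝ) (y : E), j (a • y) = a • j y := fun a y => by
      rw [← Complex.coe_smul, map_smul, Complex.coe_smul]
    simp [Algebra.algebraMap_eq_smul_one, this]
  | add p q hp hq => simp [hp, hq]
  | monomial n a h' =>
    have : C a * X ^ (n + 1) = (C a * X ^ n) * (X : ℝ[X]) := by ring
    simp only [this, map_mul, aeval_X, mul_apply_eq_comp] at h' ⊢
    rw [h', h]

theorem aeval_ergodicPoly_apply (T : K →L[ℂ] K) (k : ℕ) (x : K) :
    aeval T (ergodicPoly k) x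
      = x - ((k : ℝ) + 1)⁻¹ • ∑ i ∈ Finset.range (k + 1), ((1 - T) ^ i : K →L[ℂ] K) x := by
  rw [ergodicPoly, map_sub, map_one, map_mul, aeval_C, Algebra.algebraMap_eq_smul_one,
    smul_mul_assoc, one_mul, map_sum]
  simp

variable [CompleteSpace K]

/-- The averages of the powers of the contraction `1 - T` converge to the projection onto its fixed
vectors, which form the kernel of `T`, so they tend to zero on vectors orthogonal to that kernel.
Since `ergodicPoly k` is divisible by `X`, the identity is thereby approximated by operators that
factor through `T`. -/
theorem tendsto_aeval_ergodicPoly (T : K →L[ℂ] K) (hT1 : ‖1 - T‖ ≤ 1) (x : K)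
    (hx : ∀ y, T y = 0 → inner ℂ y x = 0) :
    Tendsto (fun k => aeval T (ergodicPoly k) x) atTop (𝓝 x) := by
  obtain ⟨G, hG⟩ : ∃ G : K →L[ℂ] K, G = 1 - T := ⟨_, rfl⟩
  have h := G.tendsto_birkhoffAverage_orthogonalProjection (hG ▸ hT1) x
  have h0 : (G.eqLocus (1 : K →L[ℂ] K)).orthogonalProjectionOnto x = 0 := by
    rw [Submodule.orthogonalProjectionOnto_eq_zero_iff, Submodule.mem_orthogonal]
    intro u hu
    apply hx
    have hu' : G u = u := hu
    simpa [hG] using hu'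
  rw [h0] at h
  have h1 : Tendsto (fun k : ℕ => x - birkhoffAverage ℂ G _root_.id (k + 1) x) atTop
      (𝓝 (x - ((0 : (G.eqLocus (1 : K →L[ℂ] K))) : K))) :=
    tendsto_const_nhds.sub (h.comp (tendsto_add_atTop_nat 1))
  simp only [ZeroMemClass.coe_zero, sub_zero] at h1
  refine h1.congr fun k => ?_
  rw [aeval_ergodicPoly_apply, ← hG, birkhoffAverage, birkhoffSum]
  simp only [_root_.id]
  rw [← Complex.coe_smul]
  push_cast
  rfl

theorem norm_aeval_ergodicPoly_le (T : K →L[ℂ] K) (hT1 : ‖1 - T‖ ≤ 1) (k : ℕ) (x : K) :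
    ‖aeval T (ergodicPoly k) x‖ ≤ 2 * ‖x‖ := by
  have hp : ∀ i : ℕ, ‖((1 - T) ^ i : K →L[ℂ] K) x‖ ≤ ‖x‖ := by
    intro i
    induction i with
    | zero => simp
    | succ i ih =>
      rw [pow_succ', mul_apply_eq_comp]
      exact ((1 - T).le_of_opNorm_le hT1 _).trans (by simpa using ih)
  have hk : (0 : ℝ) < k + 1 := by positivity
  rw [aeval_ergodicPoly_apply]
  refine (norm_sub_le _ _).trans ?_
  rw [two_mul]
  gcongr
  rw [norm_smul, Real.norm_of_nonneg (by positivity)]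
  refine (mul_le_mul_of_nonneg_left (norm_sum_le_of_le _ fun i _ => hp i) (by positivity)).trans ?_
  simp
  field_simp
  rfl

/-- The square is used because two powers of `T` have to be divided out later. The bound that is
uniform in `k` carries the convergence through the second application. -/
theorem tendsto_aeval_ergodicPoly_sq (T : K →L[ℂ] K) (hT1 : ‖1 - T‖ ≤ 1) (x : K)
    (hx : ∀ y, T y = 0 → inner ℂ y x = 0) :
    Tendsto (fun k => aeval T (ergodicPoly k ^ 2) x) atTop (𝓝 x) := by
  have h := tendsto_aeval_ergodicPoly T hT1 x hx
  have h' := (tendsto_iff_norm_sub_tendsto_zero.1 h)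
  have h2 : Tendsto (fun k => aeval T (ergodicPoly k) (aeval T (ergodicPoly k) x - x)) atTop
      (𝓝 0) := by
    refine squeeze_zero_norm (fun k => norm_aeval_ergodicPoly_le T hT1 k _) ?_
    simpa using h'.const_mul 2
  refine (h2.add h |>.congr fun k => ?_).trans (by simp)
  simp [pow_two]

variable {E : Type*} [NormedAddCommGroup E] [InnerProductSpace ℂ E] [CompleteSpace E]

-- Expand: `‖x - j j* x‖² = ‖x‖² - 2‖j* x‖² + ‖j j* x‖²`, and the last term is at most `‖j* x‖²`.
open ContinuousLinearMap in
theorem norm_one_sub_comp_adjoint_le (j : E →L[ℂ] K) (hj : ‖j‖ ≤ 1) :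
    ‖1 - j ∘L adjoint j‖ ≤ 1 := by
  refine ContinuousLinearMap.opNorm_le_bound _ zero_le_one fun x => ?_
  rw [one_mul]
  have h1 : ‖j (adjoint j x)‖ ≤ ‖adjoint j x‖ := by
    simpa using j.le_of_opNorm_le hj (adjoint j x)
  have h2 : RCLike.re (inner ℂ x (j (adjoint j x))) = ‖adjoint j x‖ ^ 2 := by
    rw [← adjoint_inner_left, inner_self_eq_norm_sq]
  have h3 := norm_sub_sq (𝕜 := ℂ) x (j (adjoint j x))
  have h4 : ‖x - j (adjoint j x)‖ ^ 2 ≤ ‖x‖ ^ 2 := by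
    rw [h3, h2]; nlinarith [norm_nonneg (j (adjoint j x))]
  simpa using (sq_le_sq₀ (norm_nonneg _) (norm_nonneg _)).1 h4

end AbstractWave

end

end TaubWave

namespace TaubWave

noncomputable section

/-! ### The abstract wave equation and persistence of regularity -/

section AbstractWaveEnergy

open Polynomial ContinuousLinearMap

variable {K : Type*} [NormedAddCommGroup K] [InnerProductSpace ℂ K] [CompleteSpace K]
variable {E : Type*} [NormedAddCommGroup E] [InnerProductSpace ℂ E] [CompleteSpace E]

theorem comp_adjoint_inner_comm (j : E →L[ℂ] K) (x y : K) :
    inner ℂ ((j ∘L adjoint j) x) y = inner ℂ x ((j ∘L adjoint j) y) := by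
  rw [comp_apply, comp_apply, ← adjoint_inner_right, adjoint_inner_left]

/-- For a contraction `j` this shows that the kinetic part of the regularized energy is nonnegative
and at most `‖j* y‖²`; both facts enter the estimate below. -/
theorem re_inner_one_sub_mul_self (j : E →L[ℂ] K) (y : K) :
    RCLike.re (inner ℂ (aeval (j ∘L adjoint j) ((1 - X) * X : ℝ[X]) y) y)
      = ‖adjoint j y‖ ^ 2 - ‖j (adjoint j y)‖ ^ 2 := by
  have h1 : aeval (j ∘L adjoint j) ((1 - X) * X : ℝ[X]) y
      = (j ∘L adjoint j) y - (j ∘L adjoint j) ((j ∘L adjoint j) y) := by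
    simp [sub_mul]
  rw [h1, inner_sub_left, comp_adjoint_inner_comm j ((j ∘L adjoint j) y), map_sub]
  congr 1
  · rw [comp_apply, ← adjoint_inner_right, inner_self_eq_norm_sq]
  · rw [inner_self_eq_norm_sq]; rfl

theorem norm_comp_le_of_opNorm_le_one (j : E →L[ℂ] K) (hj : ‖j‖ ≤ 1) (y : E) : ‖j y‖ ≤ ‖y‖ := by
  simpa using j.le_of_opNorm_le hj y

/-- The conserved quantity of the regularized abstract wave equation. -/
theorem abstract_energy_const (j : E →L[ℂ] K) (φ φ' : ℝ → K)
    (hφ : ∀ t, 0 ≤ t → HasDerivWithinAt φ (φ' t) (Ici 0) t)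
    (hJ : ∀ t, 0 ≤ t → HasDerivWithinAt (fun s => (j ∘L adjoint j) (φ' s))
      ((j ∘L adjoint j) (φ t) - φ t) (Ici 0) t) (P : ℝ[X]) (t : ℝ) (ht : 0 ≤ t) :
    let J := j ∘L adjoint j
    let e : ℝ → ℝ := fun t => ‖aeval J ((1 - X) * X * P) (φ t)‖ ^ 2
      + RCLike.re (inner ℂ (aeval J ((1 - X) * X : ℝ[X]) (aeval J P (J (φ' t))))
        (aeval J P (J (φ' t))))
    e t = e 0 := by
  intro J e
  have hJc := comp_adjoint_inner_comm j
  have hder : ∀ t, 0 ≤ t → HasDerivWithinAt e 0 (Ici 0) t := by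
    intro t ht
    have hclm : ∀ (p : ℝ[X]) (f : ℝ → K) (f' : K), HasDerivWithinAt f f' (Ici 0) t →
        HasDerivWithinAt (fun s => aeval J p (f s)) (aeval J p f') (Ici 0) t :=
      fun p f f' hf =>
        ((aeval J p).restrictScalars ℝ).hasFDerivAt.comp_hasDerivWithinAt t hf
    have h1 := hclm ((1 - X) * X * P) _ _ (hφ t ht)
    have h2 := hclm P _ _ (hJ t ht)
    have h3 := hclm ((1 - X) * X) _ _ h2
    have h4 := (h1.inner ℂ h1)
    have h5 := (h3.inner ℂ h2)
    have h6 := ((Complex.reCLM.hasFDerivAt.comp_hasDerivWithinAt t h4).add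
      (Complex.reCLM.hasFDerivAt.comp_hasDerivWithinAt t h5))
    refine (h6.congr_deriv ?_).congr (fun s _ => ?_) ?_
    · simp only [Complex.reCLM_apply, Complex.add_re]
      have c1 : ∀ x y : K, (inner ℂ x y).re = (inner ℂ y x).re := fun x y => by
        rw [← inner_conj_symm, Complex.conj_re]
      have e1 : J (φ t) - φ t = - aeval J (1 - X : ℝ[X]) (φ t) := by simp
      have e2 : J (φ' t) = aeval J (X : ℝ[X]) (φ' t) := by simp
      rw [e1, e2, map_neg, map_neg, inner_neg_left, inner_neg_right]
      have hc := aeval_inner_comm J hJc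
      have hm : ∀ (p q : ℝ[X]) (x : K), aeval J p (aeval J q x) = aeval J (p * q) x := fun p q x => by
        rw [map_mul, mul_apply_eq_comp]
      simp only [hm, Complex.neg_re]
      -- Once all polynomials in `J` act on one factor, the two contributions are twice the real
      -- part of `⟨φ', (1 - J)²J²P(J)² φ⟩` with opposite signs.
      have k1 : ∀ (p q : ℝ[X]) (x y : K), inner ℂ (aeval J p x) (aeval J q y)
          = inner ℂ x (aeval J (p * q) y) := fun p q x y => by rw [hc, hm]
      simp only [k1]
      rw [c1 (φ' t)]
      have k2 : ∀ (p : ℝ[X]) (x y : K), (inner ℂ x (aeval J p y)).re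
          = (inner ℂ y (aeval J p x)).re := fun p x y => by rw [c1, hc]
      rw [k2 _ (φ' t), c1 (aeval J _ _), k2 _ (φ' t)]
      ring_nf
    · simp only [e, Function.comp, Pi.add_apply]
      rw [← inner_self_eq_norm_sq (𝕜 := ℂ)]
      rfl
    · simp only [e, Function.comp, Pi.add_apply]
      rw [← inner_self_eq_norm_sq (𝕜 := ℂ)]
      rfl
  refine constant_of_has_deriv_right_zero (a := 0) (b := t) (fun s hs => ?_) (fun s hs => ?_) t
    ⟨ht, le_rfl⟩
  · exact (hder s hs.1).continuousWithinAt.mono Icc_subset_Ici_self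
  · exact (hder s hs.1).mono (Ici_subset_Ici.2 hs.1)

/-- At time `t` the kinetic part is dropped by positivity; at time `0` it is bounded by a norm in
`E`. The data have the form `J f` and `j g`, which supplies the powers of `J` needed for only `X ^ 2
* P` to appear on the right. This stays bounded when `P` approximates `J⁻²`. -/
theorem abstract_energy_estimate (j : E →L[ℂ] K) (hj : ‖j‖ ≤ 1) (φ φ' : ℝ → K)
    (hφ : ∀ t, 0 ≤ t → HasDerivWithinAt φ (φ' t) (Ici 0) t)
    (hJ : ∀ t, 0 ≤ t → HasDerivWithinAt (fun s => (j ∘L adjoint j) (φ' s))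
      ((j ∘L adjoint j) (φ t) - φ t) (Ici 0) t)
    (f : K) (g : E) (hf : φ 0 = (j ∘L adjoint j) f) (hg : φ' 0 = j g) (P : ℝ[X])
    (t : ℝ) (ht : 0 ≤ t) :
    ‖aeval (j ∘L adjoint j) ((1 - X) * X * P) (φ t)‖ ≤
      ‖aeval (j ∘L adjoint j) (X ^ 2 * P) f‖ + ‖aeval (adjoint j ∘L j) (X ^ 2 * P) g‖ := by
  have h := abstract_energy_const j φ φ' hφ hJ P t ht
  simp only at h
  rw [re_inner_one_sub_mul_self, re_inner_one_sub_mul_self, hf, hg] at h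
  set J := j ∘L adjoint j with hJdef
  have hm : ∀ (p q : ℝ[X]) (x : K), aeval J p (aeval J q x) = aeval J (p * q) x := fun p q x => by
    rw [map_mul, mul_apply_eq_comp]
  have h1 : ‖aeval J ((1 - X) * X * P) (J f)‖ ≤ ‖aeval J (X ^ 2 * P) f‖ := by
    have : aeval J ((1 - X) * X * P) (J f) = (1 - J) (aeval J (X ^ 2 * P) f) := by
      have e1 : J f = aeval J (X : ℝ[X]) f := by simp
      have e2 : (1 - J) = aeval J (1 - X : ℝ[X]) := by simp
      rw [e1, e2, hm, hm]; congr 2; ring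
    rw [this]
    simpa using (1 - J).le_of_opNorm_le (norm_one_sub_comp_adjoint_le j hj) _
  have h2 : adjoint j (aeval J P (J (j g))) = aeval (adjoint j ∘L j) (X ^ 2 * P) g := by
    have e1 : J (j g) = j ((adjoint j ∘L j) g) := rfl
    rw [e1, ← aeval_intertwine (adjoint j ∘L j) J j (fun _ => rfl), ← comp_apply]
    have e2 : (adjoint j ∘L j) = aeval (adjoint j ∘L j) (X : ℝ[X]) := by simp
    set S := adjoint j ∘L j
    have hm' : ∀ (p q : ℝ[X]) (x : E), aeval S p (aeval S q x) = aeval S (p * q) x :=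
      fun p q x => by rw [map_mul, mul_apply_eq_comp]
    calc S (aeval S P (S g)) = aeval S X (aeval S P (aeval S (X : ℝ[X]) g)) := by simp
      _ = _ := by rw [hm', hm']; congr 2; ring
  have h3 := norm_comp_le_of_opNorm_le_one j hj (adjoint j (aeval J P (J (φ' t))))
  rw [h2] at h
  refine (sq_le_sq₀ (norm_nonneg _) (by positivity)).1 ?_
  have h4 := norm_nonneg (j (adjoint j (aeval J P (J (φ' t)))))
  have h5 := norm_nonneg (aeval J ((1 - X) * X * P) (J f))
  have h6 : 0 ≤ ‖aeval J (X ^ 2 * P) f‖ * ‖aeval (adjoint j ∘L j) (X ^ 2 * P) g‖ := by positivity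
  nlinarith [sq_nonneg ‖j (aeval (adjoint j ∘L j) (X ^ 2 * P) g)‖]

/-- Solutions of the abstract wave equation with regular data stay in the range of the
resolvent `j ∘L adjoint j`, with continuous preimages. -/
theorem exists_continuousOn_preimage (j : E →L[ℂ] K) (hj : ‖j‖ ≤ 1)
    (hinj : Function.Injective j) (φ φ' : ℝ → K)
    (hφ : ∀ t, 0 ≤ t → HasDerivWithinAt φ (φ' t) (Ici 0) t)
    (hJ : ∀ t, 0 ≤ t → HasDerivWithinAt (fun s => (j ∘L adjoint j) (φ' s))
      ((j ∘L adjoint j) (φ t) - φ t) (Ici 0) t)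
    (hr : ∀ t, 0 ≤ t → φ t ∈ Set.range j)
    (f : K) (g : E) (hf : φ 0 = (j ∘L adjoint j) f) (hg : φ' 0 = j g) :
    ∃ θ : ℝ → K, ContinuousOn θ (Ici 0) ∧ ∀ t, 0 ≤ t → φ t = (j ∘L adjoint j) (θ t) := by
  set J := j ∘L adjoint j with hJdef
  -- A component of `f` in the kernel of `J` does not affect `J f`, so it can be removed; afterwards
  -- the ergodic theorem applies to `f`.
  wlog hfo : ∀ y, J y = 0 → inner ℂ y f = 0 generalizing f
  · refine this (f - J.ker.orthogonalProjectionOnto f) ?_ ?_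
    · have h1 := (J.ker.orthogonalProjectionOnto f).2
      rw [LinearMap.mem_ker] at h1
      have h1' : J (J.ker.orthogonalProjectionOnto f : K) = 0 := h1
      rw [hf, map_sub, h1', sub_zero]
    · intro y hy
      exact (Submodule.mem_orthogonal _ _).1
        (J.ker.sub_starProjection_mem_orthogonal f) y hy
  have hS1 : ‖1 - adjoint j ∘L j‖ ≤ 1 := by
    have := norm_one_sub_comp_adjoint_le (adjoint j) (by simpa using hj)
    rwa [adjoint_adjoint] at this
  have hJ1 := norm_one_sub_comp_adjoint_le j hj
  -- Injectivity of `j` makes `j* j` injective, so orthogonality to its kernel is automatic for `g`.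
  have hkerS : ∀ y, (adjoint j ∘L j) y = 0 → inner ℂ y g = 0 := by
    intro y hy
    have : ‖j y‖ ^ 2 = 0 := by
      rw [← inner_self_eq_norm_sq (𝕜 := ℂ), ← adjoint_inner_left]
      have : adjoint j (j y) = 0 := hy
      simp [this]
    have h0 : j y = 0 := by simpa using this
    rw [hinj (h0.trans (map_zero j).symm), inner_zero_left]
  have hkerJ : ∀ y, J y = 0 → adjoint j y = 0 := by
    intro y hy
    have : ‖adjoint j y‖ ^ 2 = 0 := by
      rw [← inner_self_eq_norm_sq (𝕜 := ℂ), adjoint_inner_left]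
      have : j (adjoint j y) = 0 := hy
      simp [this]
    simpa using this
  have hlf := (tendsto_aeval_ergodicPoly_sq J hJ1 f hfo).cauchySeq
  have hlg := (tendsto_aeval_ergodicPoly_sq _ hS1 g hkerS).cauchySeq
  -- With `ergodicQuot k ^ 2` in place of `J⁻²`, this is a bounded substitute for `J⁻¹(1 - J) φ = A
  -- φ`.
  let θ : ℕ → ℝ → K := fun k t => aeval J ((1 - X) * X * ergodicQuot k ^ 2) (φ t)
  have hX : ∀ k, X ^ 2 * ergodicQuot k ^ 2 = ergodicPoly k ^ 2 := fun k => by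
    rw [← mul_pow, X_mul_ergodicQuot]
  have hcau : UniformCauchySeqOn θ atTop (Ici 0) := by
    rw [Metric.uniformCauchySeqOn_iff]
    intro ε hε
    obtain ⟨N1, h1⟩ := Metric.cauchySeq_iff.1 hlf (ε / 2) (by positivity)
    obtain ⟨N2, h2⟩ := Metric.cauchySeq_iff.1 hlg (ε / 2) (by positivity)
    refine ⟨max N1 N2, fun m hm k hk t ht => ?_⟩
    -- The estimate holds for every polynomial, hence for the difference of two approximants, and
    -- its right side is independent of `t`.
    have h3 := abstract_energy_estimate j hj φ φ' hφ hJ f g hf hg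
      (ergodicQuot m ^ 2 - ergodicQuot k ^ 2) t ht
    have h4 := h1 m (le_of_max_le_left hm) k (le_of_max_le_left hk)
    have h5 := h2 m (le_of_max_le_right hm) k (le_of_max_le_right hk)
    rw [mul_sub, mul_sub, hX, hX, map_sub, map_sub, map_sub, sub_apply, sub_apply,
      sub_apply] at h3
    rw [dist_eq_norm] at h4 h5 ⊢
    exact h3.trans_lt (by linarith)
  have hpt : ∀ t ∈ Ici (0 : ℝ), ∃ y, Tendsto (fun k => θ k t) atTop (𝓝 y) := fun t ht =>
    cauchySeq_tendsto_of_complete (hcau.cauchySeq ht)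
  choose! θ₀ hθ₀ using hpt
  have hunif : TendstoUniformlyOn θ θ₀ atTop (Ici 0) :=
    hcau.tendstoUniformlyOn_of_tendsto hθ₀
  have hφc : ContinuousOn φ (Ici 0) := fun t ht => (hφ t ht).continuousWithinAt
  have hθc : ContinuousOn θ₀ (Ici 0) :=
    hunif.continuousOn (Frequently.of_forall fun k =>
      (aeval J ((1 - X) * X * ergodicQuot k ^ 2)).continuous.comp_continuousOn hφc)
  -- The limit `θ₀` stands for `A φ`, so the preimage under `(1 + A)⁻¹` is `θ₀ + φ`.
  refine ⟨fun t => θ₀ t + φ t, hθc.add hφc, fun t ht => ?_⟩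
  have hl1 : Tendsto (fun k => J (θ k t)) atTop (𝓝 (J (θ₀ t))) :=
    (J.continuous.tendsto _).comp (hθ₀ t ht)
  -- The kernel of `J` equals that of `j*`, which is orthogonal to the range of `j`. This is where
  -- `hr` enters.
  have horth : ∀ y, J y = 0 → inner ℂ y (φ t) = 0 := by
    intro y hy
    obtain ⟨e, he⟩ := hr t ht
    rw [← he, ← adjoint_inner_left, hkerJ y hy, inner_zero_left]
  have hl2 : Tendsto (fun k => (1 - J) (aeval J (ergodicPoly k ^ 2) (φ t))) atTop
      (𝓝 ((1 - J) (φ t))) :=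
    ((1 - J).continuous.tendsto _).comp (tendsto_aeval_ergodicPoly_sq J hJ1 (φ t) horth)
  have heq : ∀ k, J (θ k t) = (1 - J) (aeval J (ergodicPoly k ^ 2) (φ t)) := by
    intro k
    have hm : ∀ (p q : ℝ[X]) (x : K), aeval J p (aeval J q x) = aeval J (p * q) x :=
      fun p q x => by rw [map_mul, mul_apply_eq_comp]
    have e2 : (1 - J) = aeval J (1 - X : ℝ[X]) := by simp
    have e1 : ∀ x, J x = aeval J (X : ℝ[X]) x := by simp
    rw [e1, e2, hm, hm, ← hX]; congr 2; ring
  simp only [heq] at hl1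
  have := tendsto_nhds_unique hl1 hl2
  simp only [map_add, this, sub_apply]
  abel

end AbstractWaveEnergy

end

end TaubWave

namespace TaubWave

noncomputable section

/-! ### Product rule for primitives of integrable functions -/

section BilinearProduct

variable {X Y Z : Type*} [NormedAddCommGroup X] [NormedSpace ℝ X] [CompleteSpace X]
  [NormedAddCommGroup Y] [NormedSpace ℝ Y] [NormedAddCommGroup Z] [NormedSpace ℝ Z]
  [CompleteSpace Z]

/-- Product rule for a primitive of an integrable function and a `C¹` function. -/
theorem bilinear_sub_eq_integral (B : X →L[ℝ] Y →L[ℝ] Z) {a b : ℝ} (hab : a ≤ b)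
    {q Q : ℝ → X} {V V' : ℝ → Y} (hq : IntervalIntegrable q volume a b)
    (hQ : ∀ z ∈ Icc a b, Q z = Q a + ∫ t in a..z, q t)
    (hV : ∀ z ∈ Icc a b, HasDerivAt V (V' z) z) (hV' : ContinuousOn V' (Icc a b)) :
    B (Q b) (V b) - B (Q a) (V a) = ∫ z in a..b, (B (q z) (V z) + B (Q z) (V' z)) := by
  have hVc : ContinuousOn V (Icc a b) := fun z hz => (hV z hz).continuousAt.continuousWithinAt
  obtain ⟨C₀, hC₀⟩ := isCompact_Icc.exists_bound_of_continuousOn hVc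
  obtain ⟨C₁, hC₁⟩ := isCompact_Icc.exists_bound_of_continuousOn hV'
  have hC₀n : 0 ≤ C₀ := (norm_nonneg _).trans (hC₀ a ⟨le_rfl, hab⟩)
  have hC₁n : 0 ≤ C₁ := (norm_nonneg _).trans (hC₁ a ⟨le_rfl, hab⟩)
  have hprim : ∀ {f : ℝ → X}, IntervalIntegrable f volume a b →
      ContinuousOn (fun z => ∫ t in a..z, f t) (Icc a b) := by
    intro f hf
    have := intervalIntegral.continuousOn_primitive_interval' hf left_mem_uIcc
    rwa [uIcc_of_le hab] at this
  have hB1 : ∀ {f : ℝ → X}, IntervalIntegrable f volume a b →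
      IntervalIntegrable (fun z => B (f z) (V z)) volume a b := by
    intro f hf
    rw [intervalIntegrable_iff_integrableOn_Ioc_of_le hab] at hf ⊢
    have hVm : AEStronglyMeasurable V (volume.restrict (Ioc a b)) :=
      (hVc.mono Ioc_subset_Icc_self).aestronglyMeasurable measurableSet_Ioc
    refine Integrable.mono' (hf.norm.const_mul (‖B‖ * C₀))
      (B.aestronglyMeasurable_comp₂ hf.1 hVm) ?_
    refine (ae_restrict_mem measurableSet_Ioc).mono fun z hz => ?_
    refine (B.le_opNorm₂ _ _).trans ?_
    have := hC₀ z (Ioc_subset_Icc_self hz)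
    calc ‖B‖ * ‖f z‖ * ‖V z‖ ≤ ‖B‖ * ‖f z‖ * C₀ := by gcongr
      _ = _ := by ring
  have hB2 : ∀ {f : ℝ → X}, ContinuousOn f (Icc a b) →
      IntervalIntegrable (fun z => B (f z) (V' z)) volume a b := by
    intro f hf
    refine ContinuousOn.intervalIntegrable ?_
    rw [uIcc_of_le hab]
    exact (B.continuous.comp_continuousOn hf).clm_apply hV'
  have hQc : ContinuousOn Q (Icc a b) :=
    (continuousOn_const.add (hprim hq)).congr hQ
  rw [← sub_eq_zero]
  refine norm_le_zero_iff.1 (le_of_forall_pos_le_add fun ε hε => ?_)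
  rw [zero_add]
  -- `M - 1` is the total factor with which an `L¹` error in `q` enters the identity; the added `1`
  -- keeps `M` positive.
  set M : ℝ := ‖B‖ * C₀ + (‖B‖ * C₀ + ‖B‖ * C₁ * (b - a)) + 1 with hM
  have hba : 0 ≤ b - a := sub_nonneg.2 hab
  have hMpos : 0 < M := by positivity
  have hqi : Integrable ((Ioc a b).indicator q) volume :=
    (integrable_indicator_iff measurableSet_Ioc).2
      ((intervalIntegrable_iff_integrableOn_Ioc_of_le hab).1 hq)
  -- `Q` is only absolutely continuous. Replacing `q` by a continuous `g` close to it in `L¹` gives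
  -- a differentiable primitive `G`, for which the fundamental theorem of calculus applies; the
  -- remainder `r = q - g` is then estimated term by term.
  obtain ⟨g, -, hg, hgc, hgi⟩ := hqi.exists_hasCompactSupport_integral_sub_le
    (ε := ε / M) (by positivity)
  have hgI : ∀ c d, IntervalIntegrable g volume c d := fun c d => hgc.intervalIntegrable c d
  set r : ℝ → X := fun z => q z - g z with hr
  have hri : IntervalIntegrable r volume a b := hq.sub (hgI a b)
  have hrn : ∫ z in a..b, ‖r z‖ ≤ ε / M := by
    refine le_trans ?_ hg
    rw [intervalIntegral.integral_of_le hab]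
    calc ∫ z in Ioc a b, ‖r z‖ = ∫ z in Ioc a b, ‖(Ioc a b).indicator q z - g z‖ := by
          refine setIntegral_congr_fun measurableSet_Ioc fun z hz => ?_
          simp [hr, indicator_of_mem hz]
      _ ≤ _ := setIntegral_le_integral (hqi.sub hgi).norm (Eventually.of_forall fun _ => norm_nonneg _)
  set G : ℝ → X := fun z => Q a + ∫ t in a..z, g t with hG
  have hGd : ∀ z, HasDerivAt G (g z) z := fun z =>
    (intervalIntegral.integral_hasDerivAt_right (hgI a z)
      hgc.stronglyMeasurable.stronglyMeasurableAtFilter hgc.continuousAt).const_add _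
  have hGc : ContinuousOn G (Icc a b) := fun z _ => (hGd z).continuousAt.continuousWithinAt
  have hGa : G a = Q a := by simp [hG]
  have hIG : B (G b) (V b) - B (G a) (V a) = ∫ z in a..b, (B (g z) (V z) + B (G z) (V' z)) := by
    symm
    refine intervalIntegral.integral_eq_sub_of_hasDerivAt (f := fun z => B (G z) (V z))
      (fun z hz => ?_) ((hB1 (hgI a b)).add (hB2 hGc))
    rw [uIcc_of_le hab] at hz
    have := B.hasFDerivAt_of_bilinear (hGd z).hasFDerivAt (hV z hz).hasFDerivAt
    have h2 := this.hasDerivAt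
    simpa [add_comm] using h2
  set R : ℝ → X := fun z => ∫ t in a..z, r t with hR
  have hRc : ContinuousOn R (Icc a b) := hprim hri
  have hQG : ∀ z ∈ Icc a b, Q z = G z + R z := by
    intro z hz
    have h1 : IntervalIntegrable q volume a z := hq.mono_set (by
      rw [uIcc_of_le hab, uIcc_of_le hz.1]; exact Icc_subset_Icc_right hz.2)
    rw [hQ z hz, hG, hR, hr]
    simp only
    rw [intervalIntegral.integral_sub h1 (hgI a z)]
    abel
  have hRn : ∀ z ∈ Icc a b, ‖R z‖ ≤ ε / M := by
    intro z hz
    refine (intervalIntegral.norm_integral_le_integral_norm hz.1).trans (le_trans ?_ hrn)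
    exact intervalIntegral.integral_mono_interval le_rfl hz.1 hz.2
      (Eventually.of_forall fun _ => norm_nonneg _) hri.norm
  have hsplit : B (Q b) (V b) - B (Q a) (V a) - ∫ z in a..b, (B (q z) (V z) + B (Q z) (V' z))
      = B (R b) (V b) - ((∫ z in a..b, B (r z) (V z)) + ∫ z in a..b, B (R z) (V' z)) := by
    have e1 : ∫ z in a..b, (B (q z) (V z) + B (Q z) (V' z))
        = ∫ z in a..b, ((B (g z) (V z) + B (G z) (V' z)) + (B (r z) (V z) + B (R z) (V' z))) := by
      refine intervalIntegral.integral_congr fun z hz => ?_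
      rw [uIcc_of_le hab] at hz
      simp only [hQG z hz, hr, map_add, map_sub, add_apply, sub_apply]
      abel
    rw [e1, intervalIntegral.integral_add ((hB1 (hgI a b)).add (hB2 hGc)) ((hB1 hri).add (hB2 hRc)),
      ← hIG, intervalIntegral.integral_add (hB1 hri) (hB2 hRc), hQG b ⟨hab, le_rfl⟩, hGa]
    simp only [map_add, add_apply]
    abel
  rw [hsplit]
  have b1 : ‖B (R b) (V b)‖ ≤ ‖B‖ * C₀ * (ε / M) := by
    refine (B.le_opNorm₂ _ _).trans ?_
    have h1 := hRn b ⟨hab, le_rfl⟩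
    have h2 := hC₀ b ⟨hab, le_rfl⟩
    calc ‖B‖ * ‖R b‖ * ‖V b‖ ≤ ‖B‖ * (ε / M) * C₀ := by gcongr
      _ = _ := by ring
  have b2 : ‖∫ z in a..b, B (r z) (V z)‖ ≤ ‖B‖ * C₀ * (ε / M) := by
    refine (intervalIntegral.norm_integral_le_integral_norm hab).trans ?_
    calc ∫ z in a..b, ‖B (r z) (V z)‖ ≤ ∫ z in a..b, ‖B‖ * C₀ * ‖r z‖ := by
          refine intervalIntegral.integral_mono_on hab (hB1 hri).norm (hri.norm.const_mul _)
            fun z hz => (B.le_opNorm₂ _ _).trans ?_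
          have := hC₀ z hz
          calc ‖B‖ * ‖r z‖ * ‖V z‖ ≤ ‖B‖ * ‖r z‖ * C₀ := by gcongr
            _ = _ := by ring
      _ ≤ _ := by rw [intervalIntegral.integral_const_mul]; gcongr
  have b3 : ‖∫ z in a..b, B (R z) (V' z)‖ ≤ ‖B‖ * C₁ * (b - a) * (ε / M) := by
    refine (intervalIntegral.norm_integral_le_of_norm_le_const (C := ‖B‖ * (ε / M) * C₁)
      fun z hz => ?_).trans ?_
    · rw [uIoc_of_le hab] at hz
      have hz' := Ioc_subset_Icc_self hz
      have h1 := hRn z hz'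
      have h2 := hC₁ z hz'
      exact (B.le_opNorm₂ _ _).trans (by gcongr)
    · rw [abs_of_nonneg hba]; exact le_of_eq (by ring)
  calc _ ≤ ‖B‖ * C₀ * (ε / M) + (‖B‖ * C₀ * (ε / M) + ‖B‖ * C₁ * (b - a) * (ε / M)) :=
        (norm_sub_le _ _).trans (add_le_add b1 ((norm_add_le _ _).trans (add_le_add b2 b3)))
    _ = (M - 1) * (ε / M) := by rw [hM]; ring
    _ ≤ M * (ε / M) := by
        have : 0 < ε / M := by positivity
        nlinarith
    _ = ε := by field_simp

end BilinearProduct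

end

end TaubWave

namespace TaubWave

noncomputable section

/-! ### The vertical system: vanishing flux and boundary values -/

section RadialSystem

theorem integral_mul_le_sqrt_mul_sqrt {α : Type*} [MeasurableSpace α] {μ : Measure α}
    {f g : α → ℝ} (hf0 : ∀ᵐ x ∂μ, 0 ≤ f x) (hg0 : ∀ᵐ x ∂μ, 0 ≤ g x)
    (hf : AEStronglyMeasurable f μ) (hg : AEStronglyMeasurable g μ)
    (hf2 : Integrable (fun x => f x ^ 2) μ) (hg2 : Integrable (fun x => g x ^ 2) μ) :
    ∫ x, f x * g x ∂μ ≤ √(∫ x, f x ^ 2 ∂μ) * √(∫ x, g x ^ 2 ∂μ) := by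
  have h2 : ENNReal.ofReal 2 = 2 := by norm_num
  have := integral_mul_le_Lp_mul_Lq_of_nonneg Real.HolderConjugate.two_two hf0 hg0
    (by rw [h2]; exact (memLp_two_iff_integrable_sq hf).2 hf2)
    (by rw [h2]; exact (memLp_two_iff_integrable_sq hg).2 hg2)
  simpa [Real.sqrt_eq_rpow] using this

variable {X : Type*} [NormedAddCommGroup X] [InnerProductSpace ℂ X] [CompleteSpace X]

/-- The system `z V' = Q`, `Q' = z ^ (-ν) K V - z F` on `(0, ∞)`, with finite energy. -/
structure RadialSystem (ν : ℝ) (K : X →L[ℂ] X) (V Q F : ℝ → X) : Prop where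
  hasDerivAt : ∀ z, 0 < z → HasDerivAt V (z⁻¹ • Q z) z
  sub_eq_integral : ∀ a b, 0 < a → a ≤ b →
    Q b - Q a = ∫ z in a..b, (z ^ (-ν) • K (V z) - z • F z)
  source_aesm : AEStronglyMeasurable F (volume.restrict (Ioi 0))
  vertical : IntegrableOn (fun z => z⁻¹ * ‖Q z‖ ^ 2) (Ioi 0)
  horizontal : IntegrableOn (fun z => z ^ (-ν) * (inner ℂ (K (V z)) (V z)).re) (Ioi 0)
  mass : IntegrableOn (fun z => z * ‖V z‖ ^ 2) (Ioi 0)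
  source : IntegrableOn (fun z => z * ‖F z‖ ^ 2) (Ioi 0)

namespace RadialSystem

variable {ν R : ℝ} {K : X →L[ℂ] X} {V Q F : ℝ → X}

theorem continuousOn (h : RadialSystem ν K V Q F) : ContinuousOn V (Ioi 0) :=
  fun z hz => (h.hasDerivAt z hz).continuousAt.continuousWithinAt

theorem continuousOn_rpow (ν : ℝ) : ContinuousOn (fun z : ℝ => z ^ ν) (Ioi 0) :=
  fun z hz => (Real.continuousAt_rpow_const z ν (Or.inl (ne_of_gt hz))).continuousWithinAt

theorem aesm_left (h : RadialSystem ν K V Q F) :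
    AEStronglyMeasurable (fun z => z ^ (-ν) * ‖K (V z)‖ ^ 2) (volume.restrict (Ioi 0)) :=
  ((continuousOn_rpow _).mul
    ((K.continuous.comp_continuousOn h.continuousOn).norm.pow 2)).aestronglyMeasurable
    measurableSet_Ioi

/-- The hypothesis `hK` expresses `K² ≤ R K`. It converts the horizontal energy, which is quadratic
through `⟨K V, V⟩`, into a weighted bound of `K V` itself. -/
theorem integrableOn_K (h : RadialSystem ν K V Q F)
    (hK : ∀ x, ‖K x‖ ^ 2 ≤ R * (inner ℂ (K x) x).re) :
    IntegrableOn (fun z => z ^ (-ν) * ‖K (V z)‖ ^ 2) (Ioi 0) := by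
  refine Integrable.mono' (h.horizontal.const_mul R) h.aesm_left ?_
  refine (ae_restrict_mem measurableSet_Ioi).mono fun z hz => ?_
  have hz' : (0 : ℝ) < z := hz
  rw [Real.norm_of_nonneg (by positivity)]
  calc z ^ (-ν) * ‖K (V z)‖ ^ 2 ≤ z ^ (-ν) * (R * (inner ℂ (K (V z)) (V z)).re) := by
        gcongr; exact hK _
    _ = _ := by ring

theorem integral_K_le (h : RadialSystem ν K V Q F)
    (hK : ∀ x, ‖K x‖ ^ 2 ≤ R * (inner ℂ (K x) x).re) :
    ∫ z in Ioi 0, z ^ (-ν) * ‖K (V z)‖ ^ 2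
      ≤ R * ∫ z in Ioi 0, z ^ (-ν) * (inner ℂ (K (V z)) (V z)).re := by
  rw [← integral_const_mul]
  refine setIntegral_mono_on (h.integrableOn_K hK) (h.horizontal.const_mul R) measurableSet_Ioi
    fun z hz => ?_
  have hz' : (0 : ℝ) < z := hz
  calc z ^ (-ν) * ‖K (V z)‖ ^ 2 ≤ z ^ (-ν) * (R * (inner ℂ (K (V z)) (V z)).re) := by
        gcongr; exact hK _
    _ = _ := by ring

/-- Use `‖K V‖ ≤ ‖K V‖² + 1`: the first term is controlled by the energy, and the second leaves `z ^
(-ν)`, integrable at `0` because `ν < 1`. -/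
theorem integrableOn_left (h : RadialSystem ν K V Q F) (hν : ν < 1)
    (hK : ∀ x, ‖K x‖ ^ 2 ≤ R * (inner ℂ (K x) x).re) (b : ℝ) :
    IntegrableOn (fun z => z ^ (-ν) • K (V z)) (Ioc 0 b) := by
  have h1 := (h.integrableOn_K hK).mono_set (fun _ hx => hx.1 : Ioc 0 b ⊆ Ioi 0)
  have h2 : IntegrableOn (fun z : ℝ => z ^ (-ν)) (Ioc 0 b) := by
    rcases le_total 0 b with hb | hb
    · exact (intervalIntegrable_iff_integrableOn_Ioc_of_le hb).1
        (intervalIntegral.intervalIntegrable_rpow' (by linarith))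
    · simp [Ioc_eq_empty_of_le hb]
  refine Integrable.mono' (h1.add h2) ?_ ?_
  · refine (ContinuousOn.aestronglyMeasurable (μ := volume) (ContinuousOn.smul
      (continuousOn_rpow _) (K.continuous.comp_continuousOn h.continuousOn))
      measurableSet_Ioi).mono_measure ?_
    exact Measure.restrict_mono (μ := volume) (fun _ hx => hx.1 : Ioc 0 b ⊆ Ioi 0) le_rfl
  · refine (ae_restrict_mem measurableSet_Ioc).mono fun z hz => ?_
    have hz' : (0 : ℝ) < z := hz.1
    have hp : 0 < z ^ (-ν) := Real.rpow_pos_of_pos hz' _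
    rw [norm_smul, Real.norm_of_nonneg hp.le]
    simp only [Pi.add_apply]
    nlinarith [sq_nonneg (‖K (V z)‖ - 1), norm_nonneg (K (V z))]

theorem integrableOn_right (h : RadialSystem ν K V Q F) (b : ℝ) :
    IntegrableOn (fun z => z • F z) (Ioc 0 b) := by
  have h1 := h.source.mono_set (fun _ hx => hx.1 : Ioc 0 b ⊆ Ioi 0)
  have h2 : IntegrableOn (fun z : ℝ => z) (Ioc 0 b) := by
    rcases le_total 0 b with hb | hb
    · exact (intervalIntegrable_iff_integrableOn_Ioc_of_le hb).1
        (continuous_id.intervalIntegrable _ _)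
    · simp [Ioc_eq_empty_of_le hb]
  have hm : AEStronglyMeasurable F (volume.restrict (Ioc 0 b)) :=
    h.source_aesm.mono_measure (Measure.restrict_mono Ioc_subset_Ioi_self le_rfl)
  refine Integrable.mono' (h1.add h2) (aestronglyMeasurable_id.smul hm) ?_
  refine (ae_restrict_mem measurableSet_Ioc).mono fun z hz => ?_
  have hz' : (0 : ℝ) < z := hz.1
  rw [norm_smul, Real.norm_of_nonneg hz'.le]
  simp only [Pi.add_apply]
  nlinarith [sq_nonneg (‖F z‖ - 1), norm_nonneg (F z)]

theorem intervalIntegrable_rhs (h : RadialSystem ν K V Q F) (hν : ν < 1)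
    (hK : ∀ x, ‖K x‖ ^ 2 ≤ R * (inner ℂ (K x) x).re) {a b : ℝ} (ha : 0 ≤ a) (hb : 0 ≤ b) :
    IntervalIntegrable (fun z => z ^ (-ν) • K (V z) - z • F z) volume a b := by
  have : ∀ c, 0 ≤ c → IntervalIntegrable (fun z => z ^ (-ν) • K (V z) - z • F z) volume 0 c :=
    fun c hc => (intervalIntegrable_iff_integrableOn_Ioc_of_le hc).2
      ((h.integrableOn_left hν hK c).sub (h.integrableOn_right c))
  exact (this a ha).symm.trans (this b hb)

/-- `Q'` is integrable near `0`, so `Q` has a limit there. A nonzero limit would make `z⁻¹ ‖Q‖²`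
comparable to `z⁻¹`, which is not integrable. The natural boundary condition thus follows from
finite energy. -/
theorem tendsto_Q (h : RadialSystem ν K V Q F) (hν : ν < 1)
    (hK : ∀ x, ‖K x‖ ^ 2 ≤ R * (inner ℂ (K x) x).re) :
    Tendsto Q (𝓝[>] 0) (𝓝 0) := by
  set q := fun z => z ^ (-ν) • K (V z) - z • F z with hq
  have hlim : Tendsto Q (𝓝[>] 0) (𝓝 (Q 1 - ∫ z in (0)..1, q z)) := by
    have hc : ContinuousOn (fun z => ∫ t in z..1, q t) (Icc 0 1) := by
      have := intervalIntegral.continuousOn_primitive_interval' (a := 1)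
        (h.intervalIntegrable_rhs hν hK le_rfl zero_le_one) right_mem_uIcc
      rw [uIcc_of_le zero_le_one] at this
      refine this.neg.congr fun z _ => ?_
      exact intervalIntegral.integral_symm _ _
    have hc0 := (hc 0 (by simp)).tendsto
    have hc1 : Tendsto (fun z => ∫ t in z..1, q t) (𝓝[>] 0) (𝓝 (∫ t in (0)..1, q t)) := by
      rw [← nhdsWithin_Ioc_eq_nhdsGT zero_lt_one]
      exact hc0.mono_left (nhdsWithin_mono _ Ioc_subset_Icc_self)
    refine (tendsto_const_nhds.sub hc1).congr' ?_
    filter_upwards [Ioc_mem_nhdsGT zero_lt_one] with z hz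
    rw [← h.sub_eq_integral z 1 hz.1 hz.2]; abel
  set Q₀ := Q 1 - ∫ z in (0)..1, q z
  suffices Q₀ = 0 by rwa [this] at hlim
  by_contra hne
  have hev : ∀ᶠ z in 𝓝[>] (0 : ℝ), ‖Q₀‖ / 2 < ‖Q z‖ :=
    hlim.norm.eventually_const_lt (half_lt_self (norm_pos_iff.2 hne))
  obtain ⟨ε, hε, hsub⟩ := (mem_nhdsGT_iff_exists_Ioc_subset).1 hev
  have hε' : (0 : ℝ) < ε := hε
  have hpos : 0 < (‖Q₀‖ / 2) ^ 2 := by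
    have := norm_pos_iff.2 hne
    positivity
  have hint : IntegrableOn (fun z : ℝ => z⁻¹) (Ioc 0 ε) := by
    refine Integrable.mono' ((h.vertical.mono_set Ioc_subset_Ioi_self).const_mul
      ((‖Q₀‖ / 2) ^ 2)⁻¹) measurable_inv.aestronglyMeasurable ?_
    refine (ae_restrict_mem measurableSet_Ioc).mono fun z hz => ?_
    have hz' : (0 : ℝ) < z := hz.1
    have h1 : ‖Q₀‖ / 2 < ‖Q z‖ := hsub hz
    have h2 : (‖Q₀‖ / 2) ^ 2 ≤ ‖Q z‖ ^ 2 := by gcongr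
    rw [Real.norm_of_nonneg (by positivity), inv_mul_eq_div, le_div_iff₀ hpos]
    gcongr
  have := (intervalIntegrable_iff_integrableOn_Ioc_of_le hε'.le).2 hint
  rw [intervalIntegrable_inv_iff] at this
  rcases this with h0 | h0
  · exact hε'.ne h0
  · exact h0 left_mem_uIcc

theorem Q_eq_integral (h : RadialSystem ν K V Q F) (hν : ν < 1)
    (hK : ∀ x, ‖K x‖ ^ 2 ≤ R * (inner ℂ (K x) x).re) {z : ℝ} (hz : 0 < z) :
    Q z = ∫ t in (0)..z, (t ^ (-ν) • K (V t) - t • F t) := by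
  set q := fun z => z ^ (-ν) • K (V z) - z • F z with hq
  have hc : ContinuousOn (fun x => ∫ t in x..z, q t) (Icc 0 z) := by
    have := intervalIntegral.continuousOn_primitive_interval' (a := z)
      (h.intervalIntegrable_rhs hν hK le_rfl hz.le) right_mem_uIcc
    rw [uIcc_of_le hz.le] at this
    refine this.neg.congr fun z _ => ?_
    exact intervalIntegral.integral_symm _ _
  have hc1 : Tendsto (fun x => ∫ t in x..z, q t) (𝓝[>] 0) (𝓝 (∫ t in (0)..z, q t)) := by
    rw [← nhdsWithin_Ioc_eq_nhdsGT hz]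
    exact ((hc 0 ⟨le_rfl, hz.le⟩).tendsto).mono_left (nhdsWithin_mono _ Ioc_subset_Icc_self)
  refine tendsto_nhds_unique (f := fun x => Q z - Q x) ?_ (hc1.congr' ?_)
  · simpa using tendsto_const_nhds.sub (h.tendsto_Q hν hK)
  · filter_upwards [Ioc_mem_nhdsGT hz] with x hx
    rw [← h.sub_eq_integral x z hx.1 hx.2]

/-- Integrate `Q'` from the boundary, where `Q` vanishes, and apply Cauchy-Schwarz against the
weights `t ^ (-ν)` and `t`. -/
theorem norm_Q_le (h : RadialSystem ν K V Q F) (hν0 : 0 ≤ ν) (hν : ν ≤ 1 / 2)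
    (hK : ∀ x, ‖K x‖ ^ 2 ≤ R * (inner ℂ (K x) x).re) {z : ℝ} (hz : 0 < z) :
    ‖Q z‖ ≤ 2 * z ^ ((1 - ν) / 2) * √(∫ z in Ioi 0, z ^ (-ν) * ‖K (V z)‖ ^ 2)
      + z * √(∫ z in Ioi 0, z * ‖F z‖ ^ 2) := by
  have hν1 : ν < 1 := by linarith
  have hI1 := h.integrableOn_left hν1 hK z
  have hI2 := h.integrableOn_right z
  have hIK := (h.integrableOn_K hK)
  have hr : IntegrableOn (fun t : ℝ => t ^ (-ν)) (Ioc 0 z) :=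
    (intervalIntegrable_iff_integrableOn_Ioc_of_le hz.le).1
        (intervalIntegral.intervalIntegrable_rpow' (by linarith))
  have hid : IntegrableOn (fun t : ℝ => t) (Ioc 0 z) :=
    (intervalIntegrable_iff_integrableOn_Ioc_of_le hz.le).1
        (continuous_id.intervalIntegrable _ _)
  have hsub : Ioc 0 z ⊆ Ioi 0 := Ioc_subset_Ioi_self
  have hmono : volume.restrict (Ioc 0 z) ≤ volume.restrict (Ioi 0) :=
    Measure.restrict_mono hsub le_rfl
  have e1 : ∀ t ∈ Ioc 0 z, (t ^ (-ν / 2)) ^ 2 = t ^ (-ν) := by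
    intro t ht
    rw [← Real.rpow_natCast, ← Real.rpow_mul ht.1.le]; congr 1; push_cast; ring
  have e2 : ∀ t ∈ Ioc 0 z, (t ^ (-ν / 2) * ‖K (V t)‖) ^ 2 = t ^ (-ν) * ‖K (V t)‖ ^ 2 := by
    intro t ht
    rw [mul_pow, e1 t ht]
  have b1 : ∫ t in Ioc 0 z, ‖t ^ (-ν) • K (V t)‖
      ≤ 2 * z ^ ((1 - ν) / 2) * √(∫ z in Ioi 0, z ^ (-ν) * ‖K (V z)‖ ^ 2) := by
    have hae1 : ∀ᵐ t ∂(volume.restrict (Ioc 0 z)), t ∈ Ioc 0 z := ae_restrict_mem measurableSet_Ioc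
    have i1 : IntegrableOn (fun t : ℝ => (t ^ (-ν / 2)) ^ 2) (Ioc 0 z) :=
      hr.congr_fun (fun t ht => (e1 t ht).symm) measurableSet_Ioc
    have i2 : IntegrableOn (fun t : ℝ => (t ^ (-ν / 2) * ‖K (V t)‖) ^ 2) (Ioc 0 z) :=
      (hIK.mono_set hsub).congr_fun (fun t ht => (e2 t ht).symm) measurableSet_Ioc
    have m1 : ContinuousOn (fun t : ℝ => t ^ (-ν / 2)) (Ioi 0) := continuousOn_rpow _
    have m2 : ContinuousOn (fun t : ℝ => t ^ (-ν / 2) * ‖K (V t)‖) (Ioi 0) :=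
      m1.mul (K.continuous.comp_continuousOn h.continuousOn).norm
    have := integral_mul_le_sqrt_mul_sqrt (μ := volume.restrict (Ioc 0 z))
      (hae1.mono fun t ht => Real.rpow_nonneg ht.1.le (-ν / 2))
      (hae1.mono fun t ht => mul_nonneg (Real.rpow_nonneg ht.1.le (-ν / 2)) (norm_nonneg _))
      ((m1.aestronglyMeasurable measurableSet_Ioi).mono_measure hmono)
      ((m2.aestronglyMeasurable measurableSet_Ioi).mono_measure hmono) i1 i2
    have e3 : ∫ t in Ioc 0 z, ‖t ^ (-ν) • K (V t)‖
        = ∫ t in Ioc 0 z, t ^ (-ν / 2) * (t ^ (-ν / 2) * ‖K (V t)‖) := by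
      refine setIntegral_congr_fun measurableSet_Ioc fun t ht => ?_
      rw [norm_smul, Real.norm_of_nonneg (Real.rpow_nonneg ht.1.le _), ← e1 t ht]
      ring
    rw [e3]
    refine this.trans ?_
    rw [setIntegral_congr_fun measurableSet_Ioc e1, setIntegral_congr_fun measurableSet_Ioc e2]
    have e4 : ∫ t in Ioc 0 z, t ^ (-ν) = z ^ (1 - ν) / (1 - ν) := by
      rw [← intervalIntegral.integral_of_le hz.le, integral_rpow (Or.inl (by linarith)),
        Real.zero_rpow (by linarith), sub_zero]
      congr 1 <;> ring_nf
    rw [e4]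
    -- Since `ν ≤ 1 / 2`, the factor `1 / (1 - ν)` is at most `2`, below the `4` obtained by
    -- squaring the right side.
    have e5 : √(z ^ (1 - ν) / (1 - ν)) ≤ 2 * z ^ ((1 - ν) / 2) := by
      rw [Real.sqrt_le_left (by positivity), mul_pow, ← Real.rpow_natCast (z ^ ((1 - ν) / 2)),
        ← Real.rpow_mul hz.le]
      have : (1 - ν) / 2 * ((2 : ℕ) : ℝ) = 1 - ν := by push_cast; ring
      rw [this, div_le_iff₀ (by linarith)]
      have := Real.rpow_pos_of_pos hz (1 - ν)
      nlinarith
    refine mul_le_mul e5 (Real.sqrt_le_sqrt ?_) (by positivity) (by positivity)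
    refine setIntegral_mono_set hIK ?_ (LE.le.eventuallyLE hsub)
    exact (ae_restrict_mem measurableSet_Ioi).mono fun t ht =>
      mul_nonneg (Real.rpow_nonneg (le_of_lt ht) _) (by positivity)
  have b2 : ∫ t in Ioc 0 z, ‖t • F t‖ ≤ z * √(∫ z in Ioi 0, z * ‖F z‖ ^ 2) := by
    have hae1 : ∀ᵐ t ∂(volume.restrict (Ioc 0 z)), t ∈ Ioc 0 z := ae_restrict_mem measurableSet_Ioc
    have e1 : ∀ t ∈ Ioc 0 z, (√t) ^ 2 = t := fun t ht => Real.sq_sqrt ht.1.le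
    have e2 : ∀ t ∈ Ioc 0 z, (√t * ‖F t‖) ^ 2 = t * ‖F t‖ ^ 2 := by
      intro t ht
      rw [mul_pow, e1 t ht]
    have i1 : IntegrableOn (fun t : ℝ => (√t) ^ 2) (Ioc 0 z) :=
      hid.congr_fun (fun t ht => (e1 t ht).symm) measurableSet_Ioc
    have i2 : IntegrableOn (fun t : ℝ => (√t * ‖F t‖) ^ 2) (Ioc 0 z) :=
      (h.source.mono_set hsub).congr_fun (fun t ht => (e2 t ht).symm) measurableSet_Ioc
    have m1 : AEStronglyMeasurable (fun t : ℝ => √t) (volume.restrict (Ioc 0 z)) :=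
      Real.continuous_sqrt.aestronglyMeasurable
    have := integral_mul_le_sqrt_mul_sqrt (μ := volume.restrict (Ioc 0 z))
      (hae1.mono fun t _ => Real.sqrt_nonneg t)
      (hae1.mono fun t _ => mul_nonneg (Real.sqrt_nonneg t) (norm_nonneg _))
      m1 (m1.mul (h.source_aesm.mono_measure hmono).norm) i1 i2
    have e3 : ∫ t in Ioc 0 z, ‖t • F t‖ = ∫ t in Ioc 0 z, √t * (√t * ‖F t‖) := by
      refine setIntegral_congr_fun measurableSet_Ioc fun t ht => ?_
      rw [norm_smul, Real.norm_of_nonneg ht.1.le, ← mul_assoc, Real.mul_self_sqrt ht.1.le]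
    rw [e3]
    refine this.trans ?_
    rw [setIntegral_congr_fun measurableSet_Ioc e1, setIntegral_congr_fun measurableSet_Ioc e2]
    have e4 : ∫ t in Ioc 0 z, t = z ^ 2 / 2 := by
      rw [← intervalIntegral.integral_of_le hz.le, integral_id]; ring
    rw [e4]
    have e5 : √(z ^ 2 / 2) ≤ z := by
      rw [Real.sqrt_le_left hz.le]; nlinarith [sq_nonneg z]
    refine mul_le_mul e5 (Real.sqrt_le_sqrt ?_) (by positivity) (by positivity)
    refine setIntegral_mono_set h.source ?_ (LE.le.eventuallyLE hsub)
    exact (ae_restrict_mem measurableSet_Ioi).mono fun t ht =>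
      mul_nonneg (le_of_lt ht) (by positivity)
  rw [h.Q_eq_integral hν1 hK hz, intervalIntegral.integral_of_le hz.le, integral_sub hI1 hI2]
  refine (norm_sub_le _ _).trans (add_le_add ?_ ?_)
  · exact (norm_integral_le_integral_norm _).trans b1
  · exact (norm_integral_le_integral_norm _).trans b2

/-- The modulus of continuity of `V` at the boundary. -/
theorem norm_sub_le (h : RadialSystem ν K V Q F) (hν0 : 0 ≤ ν) (hν : ν ≤ 1 / 2)
    (hK : ∀ x, ‖K x‖ ^ 2 ≤ R * (inner ℂ (K x) x).re) {w z : ℝ} (hw : 0 < w) (hwz : w ≤ z) :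
    ‖V z - V w‖ ≤
      (2 / ((1 - ν) / 2) * √(∫ z in Ioi 0, z ^ (-ν) * ‖K (V z)‖ ^ 2))
          * (z ^ ((1 - ν) / 2) - w ^ ((1 - ν) / 2))
        + √(∫ z in Ioi 0, z * ‖F z‖ ^ 2) * (z - w) := by
  set A := √(∫ z in Ioi 0, z ^ (-ν) * ‖K (V z)‖ ^ 2)
  set S := √(∫ z in Ioi 0, z * ‖F z‖ ^ 2)
  set γ := (1 - ν) / 2 with hγ
  have hγ0 : 0 < γ := by rw [hγ]; linarith
  refine image_norm_le_of_norm_deriv_right_le_deriv_boundary' (a := w) (b := z)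
    (f := fun t => V t - V w) (f' := fun t => t⁻¹ • Q t)
    (B := fun t => (2 / γ * A) * (t ^ γ - w ^ γ) + S * (t - w))
    (B' := fun t => (2 / γ * A) * (γ * t ^ (γ - 1)) + S * 1) ?_ ?_ ?_ ?_ ?_ ?_ ⟨hwz, le_rfl⟩
  · exact (h.continuousOn.mono fun t ht => hw.trans_le ht.1).sub continuousOn_const
  · exact fun t ht => ((h.hasDerivAt t (hw.trans_le ht.1)).sub_const _).hasDerivWithinAt
  · simp
  · refine ContinuousOn.add (continuousOn_const.mul (ContinuousOn.sub ?_ continuousOn_const))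
      (by fun_prop)
    exact (continuousOn_rpow γ).mono fun t ht => hw.trans_le ht.1
  · intro t ht
    have h1 := Real.hasDerivAt_rpow_const (x := t) (p := γ) (Or.inl (hw.trans_le ht.1).ne')
    exact (((h1.sub_const _).const_mul _).add (((hasDerivAt_id t).sub_const _).const_mul
      _)).hasDerivWithinAt
  · intro t ht
    have ht0 : 0 < t := hw.trans_le ht.1
    rw [norm_smul, Real.norm_of_nonneg (by positivity)]
    have := h.norm_Q_le hν0 hν hK ht0
    calc t⁻¹ * ‖Q t‖ ≤ t⁻¹ * (2 * t ^ γ * A + t * S) := by gcongr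
      _ = _ := by
        rw [Real.rpow_sub_one ht0.ne']
        field_simp

/-- The flux bound gives `‖V'‖ ≤ 2 A z ^ (γ - 1) + S` with `γ > 0`, which is integrable at `0`, so
the values of `V` near the boundary form a Cauchy filter. -/
theorem exists_tendsto (h : RadialSystem ν K V Q F) (hν0 : 0 ≤ ν) (hν : ν ≤ 1 / 2)
    (hK : ∀ x, ‖K x‖ ^ 2 ≤ R * (inner ℂ (K x) x).re) :
    ∃ V₀, Tendsto V (𝓝[>] 0) (𝓝 V₀) := by
  set A := √(∫ z in Ioi 0, z ^ (-ν) * ‖K (V z)‖ ^ 2) with hA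
  set S := √(∫ z in Ioi 0, z * ‖F z‖ ^ 2) with hS
  set γ := (1 - ν) / 2 with hγ
  have hγ0 : 0 < γ := by rw [hγ]; linarith
  have hAn : 0 ≤ A := Real.sqrt_nonneg _
  have hSn : 0 ≤ S := Real.sqrt_nonneg _
  have hb : ∀ w z, 0 < w → 0 < z → ∀ e, w ≤ e → z ≤ e →
      ‖V z - V w‖ ≤ (2 / γ * A) * e ^ γ + S * e := by
    have key : ∀ w z, 0 < w → w ≤ z → ∀ e, z ≤ e →
        ‖V z - V w‖ ≤ (2 / γ * A) * e ^ γ + S * e := by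
      intro w z hw hwz e hze
      refine (h.norm_sub_le hν0 hν hK hw hwz).trans ?_
      have h1 : z ^ γ ≤ e ^ γ := Real.rpow_le_rpow (hw.le.trans hwz) hze hγ0.le
      have h2 : 0 ≤ w ^ γ := Real.rpow_nonneg hw.le _
      gcongr <;> linarith
    intro w z hw hz e hwe hze
    rcases le_total w z with hwz | hwz
    · exact key w z hw hwz e hze
    · rw [norm_sub_rev]; exact key z w hz hwz e hwe
  rw [← cauchy_map_iff_exists_tendsto, Metric.cauchy_iff]
  refine ⟨inferInstance, fun ε hε => ?_⟩
  have hlim : Tendsto (fun e : ℝ => (2 / γ * A) * e ^ γ + S * e) (𝓝[>] 0) (𝓝 0) := by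
    have h1 : Tendsto (fun e : ℝ => e ^ γ) (𝓝 0) (𝓝 0) := by
      have := (Real.continuousAt_rpow_const 0 γ (Or.inr hγ0.le)).tendsto
      rwa [Real.zero_rpow hγ0.ne'] at this
    have := (h1.const_mul (2 / γ * A)).add ((tendsto_id (x := 𝓝 (0 : ℝ))).const_mul S)
    simp only [mul_zero, add_zero] at this
    exact this.mono_left nhdsWithin_le_nhds
  obtain ⟨e, he, he0⟩ := ((hlim.eventually_lt_const hε).and self_mem_nhdsWithin).exists
  have he0' : (0 : ℝ) < e := he0
  refine ⟨V '' Ioc 0 e, image_mem_map (Ioc_mem_nhdsGT he0'), ?_⟩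
  rintro _ ⟨x, hx, rfl⟩ _ ⟨y, hy, rfl⟩
  rw [dist_eq_norm]
  exact (hb y x hy.1 hx.1 e hy.2 hx.2).trans_lt he

theorem norm_limit_sub_le (h : RadialSystem ν K V Q F) (hν0 : 0 ≤ ν) (hν : ν ≤ 1 / 2)
    (hK : ∀ x, ‖K x‖ ^ 2 ≤ R * (inner ℂ (K x) x).re) {V₀ : X} (hV₀ : Tendsto V (𝓝[>] 0) (𝓝 V₀))
    {z : ℝ} (hz : 0 < z) (hz1 : z ≤ 1) :
    ‖V z - V₀‖ ≤ 8 * √(∫ z in Ioi 0, z ^ (-ν) * ‖K (V z)‖ ^ 2)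
        + √(∫ z in Ioi 0, z * ‖F z‖ ^ 2) := by
  refine le_of_tendsto ((tendsto_const_nhds (x := V z)).sub hV₀).norm ?_
  filter_upwards [Ioc_mem_nhdsGT hz] with w hw
  refine (h.norm_sub_le hν0 hν hK hw.1 hw.2).trans ?_
  set A := √(∫ z in Ioi 0, z ^ (-ν) * ‖K (V z)‖ ^ 2)
  set S := √(∫ z in Ioi 0, z * ‖F z‖ ^ 2)
  have hγ0 : 0 < (1 - ν) / 2 := by linarith
  have h1 : z ^ ((1 - ν) / 2) ≤ 1 := Real.rpow_le_one hz.le hz1 hγ0.le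
  have h2 : 0 ≤ w ^ ((1 - ν) / 2) := Real.rpow_nonneg hw.1.le _
  -- The bound `ν ≤ 1 / 2` keeps the exponent `(1 - ν) / 2` at least `1 / 4`.
  have h3 : 2 / ((1 - ν) / 2) ≤ 8 := by rw [div_le_iff₀ hγ0]; linarith
  have hw1 := hw.1
  have hAn : 0 ≤ A := Real.sqrt_nonneg _
  have hSn : 0 ≤ S := Real.sqrt_nonneg _
  refine add_le_add ?_ ?_
  · have h5 : z ^ ((1 - ν) / 2) - w ^ ((1 - ν) / 2) ≤ 1 := by linarith
    calc _ ≤ 2 / ((1 - ν) / 2) * A * 1 := by gcongr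
      _ ≤ 8 * A := by rw [mul_one]; gcongr
  · nlinarith

/-- The boundary value is bounded by the energy, the mass and the source. -/
theorem norm_limit_sq_le (h : RadialSystem ν K V Q F) (hν0 : 0 ≤ ν) (hν : ν ≤ 1 / 2)
    (hK : ∀ x, ‖K x‖ ^ 2 ≤ R * (inner ℂ (K x) x).re) {V₀ : X}
    (hV₀ : Tendsto V (𝓝[>] 0) (𝓝 V₀)) :
    ‖V₀‖ ^ 2 ≤ 256 * ((∫ z in Ioi 0, z * ‖V z‖ ^ 2)
      + R * (∫ z in Ioi 0, z ^ (-ν) * (inner ℂ (K (V z)) (V z)).re)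
      + ∫ z in Ioi 0, z * ‖F z‖ ^ 2) := by
  have hIA := h.integral_K_le hK
  set I := ∫ z in Ioi 0, z ^ (-ν) * ‖K (V z)‖ ^ 2 with hI
  set J := ∫ z in Ioi 0, z * ‖F z‖ ^ 2 with hJ
  have hI0 : 0 ≤ I := setIntegral_nonneg measurableSet_Ioi fun t ht =>
      mul_nonneg (Real.rpow_nonneg (le_of_lt ht) _) (by positivity)
  have hJ0 : 0 ≤ J := setIntegral_nonneg measurableSet_Ioi fun t ht =>
      mul_nonneg (le_of_lt ht) (by positivity)
  -- This pointwise bound is integrated over `(0, 1]` with the weight `z`, so that the mass controls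
  -- the term in `V z`. The constants `256` and `4` come from `2 (8√I + √J)² ≤ 256 I + 4 J`.
  have hM : ∀ z ∈ Ioc (0 : ℝ) 1, z * ‖V₀‖ ^ 2 ≤ 2 * (z * ‖V z‖ ^ 2) + z * (256 * I + 4 * J) := by
    intro z hz
    have h1 := h.norm_limit_sub_le hν0 hν hK hV₀ hz.1 hz.2
    have h2 : ‖V₀‖ ≤ ‖V z‖ + (8 * √I + √J) := by
      have := norm_sub_norm_le V₀ (V z)
      rw [norm_sub_rev] at this
      linarith
    have h3 : ‖V₀‖ ^ 2 ≤ (‖V z‖ + (8 * √I + √J)) ^ 2 := by gcongr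
    have h4 : ‖V₀‖ ^ 2 ≤ 2 * ‖V z‖ ^ 2 + (256 * I + 4 * J) := by
      nlinarith [sq_nonneg (‖V z‖ - (8 * √I + √J)), sq_nonneg (8 * √I - √J), Real.sq_sqrt hI0,
        Real.sq_sqrt hJ0]
    have := hz.1
    nlinarith
  have hid : IntegrableOn (fun t : ℝ => t) (Ioc 0 1) :=
    (intervalIntegrable_iff_integrableOn_Ioc_of_le zero_le_one).1
        (continuous_id.intervalIntegrable _ _)
  have hmI := h.mass.mono_set (fun _ hx => hx.1 : Ioc (0 : ℝ) 1 ⊆ Ioi 0)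
  have h5 := setIntegral_mono_on (hid.mul_const (‖V₀‖ ^ 2))
    ((hmI.const_mul 2).add (hid.mul_const (256 * I + 4 * J))) measurableSet_Ioc hM
  have e4 : ∫ t in Ioc (0 : ℝ) 1, t = 1 / 2 := by
    rw [← intervalIntegral.integral_of_le zero_le_one, integral_id]; norm_num
  simp only [Pi.add_apply] at h5
  rw [integral_mul_const, integral_add (hmI.const_mul 2) (hid.mul_const _), integral_mul_const,
    integral_const_mul, e4] at h5
  have h6 : ∫ z in Ioc (0 : ℝ) 1, z * ‖V z‖ ^ 2 ≤ ∫ z in Ioi 0, z * ‖V z‖ ^ 2 := by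
    refine setIntegral_mono_set h.mass ?_ (LE.le.eventuallyLE Ioc_subset_Ioi_self)
    exact (ae_restrict_mem measurableSet_Ioi).mono fun t ht =>
      mul_nonneg (le_of_lt ht) (by positivity)
  have h7 : 0 ≤ ∫ z in Ioi 0, z * ‖V z‖ ^ 2 := setIntegral_nonneg measurableSet_Ioi fun t ht =>
      mul_nonneg (le_of_lt ht) (by positivity)
  linarith

end RadialSystem

end RadialSystem

end

end TaubWave

namespace TaubWave

noncomputable section

/-! ### A logarithmic weight at the scale `ℓ` -/

section Weight

/-- The weight `log (1 + (z / ℓ) ^ (-2))`. -/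
def radialWeight (ℓ z : ℝ) : ℝ := Real.log (z ^ 2 + ℓ ^ 2) - Real.log (z ^ 2)

theorem radialWeight_eq {ℓ z : ℝ} (hz : 0 < z) :
    radialWeight ℓ z = Real.log (1 + ℓ ^ 2 / z ^ 2) := by
  rw [radialWeight, ← Real.log_div (by positivity) (by positivity)]
  congr 1
  field_simp

theorem hasDerivAt_radialWeight {ℓ z : ℝ} (hz : 0 < z) :
    HasDerivAt (radialWeight ℓ) (-(2 * ℓ ^ 2) / (z * (z ^ 2 + ℓ ^ 2))) z := by
  have h0 : HasDerivAt (fun z : ℝ => z ^ 2) (2 * z) z := by simpa using hasDerivAt_pow 2 z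
  have h1 := (h0.add_const (ℓ ^ 2)).log (by positivity)
  have h2 := h0.log (by positivity)
  refine (h1.sub h2).congr_deriv ?_
  field_simp
  ring

theorem le_radialWeight {ℓ z : ℝ} (hz : 0 < z) : ℓ ^ 2 / (z ^ 2 + ℓ ^ 2) ≤ radialWeight ℓ z := by
  rw [radialWeight_eq hz]
  have := Real.one_sub_inv_le_log_of_pos (x := 1 + ℓ ^ 2 / z ^ 2) (by positivity)
  refine le_trans (le_of_eq ?_) this
  field_simp
  ring

theorem radialWeight_nonneg {ℓ z : ℝ} (hz : 0 < z) : 0 ≤ radialWeight ℓ z :=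
  le_trans (by positivity) (le_radialWeight hz)

theorem radialWeight_anti {ℓ y z : ℝ} (hy : 0 < y) (hyz : y ≤ z) :
    radialWeight ℓ z ≤ radialWeight ℓ y := by
  rw [radialWeight_eq hy, radialWeight_eq (hy.trans_le hyz)]
  gcongr

/-- With `t = ℓ² / z²` and `p = (1 + ν) / 2`, subadditivity of `t ↦ t ^ p` gives `p log (1 + t) ≤
log (1 + t ^ p) ≤ t ^ p`. The factor `2` comes from `p ≥ 1 / 2`. -/
theorem radialWeight_mul_rpow_le {ℓ z ν : ℝ} (hℓ : 0 < ℓ) (hz : 0 < z) (hν0 : 0 ≤ ν)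
    (hν : ν ≤ 1) : radialWeight ℓ z * z ^ (1 + ν) ≤ 2 * ℓ ^ (1 + ν) := by
  set p : ℝ := (1 + ν) / 2 with hp
  have hp0 : 0 < p := by rw [hp]; linarith
  have hp1 : p ≤ 1 := by rw [hp]; linarith
  set t : ℝ := ℓ ^ 2 / z ^ 2 with ht
  have ht0 : 0 < t := by positivity
  have h1 : (1 + t) ^ p ≤ 1 + t ^ p := by
    simpa using Real.rpow_add_le_add_rpow (p := p) zero_le_one ht0.le hp0.le hp1
  have h2 : p * Real.log (1 + t) ≤ t ^ p := by
    rw [← Real.log_rpow (by positivity)]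
    calc Real.log ((1 + t) ^ p) ≤ Real.log (1 + t ^ p) := Real.log_le_log (by positivity) h1
      _ ≤ t ^ p := by
        have := Real.log_le_sub_one_of_pos (x := 1 + t ^ p) (by positivity)
        linarith
  have h3 : t ^ p * z ^ (1 + ν) = ℓ ^ (1 + ν) := by
    have e : ∀ x : ℝ, 0 < x → (x ^ 2) ^ p = x ^ (1 + ν) := by
      intro x hx
      rw [← Real.rpow_natCast, ← Real.rpow_mul hx.le]; congr 1; rw [hp]; push_cast; ring
    rw [ht, Real.div_rpow (by positivity) (by positivity), e ℓ hℓ, e z hz]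
    have := Real.rpow_pos_of_pos hz (1 + ν)
    field_simp
  have hlog : 0 ≤ Real.log (1 + t) := Real.log_nonneg (by linarith)
  rw [radialWeight_eq hz, ← h3, ← mul_assoc]
  have h4 : Real.log (1 + t) ≤ 2 * t ^ p := by nlinarith
  have := Real.rpow_nonneg hz.le (1 + ν)
  gcongr

/-- The weight is a supersolution of `(z w')' = 4 ℓ ^ (ν - 1) z ^ (-ν) w`. -/
theorem radialWeight_supersolution {ℓ z ν : ℝ} (hℓ : 0 < ℓ) (hz : 0 < z) (hν0 : 0 ≤ ν)
    (hν : ν ≤ 1) : 4 * ℓ ^ 2 * z / (z ^ 2 + ℓ ^ 2) ^ 2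
      ≤ 4 * ℓ ^ (ν - 1) * z ^ (-ν) * radialWeight ℓ z := by
  -- Weighted arithmetic-geometric mean of `z²` and `ℓ²` with weights `(1 + ν) / 2` and `(1 - ν) /
  -- 2`.
  have h1 : z ^ (1 + ν) * ℓ ^ (1 - ν) ≤ z ^ 2 + ℓ ^ 2 := by
    have h2 := Real.geom_mean_le_arith_mean2_weighted (w₁ := (1 + ν) / 2) (w₂ := (1 - ν) / 2)
      (p₁ := z ^ 2) (p₂ := ℓ ^ 2) (by linarith) (by linarith) (by positivity) (by positivity)
      (by ring)
    have e : ∀ x q : ℝ, 0 < x → (x ^ 2) ^ (q / 2) = x ^ q := by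
      intro x q hx
      rw [← Real.rpow_natCast, ← Real.rpow_mul hx.le]; congr 1; push_cast; ring
    rw [e z _ hz, e ℓ _ hℓ] at h2
    refine h2.trans ?_
    have := sq_nonneg z
    have := sq_nonneg ℓ
    nlinarith
  have h2 : ℓ ^ (ν - 1) * z ^ (-ν) = z / (z ^ (1 + ν) * ℓ ^ (1 - ν)) := by
    rw [eq_div_iff (by positivity)]
    have a1 : z ^ (-ν) * z ^ (1 + ν) = z := by rw [← Real.rpow_add hz]; simp
    have a2 : ℓ ^ (ν - 1) * ℓ ^ (1 - ν) = 1 := by rw [← Real.rpow_add hℓ]; simp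
    calc _ = (z ^ (-ν) * z ^ (1 + ν)) * (ℓ ^ (ν - 1) * ℓ ^ (1 - ν)) := by ring
      _ = z := by rw [a1, a2, mul_one]
  have h3 := le_radialWeight (ℓ := ℓ) hz
  have h4 : z / (z ^ 2 + ℓ ^ 2) ≤ ℓ ^ (ν - 1) * z ^ (-ν) := by
    rw [h2]; gcongr
  calc 4 * ℓ ^ 2 * z / (z ^ 2 + ℓ ^ 2) ^ 2
      = 4 * (z / (z ^ 2 + ℓ ^ 2)) * (ℓ ^ 2 / (z ^ 2 + ℓ ^ 2)) := by field_simp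
    _ ≤ 4 * (ℓ ^ (ν - 1) * z ^ (-ν)) * radialWeight ℓ z := by gcongr
    _ = _ := by ring

end Weight

end

end TaubWave

namespace TaubWave

noncomputable section

/-! ### The scale invariant bound near the boundary -/

section RadialEstimate

variable {X : Type*} [NormedAddCommGroup X] [InnerProductSpace ℂ X] [CompleteSpace X]

/-- The real part of the inner product as a real bilinear map. -/
def reInner (X : Type*) [NormedAddCommGroup X] [InnerProductSpace ℂ X] : X →L[ℝ] X →L[ℝ] ℝ :=
  LinearMap.mkContinuous₂ (LinearMap.mk₂ ℝ (fun x y : X => (inner ℂ x y).re)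
    (fun x y z => by simp) (fun c x y => by simp [inner_smul_left_eq_smul])
    (fun x y z => by simp) (fun c x y => by simp [inner_smul_right_eq_smul])) 1
    (fun x y => by
      rw [one_mul]
      exact (Complex.abs_re_le_norm _).trans (norm_inner_le_norm x y))

omit [CompleteSpace X] in
theorem reInner_apply (x y : X) : reInner X x y = (inner ℂ x y).re := rfl

omit [CompleteSpace X] in
theorem abs_reInner_le (x y : X) : |(inner ℂ x y).re| ≤ ‖x‖ * ‖y‖ :=
  (Complex.abs_re_le_norm _).trans (norm_inner_le_norm x y)

omit [CompleteSpace X] in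
theorem hasDerivAt_norm_sq {V : ℝ → X} {V' : X} {z : ℝ} (h : HasDerivAt V V' z) :
    HasDerivAt (fun z => ‖V z‖ ^ 2) (2 * (inner ℂ V' (V z)).re) z := by
  have h1 := (reInner X).hasFDerivAt_of_bilinear h.hasFDerivAt h.hasFDerivAt
  have h2 := h1.hasDerivAt
  have e : ∀ x : X, (inner ℂ x x).re = ‖x‖ ^ 2 := fun x => inner_self_eq_norm_sq (𝕜 := ℂ) x
  have c1 : (inner ℂ (V z) V').re = (inner ℂ V' (V z)).re := by
    rw [← inner_conj_symm, Complex.conj_re]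
  simp only [reInner_apply, e] at h2
  refine h2.congr_deriv ?_
  simp [reInner_apply, c1, two_mul]

namespace RadialSystem

variable {ν R : ℝ} {K : X →L[ℂ] X} {V Q F : ℝ → X}

theorem continuousOn_Q (h : RadialSystem ν K V Q F) (hν : ν < 1)
    (hK : ∀ x, ‖K x‖ ^ 2 ≤ R * (inner ℂ (K x) x).re) {a b : ℝ} (ha : 0 < a) (hab : a ≤ b) :
    ContinuousOn Q (Icc a b) := by
  have := intervalIntegral.continuousOn_primitive_interval' (a := a)
    (h.intervalIntegrable_rhs hν hK ha.le (ha.le.trans hab)) left_mem_uIcc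
  rw [uIcc_of_le hab] at this
  refine (continuousOn_const (c := Q a) |>.add this).congr fun z hz => ?_
  simp only [Pi.add_apply]
  rw [← h.sub_eq_integral a z ha hz.1]
  abel

/-- The energy density along the vertical direction. -/
def density (ν : ℝ) (K : X →L[ℂ] X) (V Q F : ℝ → X) (z : ℝ) : ℝ :=
  z⁻¹ * ‖Q z‖ ^ 2 + z ^ (-ν) * (inner ℂ (K (V z)) (V z)).re - z * (inner ℂ (F z) (V z)).re

theorem integrableOn_density (h : RadialSystem ν K V Q F) :
    IntegrableOn (density ν K V Q F) (Ioi 0) := by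
  refine (h.vertical.add h.horizontal).sub ?_
  have hVm : AEStronglyMeasurable V (volume.restrict (Ioi 0)) :=
    h.continuousOn.aestronglyMeasurable measurableSet_Ioi
  refine Integrable.mono' (h.source.add h.mass) ?_ ?_
  · exact aestronglyMeasurable_id.mul
      ((reInner X).aestronglyMeasurable_comp₂ h.source_aesm hVm)
  · refine (ae_restrict_mem measurableSet_Ioi).mono fun z hz => ?_
    have hz' : (0 : ℝ) < z := hz
    rw [norm_mul, Real.norm_of_nonneg hz'.le]
    simp only [Pi.add_apply]
    have h1 := abs_reInner_le (F z) (V z)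
    rw [← mul_add]
    gcongr
    refine h1.trans ?_
    nlinarith [sq_nonneg (‖F z‖ - ‖V z‖), sq_nonneg ‖F z‖, sq_nonneg ‖V z‖]

/-- This is the equation tested with `V`. As `Q` is only a primitive of an integrable function, the
product rule `bilinear_sub_eq_integral` is used instead of differentiation. -/
theorem reInner_sub_eq_integral (h : RadialSystem ν K V Q F) (hν : ν < 1)
    (hK : ∀ x, ‖K x‖ ^ 2 ≤ R * (inner ℂ (K x) x).re) {a b : ℝ} (ha : 0 < a) (hab : a ≤ b) :
    (inner ℂ (Q b) (V b)).re - (inner ℂ (Q a) (V a)).re = ∫ z in a..b, density ν K V Q F z := by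
  have hinv : ContinuousOn (fun z : ℝ => z⁻¹) (Icc a b) :=
    continuousOn_inv₀.mono fun z hz => (ha.trans_le hz.1).ne'
  have h1 := bilinear_sub_eq_integral (reInner X) hab
    (h.intervalIntegrable_rhs hν hK ha.le (ha.le.trans hab)) (Q := Q)
    (fun z hz => by rw [← h.sub_eq_integral a z ha hz.1]; abel)
    (fun z hz => h.hasDerivAt z (ha.trans_le hz.1))
    (V' := fun z => z⁻¹ • Q z) (hinv.smul (h.continuousOn_Q hν hK ha hab))
  simp only [reInner_apply] at h1
  rw [h1]
  refine intervalIntegral.integral_congr fun z _ => ?_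
  have e : (inner ℂ (Q z) (Q z)).re = ‖Q z‖ ^ 2 := inner_self_eq_norm_sq (𝕜 := ℂ) (Q z)
  simp only [density, inner_sub_left, inner_smul_left_eq_smul, inner_smul_right_eq_smul,
    Complex.sub_re, Complex.real_smul, Complex.re_ofReal_mul, e]
  ring

/-- The boundary term at `0` disappears because `Q` tends to zero there while `V` stays bounded. -/
theorem reInner_eq_integral (h : RadialSystem ν K V Q F) (hν0 : 0 ≤ ν) (hν : ν ≤ 1 / 2)
    (hK : ∀ x, ‖K x‖ ^ 2 ≤ R * (inner ℂ (K x) x).re) {b : ℝ} (hb : 0 < b) :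
    (inner ℂ (Q b) (V b)).re = ∫ z in (0)..b, density ν K V Q F z := by
  have hν1 : ν < 1 := by linarith
  obtain ⟨V₀, hV₀⟩ := h.exists_tendsto hν0 hν hK
  have hDi : IntervalIntegrable (density ν K V Q F) volume 0 b :=
    (intervalIntegrable_iff_integrableOn_Ioc_of_le hb.le).2
      (h.integrableOn_density.mono_set fun _ hx => hx.1)
  have hc : ContinuousOn (fun x => ∫ t in x..b, density ν K V Q F t) (Icc 0 b) := by
    have := intervalIntegral.continuousOn_primitive_interval' (a := b) hDi right_mem_uIcc
    rw [uIcc_of_le hb.le] at this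
    refine this.neg.congr fun z _ => ?_
    exact intervalIntegral.integral_symm _ _
  have hc1 : Tendsto (fun x => ∫ t in x..b, density ν K V Q F t) (𝓝[>] 0)
      (𝓝 (∫ t in (0)..b, density ν K V Q F t)) := by
    rw [← nhdsWithin_Ioc_eq_nhdsGT hb]
    exact ((hc 0 ⟨le_rfl, hb.le⟩).tendsto).mono_left (nhdsWithin_mono _ Ioc_subset_Icc_self)
  refine tendsto_nhds_unique (f := fun x => (inner ℂ (Q b) (V b)).re - (inner ℂ (Q x) (V x)).re)
    ?_ (hc1.congr' ?_)
  · have h0 : Tendsto (fun x => (inner ℂ (Q x) (V x)).re) (𝓝[>] 0) (𝓝 0) := by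
      refine squeeze_zero_norm (fun x => abs_reInner_le _ _) ?_
      simpa using (h.tendsto_Q hν1 hK).norm.mul hV₀.norm
    simpa using tendsto_const_nhds.sub h0
  · filter_upwards [Ioc_mem_nhdsGT hb] with x hx
    rw [h.reInner_sub_eq_integral hν1 hK hx.1 hx.2]

/-- Half of the coercive term absorbs `z ‖F‖ ‖V‖` by Young's inequality; the other half is kept on
the left to pay for the weight. What remains is a multiple of `W z ^ (1 + ν)`, at most `2 ℓ ^ (1 +
ν)`, and dividing by `8 ℓ ^ (ν - 1)` leaves `ℓ² / 4`. The bound is stated for any `W` below the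
weight so that it also covers a weight frozen at a constant. -/
theorem weight_density_le {ℓ z W : ℝ} (hℓ : 0 < ℓ) (hz : 0 < z) (hν0 : 0 ≤ ν) (hν : ν ≤ 1)
    (hc : 4 * ℓ ^ (ν - 1) * ‖V z‖ ^ 2 ≤ (inner ℂ (K (V z)) (V z)).re)
    (hW0 : 0 ≤ W) (hW : W ≤ radialWeight ℓ z) :
    -(W * density ν K V Q F z) + 1 / 2 * (W * (4 * ℓ ^ (ν - 1) * z ^ (-ν)) * ‖V z‖ ^ 2)
      ≤ ℓ ^ 2 / 4 * (z * ‖F z‖ ^ 2) := by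
  set ρ := 4 * ℓ ^ (ν - 1) with hρ
  have hρ0 : 0 < ρ := by positivity
  set y := z ^ (-ν) with hy
  have hy0 : 0 < y := by positivity
  have h1 : z * (inner ℂ (F z) (V z)).re ≤ z * (‖F z‖ * ‖V z‖) := by
    gcongr; exact (le_abs_self _).trans (abs_reInner_le _ _)
  have h2 : y * (ρ * ‖V z‖ ^ 2) ≤ y * (inner ℂ (K (V z)) (V z)).re := by gcongr
  have h3 : 0 ≤ z⁻¹ * ‖Q z‖ ^ 2 := by positivity
  have h4 : -density ν K V Q F z ≤ z * (‖F z‖ * ‖V z‖) - y * (ρ * ‖V z‖ ^ 2) := by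
    rw [density]; linarith
  have h5 : z * (‖F z‖ * ‖V z‖) - y * (ρ * ‖V z‖ ^ 2) + 1 / 2 * (ρ * y * ‖V z‖ ^ 2)
      ≤ z ^ 2 * ‖F z‖ ^ 2 / (2 * (y * ρ)) := by
    rw [le_div_iff₀ (by positivity)]
    nlinarith [sq_nonneg (z * ‖F z‖ - y * ρ * ‖V z‖)]
  have h6 : W * (z ^ 2 * ‖F z‖ ^ 2 / (2 * (y * ρ))) ≤ ℓ ^ 2 / 4 * (z * ‖F z‖ ^ 2) := by
    have e1 : z ^ (1 + ν) * y = z := by rw [hy, ← Real.rpow_add hz]; simp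
    have e2 : ℓ ^ (1 + ν) = ℓ ^ 2 * ℓ ^ (ν - 1) := by
      rw [← Real.rpow_natCast, ← Real.rpow_add hℓ]; congr 1; push_cast; ring
    have h7 : W * z ^ (1 + ν) ≤ 2 * (ℓ ^ 2 * ℓ ^ (ν - 1)) := by
      rw [← e2]
      refine le_trans ?_ (radialWeight_mul_rpow_le hℓ hz hν0 hν)
      gcongr
    have h8 : W * z ≤ 2 * (ℓ ^ 2 * ℓ ^ (ν - 1)) * y := by
      calc W * z = (W * z ^ (1 + ν)) * y := by rw [mul_assoc, e1]
        _ ≤ _ := by gcongr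
    rw [← mul_div_assoc, div_le_iff₀ (by positivity), hρ]
    have h9 : 0 ≤ z * ‖F z‖ ^ 2 := by positivity
    calc W * (z ^ 2 * ‖F z‖ ^ 2) = (W * z) * (z * ‖F z‖ ^ 2) := by ring
      _ ≤ (2 * (ℓ ^ 2 * ℓ ^ (ν - 1)) * y) * (z * ‖F z‖ ^ 2) := by gcongr
      _ = _ := by ring
  refine le_trans ?_ h6
  calc _ = W * (-density ν K V Q F z + 1 / 2 * (ρ * y * ‖V z‖ ^ 2)) := by ring
    _ ≤ _ := by
      refine mul_le_mul_of_nonneg_left ?_ hW0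
      linarith

/-- The scale invariant bound of `V` by the source, under a spectral gap. -/
theorem norm_sq_le_of_coercive (h : RadialSystem ν K V Q F) (hν0 : 0 ≤ ν) (hν : ν ≤ 1 / 2)
    (hK : ∀ x, ‖K x‖ ^ 2 ≤ R * (inner ℂ (K x) x).re) {ℓ : ℝ} (hℓ : 0 < ℓ)
    (hc : ∀ z, 0 < z → 4 * ℓ ^ (ν - 1) * ‖V z‖ ^ 2 ≤ (inner ℂ (K (V z)) (V z)).re)
    {δ : ℝ} (hδ : 0 < δ) :
    ‖V δ‖ ^ 2 ≤ (ℓ ^ 2 + δ ^ 2) / 4 * ∫ z in Ioi 0, z * ‖F z‖ ^ 2 := by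
  have hν1 : ν < 1 := by linarith
  set S := ∫ z in Ioi 0, z * ‖F z‖ ^ 2 with hS
  set D := density ν K V Q F with hD
  set w := radialWeight ℓ with hw
  have hDI : IntegrableOn D (Ioi 0) := h.integrableOn_density
  have hDi : ∀ a b, 0 ≤ a → a ≤ b → IntervalIntegrable D volume a b := fun a b ha hab =>
    (intervalIntegrable_iff_integrableOn_Ioc_of_le hab).2
      (hDI.mono_set fun _ hx => ha.trans_lt hx.1)
  have hSi : ∀ a b, 0 ≤ a → a ≤ b → IntervalIntegrable (fun z => z * ‖F z‖ ^ 2) volume a b :=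
    fun a b ha hab => (intervalIntegrable_iff_integrableOn_Ioc_of_le hab).2
      (h.source.mono_set fun _ hx => ha.trans_lt hx.1)
  -- Here `s = z m' / 2`, `c = -z w'` and `e = -c'`.
  let s : ℝ → ℝ := fun z => (inner ℂ (Q z) (V z)).re
  let m : ℝ → ℝ := fun z => ‖V z‖ ^ 2
  let c : ℝ → ℝ := fun z => 2 * ℓ ^ 2 / (z ^ 2 + ℓ ^ 2)
  let e : ℝ → ℝ := fun z => 4 * ℓ ^ 2 * z / (z ^ 2 + ℓ ^ 2) ^ 2
  have hwδ : 0 ≤ w δ := radialWeight_nonneg hδ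
  -- The effective weight is `w` truncated at height `w δ`: it is `w` on `(δ, b)` and the constant
  -- `w δ` on `(0, δ)`, which avoids the logarithmic singularity. The corner at `δ` produces the
  -- value `m δ`.
  have key : ∀ b, δ ≤ b → 1 / 2 * (c δ * m δ) ≤ w δ * |s b| + m b + ℓ ^ 2 / 4 * S := by
    intro b hb
    have hpos : ∀ z ∈ Icc δ b, 0 < z := fun z hz => hδ.trans_le hz.1
    have hQc := h.continuousOn_Q hν1 hK hδ hb
    have hVc : ContinuousOn V (Icc δ b) := h.continuousOn.mono hpos
    have hsc : ContinuousOn s (Icc δ b) := by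
      have := ((reInner X).continuous.comp_continuousOn hQc).clm_apply hVc
      exact this
    have hw'c : ContinuousOn (fun z : ℝ => -(2 * ℓ ^ 2) / (z * (z ^ 2 + ℓ ^ 2))) (Icc δ b) :=
      ContinuousOn.div continuousOn_const (by fun_prop) fun z hz => by
        have := hpos z hz; positivity
    have hcc : ContinuousOn c (Icc δ b) :=
      ContinuousOn.div continuousOn_const (by fun_prop) fun z hz => by
        have := hpos z hz; positivity
    have hec : ContinuousOn e (Icc δ b) :=
      ContinuousOn.div (by fun_prop) (by fun_prop) fun z hz => by
        have := hpos z hz; positivity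
    have hwc : ContinuousOn w (Icc δ b) := fun z hz =>
      (hasDerivAt_radialWeight (hpos z hz)).continuousAt.continuousWithinAt
    have hmc : ContinuousOn m (Icc δ b) := hVc.norm.pow 2
    have h1 := bilinear_sub_eq_integral (ContinuousLinearMap.mul ℝ ℝ) hb (hDi δ b hδ.le hb)
      (Q := s) (V := w) (fun z hz => by
        rw [hD, ← h.reInner_sub_eq_integral hν1 hK hδ hz.1]; simp only [s]; ring)
      (fun z hz => hasDerivAt_radialWeight (hpos z hz)) hw'c
    simp only [ContinuousLinearMap.mul_apply'] at h1
    have hcd : ∀ z ∈ Icc δ b, HasDerivAt (fun z => c z * m z)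
        (-e z * m z + c z * (2 * (z⁻¹ * s z))) z := by
      intro z hz
      have hz0 := hpos z hz
      have d1 : HasDerivAt (fun z : ℝ => z ^ 2 + ℓ ^ 2) (2 * z) z := by
        simpa using (hasDerivAt_pow 2 z).add_const (ℓ ^ 2)
      have d2 : HasDerivAt c (-e z) z := by
        refine ((hasDerivAt_const z (2 * ℓ ^ 2)).div d1 (by positivity)).congr_deriv ?_
        simp only [e]; ring
      have d3 := hasDerivAt_norm_sq (h.hasDerivAt z hz0)
      refine (d2.mul d3).congr_deriv ?_
      simp [s, m, inner_smul_left_eq_smul]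
    have hint : IntervalIntegrable (fun z => -e z * m z + c z * (2 * (z⁻¹ * s z))) volume δ b := by
      refine ContinuousOn.intervalIntegrable ?_
      rw [uIcc_of_le hb]
      exact (hec.neg.mul hmc).add (hcc.mul (continuousOn_const.mul
        ((continuousOn_inv₀.mono fun z hz => (hpos z hz).ne').mul hsc)))
    have h2 := intervalIntegral.integral_eq_sub_of_hasDerivAt
      (fun z hz => hcd z (by rwa [uIcc_of_le hb] at hz)) hint
    have hI1 : IntervalIntegrable (fun z => D z * w z) volume δ b :=
      (hDi δ b hδ.le hb).mul_continuousOn (by rwa [uIcc_of_le hb])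
    have hI2 : IntervalIntegrable (fun z => e z * m z) volume δ b :=
      ContinuousOn.intervalIntegrable (by rw [uIcc_of_le hb]; exact hec.mul hmc)
    -- Two integrations by parts move the derivatives from `m` to `w`; the terms `s w'` and `c m' /
    -- 2` cancel because `s = z m' / 2` and `c = -z w'`.
    have h3 : s b * w b - s δ * w δ + 1 / 2 * (c b * m b - c δ * m δ)
        = ∫ z in δ..b, (D z * w z - 1 / 2 * (e z * m z)) := by
      have hI3 : IntervalIntegrable
          (fun z => D z * w z + s z * (-(2 * ℓ ^ 2) / (z * (z ^ 2 + ℓ ^ 2)))) volume δ b :=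
        hI1.add (ContinuousOn.intervalIntegrable (by rw [uIcc_of_le hb]; exact hsc.mul hw'c))
      rw [h1, ← h2, ← intervalIntegral.integral_const_mul,
        ← intervalIntegral.integral_add hI3 (hint.const_mul _)]
      refine intervalIntegral.integral_congr fun z hz => ?_
      rw [uIcc_of_le hb] at hz
      have := hpos z hz
      simp only [c]
      field_simp
      ring
    have h4 : s δ = ∫ z in (0)..δ, D z := h.reInner_eq_integral hν0 hν hK hδ
    have h5 : -(∫ z in δ..b, (D z * w z - 1 / 2 * (e z * m z)))
        ≤ ∫ z in δ..b, ℓ ^ 2 / 4 * (z * ‖F z‖ ^ 2) := by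
      rw [← intervalIntegral.integral_neg]
      refine intervalIntegral.integral_mono_on hb ((hI1.sub (hI2.const_mul _)).neg)
        ((hSi δ b hδ.le hb).const_mul _) fun z hz => ?_
      have hz0 := hpos z hz
      have h6 := weight_density_le (F := F) (Q := Q) (K := K) hℓ hz0 hν0 (by linarith) (hc z hz0)
        (radialWeight_nonneg hz0) le_rfl
      have h7 := radialWeight_supersolution hℓ hz0 hν0 (by linarith)
      refine le_trans ?_ h6
      have h8 : e z * m z ≤ (4 * ℓ ^ (ν - 1) * z ^ (-ν) * radialWeight ℓ z) * m z :=
        mul_le_mul_of_nonneg_right h7 (by positivity)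
      simp only [m] at h8 ⊢
      linarith
    -- The flux through `δ` is the integral of the density from the boundary, so it is estimated
    -- like the rest, with the constant weight `w δ ≤ w z`.
    have h6 : -(w δ * s δ) ≤ ∫ z in (0)..δ, ℓ ^ 2 / 4 * (z * ‖F z‖ ^ 2) := by
      rw [h4, ← intervalIntegral.integral_const_mul, ← intervalIntegral.integral_neg]
      refine intervalIntegral.integral_mono_on_of_le_Ioo hδ.le ((hDi 0 δ le_rfl hδ.le).const_mul _).neg
        ((hSi 0 δ le_rfl hδ.le).const_mul _) fun z hz => ?_
      have hz0 := hz.1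
      have h6 := weight_density_le (F := F) (Q := Q) (K := K) hℓ hz0 hν0 (by linarith) (hc z hz0)
        hwδ (radialWeight_anti hz0 hz.2.le)
      refine le_trans ?_ h6
      have : 0 ≤ w δ * (4 * ℓ ^ (ν - 1) * z ^ (-ν)) * ‖V z‖ ^ 2 := by positivity
      linarith
    have h7 : (∫ z in (0)..δ, ℓ ^ 2 / 4 * (z * ‖F z‖ ^ 2))
        + (∫ z in δ..b, ℓ ^ 2 / 4 * (z * ‖F z‖ ^ 2)) ≤ ℓ ^ 2 / 4 * S := by
      rw [intervalIntegral.integral_add_adjacent_intervals ((hSi 0 δ le_rfl hδ.le).const_mul _)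
        ((hSi δ b hδ.le hb).const_mul _), intervalIntegral.integral_const_mul,
        intervalIntegral.integral_of_le (hδ.le.trans hb)]
      refine mul_le_mul_of_nonneg_left ?_ (by positivity)
      refine setIntegral_mono_set h.source ?_ (LE.le.eventuallyLE fun _ hx => hx.1)
      exact (ae_restrict_mem measurableSet_Ioi).mono fun t ht =>
        mul_nonneg (le_of_lt ht) (by positivity)
    have hb0 : 0 < b := hδ.trans_le hb
    have h8 : s b * w b ≤ w δ * |s b| := by
      have a1 : w b ≤ w δ := radialWeight_anti hδ hb
      have a2 : 0 ≤ w b := radialWeight_nonneg hb0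
      have a3 := le_abs_self (s b)
      have a4 := abs_nonneg (s b)
      nlinarith
    have h9 : 1 / 2 * (c b * m b) ≤ m b := by
      have a1 : c b ≤ 2 := by
        simp only [c]; rw [div_le_iff₀ (by positivity)]; nlinarith [sq_nonneg b]
      have a2 : 0 ≤ m b := by positivity
      nlinarith
    linarith
  have hfin : 1 / 2 * (c δ * m δ) ≤ ℓ ^ 2 / 4 * S := by
    refine le_of_forall_pos_le_add fun ε hε => ?_
    by_contra hcon
    push Not at hcon
    -- If the limiting inequality failed, the terms at `b` would stay above `ε`. For `b > 1` they
    -- are dominated by the integrable vertical energy and mass densities, which is impossible on a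
    -- half line of infinite length.
    have hge : ∀ b, max δ 1 ≤ b → ε ≤ w δ * |s b| + m b := fun b hb => by
      have := key b (le_of_max_le_left hb)
      linarith
    have hG : IntegrableOn (fun z => w δ * (z⁻¹ * ‖Q z‖ ^ 2 + z * ‖V z‖ ^ 2) + z * ‖V z‖ ^ 2)
        (Ioi (max δ 1)) :=
      IntegrableOn.mono_set ((h.vertical.add h.mass).const_mul (w δ) |>.add h.mass)
        (Ioi_subset_Ioi (hδ.le.trans (le_max_left _ _)))
    have hconst : IntegrableOn (fun _ : ℝ => ε) (Ioi (max δ 1)) := by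
      refine Integrable.mono' hG aestronglyMeasurable_const ?_
      refine (ae_restrict_mem measurableSet_Ioi).mono fun z hz => ?_
      have hz' : max δ 1 < z := hz
      have hz1 : 1 < z := (le_max_right _ _).trans_lt hz'
      have hz0 : 0 < z := by linarith
      rw [Real.norm_of_nonneg hε.le]
      refine (hge z hz'.le).trans (add_le_add ?_ ?_)
      · refine mul_le_mul_of_nonneg_left ((abs_reInner_le _ _).trans ?_) hwδ
        have a1 : ‖Q z‖ * ‖V z‖ = z⁻¹ * (‖Q z‖ * (z * ‖V z‖)) := by field_simp
        have a2 : z * ‖V z‖ ^ 2 = z⁻¹ * (z * ‖V z‖) ^ 2 := by field_simp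
        rw [a1, a2, ← mul_add]
        refine mul_le_mul_of_nonneg_left ?_ (by positivity)
        nlinarith [sq_nonneg (‖Q z‖ - z * ‖V z‖), sq_nonneg ‖Q z‖, sq_nonneg (z * ‖V z‖)]
      · have : 0 ≤ ‖V z‖ ^ 2 := by positivity
        simp only [m]; nlinarith
    rw [integrableOn_const_iff] at hconst
    simp [hε.ne'] at hconst
  have e1 : 1 / 2 * (c δ * m δ) = ℓ ^ 2 * ‖V δ‖ ^ 2 / (δ ^ 2 + ℓ ^ 2) := by
    simp only [c, m]; ring
  rw [e1, div_le_iff₀ (by positivity)] at hfin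
  have hℓ2 : 0 < ℓ ^ 2 := by positivity
  refine le_of_mul_le_mul_left ?_ hℓ2
  linarith

end RadialSystem

end RadialEstimate

end

end TaubWave

namespace TaubWave

noncomputable section

/-! ### Weak derivatives in one vertical variable -/

section DuBoisReymond

variable {X : Type*} [NormedAddCommGroup X] [NormedSpace ℝ X] [CompleteSpace X]

/-- Smooth functions of one variable with compact support in `(0, ∞)`. -/
def IsVerticalTest (ζ : ℝ → ℝ) : Prop :=
  ContDiff ℝ ∞ ζ ∧ HasCompactSupport ζ ∧ tsupport ζ ⊆ Ioi 0

theorem IsVerticalTest.exists_Icc {ζ : ℝ → ℝ} (h : IsVerticalTest ζ) :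
    ∃ a b : ℝ, 0 < a ∧ a ≤ b ∧ ∀ z, z ∉ Icc a b → ζ z = 0 := by
  rcases (tsupport ζ).eq_empty_or_nonempty with he | hne
  · exact ⟨1, 1, one_pos, le_rfl, fun z _ => image_eq_zero_of_notMem_tsupport (by simp [he])⟩
  · have hc : IsCompact (tsupport ζ) := h.2.1
    obtain ⟨a, ha, ha'⟩ := hc.exists_isLeast hne
    obtain ⟨b, hb, hb'⟩ := hc.exists_isGreatest hne
    refine ⟨a, b, h.2.2 ha, ha' hb, fun z hz => image_eq_zero_of_notMem_tsupport fun hz' => ?_⟩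
    exact hz ⟨ha' hz', hb' hz'⟩

theorem isVerticalTest_of_Icc {ζ : ℝ → ℝ} (h : ContDiff ℝ ∞ ζ) {a b : ℝ} (ha : 0 < a)
    (h0 : ∀ z, z ∉ Icc a b → ζ z = 0) : IsVerticalTest ζ := by
  have hs : tsupport ζ ⊆ Icc a b :=
    closure_minimal (fun z hz => by by_contra hn; exact hz (h0 z hn)) isClosed_Icc
  exact ⟨h, HasCompactSupport.of_support_subset_isCompact isCompact_Icc
    ((subset_tsupport _).trans hs), fun z hz => ha.trans_le (hs hz).1⟩

theorem IsVerticalTest.deriv {ζ : ℝ → ℝ} (h : IsVerticalTest ζ) : IsVerticalTest (deriv ζ) :=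
  ⟨h.1.deriv' , h.2.1.deriv, (tsupport_deriv_subset (f := ζ)).trans h.2.2⟩

theorem IsVerticalTest.mul_rpow {ζ : ℝ → ℝ} (h : IsVerticalTest ζ) (s : ℝ) :
    IsVerticalTest (fun z => z ^ s * ζ z) := by
  refine ⟨contDiff_iff_contDiffAt.2 fun z => ?_, h.2.1.mul_left,
    (tsupport_mul_subset_right).trans h.2.2⟩
  by_cases hz : z ∈ tsupport ζ
  · exact (Real.contDiffAt_rpow_const_of_ne (h.2.2 hz).ne').mul h.1.contDiffAt
  · have : (fun z => z ^ s * ζ z) =ᶠ[𝓝 z] fun _ => 0 := by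
      filter_upwards [(isClosed_tsupport ζ).isOpen_compl.mem_nhds hz] with y hy
      rw [image_eq_zero_of_notMem_tsupport hy, mul_zero]
    exact contDiffAt_const.congr_of_eventuallyEq this

theorem IsVerticalTest.integrable_smul {ζ : ℝ → ℝ} (h : IsVerticalTest ζ) {f : ℝ → X}
    (hf : LocallyIntegrableOn f (Ioi 0)) : Integrable (fun z => ζ z • f z) := by
  obtain ⟨a, b, ha, -, h0⟩ := h.exists_Icc
  have h1 : IntegrableOn f (Icc a b) :=
    hf.integrableOn_compact_subset (fun z hz => ha.trans_le hz.1) isCompact_Icc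
  have h2 : IntegrableOn (fun z => ζ z • f z) (Icc a b) :=
    h1.continuousOn_smul h.1.continuous.continuousOn isCompact_Icc
  refine (integrableOn_iff_integrable_of_support_subset fun z hz => ?_).1 h2
  by_contra hn
  exact hz (by simp [h0 z hn])

theorem exists_isVerticalTest_integral_eq_one :
    ∃ θ : ℝ → ℝ, IsVerticalTest θ ∧ ∫ z, θ z = 1 := by
  let b : ContDiffBump (1 : ℝ) := ⟨1 / 4, 1 / 2, by norm_num, by norm_num⟩
  refine ⟨b.normed volume, ⟨b.contDiff_normed, b.hasCompactSupport_normed, ?_⟩, b.integral_normed⟩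
  rw [b.tsupport_normed_eq]
  intro z hz
  rw [Metric.mem_closedBall, Real.dist_eq] at hz
  have h1 := (abs_le.1 hz).1
  have h2 : b.rOut = 1 / 2 := rfl
  rw [h2] at h1
  exact show (0 : ℝ) < z by linarith

/-- The primitive from the left end of the support vanishes to the left; the zero mean makes it
vanish to the right as well. -/
theorem exists_primitive_isVerticalTest {g : ℝ → ℝ} (hg : IsVerticalTest g)
    (h0 : ∫ z, g z = 0) : ∃ ζ, IsVerticalTest ζ ∧ deriv ζ = g := by
  obtain ⟨a, b, ha, hab, hs⟩ := hg.exists_Icc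
  have hc := hg.1.continuous
  set ζ : ℝ → ℝ := fun z => ∫ t in a..z, g t with hζ
  have hd : ∀ z, HasDerivAt ζ (g z) z := fun z =>
    intervalIntegral.integral_hasDerivAt_right (hc.intervalIntegrable _ _)
      hc.stronglyMeasurable.stronglyMeasurableAtFilter hc.continuousAt
  have hde : deriv ζ = g := funext fun z => (hd z).deriv
  refine ⟨ζ, isVerticalTest_of_Icc ?_ ha (b := b) fun z hz => ?_, hde⟩
  · refine contDiff_infty_iff_deriv.2 ⟨fun z => (hd z).differentiableAt, hde ▸ hg.1⟩
  · rw [mem_Icc, not_and_or, not_le, not_le] at hz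
    rcases hz with hz | hz
    · rw [hζ]
      simp only
      rw [intervalIntegral.integral_congr_ae (g := fun _ => 0), intervalIntegral.integral_zero]
      have hne : ∀ᵐ t : ℝ, t ≠ a := by simp [ae_iff]
      filter_upwards [hne] with t hta ht
      refine hs t fun h => ?_
      rw [uIoc_of_ge hz.le] at ht
      exact hta (le_antisymm ht.2 h.1)
    · rw [hζ, ← h0]
      simp only
      rw [intervalIntegral.integral_of_le (hab.trans hz.le)]
      have hsub : ∫ t in Icc a z, g t = ∫ t, g t := by
        refine setIntegral_eq_integral_of_forall_compl_eq_zero fun t ht => hs t fun h => ht ?_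
        exact ⟨h.1, h.2.trans hz.le⟩
      rw [← hsub, integral_Icc_eq_integral_Ioc]

/-- A function on `(0, ∞)` with vanishing weak derivative is constant. -/
theorem ae_eq_const_of_weakDeriv_eq_zero {f : ℝ → X} (hf : LocallyIntegrableOn f (Ioi 0))
    (h : ∀ ζ, IsVerticalTest ζ → ∫ z, deriv ζ z • f z = 0) :
    ∃ c : X, ∀ᵐ z : ℝ, z ∈ Ioi 0 → f z = c := by
  obtain ⟨θ, hθ, hθ1⟩ := exists_isVerticalTest_integral_eq_one
  refine ⟨∫ z, θ z • f z, ?_⟩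
  set c := ∫ z, θ z • f z with hc
  have hconst : LocallyIntegrableOn (fun _ : ℝ => c) (Ioi 0) :=
    (locallyIntegrable_const c).locallyIntegrableOn _
  have := isOpen_Ioi.ae_eq_zero_of_integral_contDiff_smul_eq_zero (hf.sub hconst)
    (μ := volume) (U := Ioi (0 : ℝ)) ?_
  · filter_upwards [this] with z hz hz'
    exact sub_eq_zero.1 (hz hz')
  intro g hg1 hg2 hg3
  have hg : IsVerticalTest g := ⟨hg1, hg2, hg3⟩
  have hgi : Integrable g := hg1.continuous.integrable_of_hasCompactSupport hg2
  have hθi : Integrable θ := hθ.1.continuous.integrable_of_hasCompactSupport hθ.2.1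
  -- Subtracting the multiple of `θ` with the same integral gives mean zero, hence a derivative of a
  -- test function.
  have hk : IsVerticalTest (fun z => g z - (∫ t, g t) * θ z) := by
    obtain ⟨a, b, ha, hab, h0⟩ := hg.exists_Icc
    obtain ⟨a', b', ha', hab', h0'⟩ := hθ.exists_Icc
    refine isVerticalTest_of_Icc (hg1.sub (contDiff_const.mul hθ.1)) (lt_min ha ha')
      (b := max b b') fun z hz => ?_
    rw [h0 z fun h => hz ⟨(min_le_left _ _).trans h.1, h.2.trans (le_max_left _ _)⟩,
      h0' z fun h => hz ⟨(min_le_right _ _).trans h.1, h.2.trans (le_max_right _ _)⟩]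
    simp
  obtain ⟨ζ, hζ, hζd⟩ := exists_primitive_isVerticalTest hk (by
    rw [integral_sub hgi (hθi.const_mul _), integral_const_mul, hθ1]; ring)
  have h1 := h ζ hζ
  have hgf := hg.integrable_smul hf
  have hθf := hθ.integrable_smul hf
  rw [hζd] at h1
  have e1 : (fun z => (g z - (∫ t, g t) * θ z) • f z)
      = fun z => g z • f z - (∫ t, g t) • (θ z • f z) := by
    ext z; rw [sub_smul, mul_smul]
  have hθf' : Integrable (fun z => (∫ t, g t) • (θ z • f z)) := hθf.smul _
  rw [e1, integral_sub hgf hθf', integral_smul, ← hc] at h1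
  have e2 : (fun z => g z • (f z - c)) = fun z => g z • f z - g z • c := by
    ext z; rw [smul_sub]
  change ∫ z, g z • (f z - c) = 0
  rw [e2, integral_sub hgf (hgi.smul_const c), integral_smul_const]
  exact h1

theorem intervalIntegrable_of_locallyIntegrableOn_Ioi {p : ℝ → X}
    (hp : LocallyIntegrableOn p (Ioi 0)) {a b : ℝ} (ha : 0 < a) (hb : 0 < b) :
    IntervalIntegrable p volume a b := by
  rw [intervalIntegrable_iff]
  refine (hp.integrableOn_compact_subset (t := uIcc a b) ?_ isCompact_uIcc).mono_set
    uIoc_subset_uIcc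
  intro z hz
  exact (lt_min ha hb).trans_le hz.1

/-- A function on `(0, ∞)` with a locally integrable weak derivative is a.e. equal to a
primitive of the weak derivative. -/
theorem exists_primitive_of_weakDeriv {f p : ℝ → X} (hf : LocallyIntegrableOn f (Ioi 0))
    (hp : LocallyIntegrableOn p (Ioi 0))
    (h : ∀ ζ, IsVerticalTest ζ → ∫ z, deriv ζ z • f z = - ∫ z, ζ z • p z) :
    ∃ u : ℝ → X, (∀ a b, 0 < a → 0 < b → u b - u a = ∫ z in a..b, p z) ∧
      ContinuousOn u (Ioi 0) ∧ ∀ᵐ z : ℝ, z ∈ Ioi 0 → f z = u z := by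
  have hpi := fun {a b : ℝ} ha hb => intervalIntegrable_of_locallyIntegrableOn_Ioi hp (a := a)
    (b := b) ha hb
  set P : ℝ → X := fun z => ∫ t in (1)..z, p t with hP
  have hPs : ∀ a b, 0 < a → 0 < b → P b - P a = ∫ z in a..b, p z := fun a b ha hb =>
    intervalIntegral.integral_interval_sub_left (hpi one_pos hb) (hpi one_pos ha)
  have hPc : ContinuousOn P (Ioi 0) := by
    intro z hz
    have hz' : (0 : ℝ) < z := hz
    have h1 : ContinuousOn (fun x => P (z / 2) + ∫ t in (z / 2)..x, p t) (Icc (z / 2) (z + 1)) := by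
      have := intervalIntegral.continuousOn_primitive_interval' (a := z / 2)
        (hpi (a := z / 2) (b := z + 1) (by linarith) (by linarith)) left_mem_uIcc
      rw [uIcc_of_le (by linarith)] at this
      exact continuousOn_const.add this
    have h2 := h1.continuousAt (Icc_mem_nhds (a := z / 2) (x := z) (by linarith) (by linarith))
    refine (h2.congr ?_).continuousWithinAt
    filter_upwards [lt_mem_nhds hz'] with x hx
    rw [← hPs (z / 2) x (by linarith) hx]; abel
  have hPl : LocallyIntegrableOn P (Ioi 0) := hPc.locallyIntegrableOn measurableSet_Ioi
  obtain ⟨c, hc⟩ := ae_eq_const_of_weakDeriv_eq_zero (hf.sub hPl) fun ζ hζ => by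
    obtain ⟨a, b, ha, hab, h0⟩ := hζ.exists_Icc
    have hb := ha.trans_le hab
    have hder : ∀ z, HasDerivAt ζ (deriv ζ z) z := fun z =>
      (hζ.1.differentiable (by simp) z).hasDerivAt
    have e1 : ∫ z, deriv ζ z • P z = - ∫ z, ζ z • p z := by
      -- The interval is widened to `[a / 2, b + 1]` so that `ζ` vanishes at both ends and no
      -- boundary terms remain.
      have hb1 := bilinear_sub_eq_integral (ContinuousLinearMap.lsmul ℝ ℝ (E := X)).flip
        (a := a / 2) (b := b + 1) (by linarith) (hpi (by linarith) (by linarith)) (Q := P)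
        (fun z hz => by
          rw [← hPs (a / 2) z (by linarith) (by have := hz.1; linarith)]; abel)
        (fun z _ => hder z) hζ.deriv.1.continuous.continuousOn
      simp only [ContinuousLinearMap.flip_apply, ContinuousLinearMap.lsmul_apply] at hb1
      rw [h0 (a / 2) fun h => by linarith [h.1], h0 (b + 1) fun h => by linarith [h.2]] at hb1
      have i1 : IntervalIntegrable (fun z => ζ z • p z) volume (a / 2) (b + 1) :=
        (hζ.integrable_smul hp).intervalIntegrable
      have i2 : IntervalIntegrable (fun z => deriv ζ z • P z) volume (a / 2) (b + 1) :=
        (hζ.deriv.integrable_smul hPl).intervalIntegrable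
      rw [intervalIntegral.integral_add i1 i2] at hb1
      have conv : ∀ (g : ℝ → X), (∀ z, z ∉ Icc a b → g z = 0) →
          ∫ z in (a / 2)..(b + 1), g z = ∫ z, g z := fun g hg => by
        rw [intervalIntegral.integral_of_le (by linarith)]
        refine setIntegral_eq_integral_of_forall_compl_eq_zero fun t ht => hg t fun h => ht ?_
        exact ⟨by linarith [h.1], by linarith [h.2]⟩
      rw [conv _ fun z hz => by simp [h0 z hz], conv _ fun z hz => ?_] at hb1
      · simp only [zero_smul, sub_zero] at hb1
        rw [eq_neg_iff_add_eq_zero, add_comm]; exact hb1.symm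
      · have : deriv ζ z = 0 := by
          have hev : ζ =ᶠ[𝓝 z] fun _ => 0 := by
            filter_upwards [isClosed_Icc.isOpen_compl.mem_nhds hz] with y hy using h0 y hy
          rw [hev.deriv_eq]; simp
        simp [this]
    have e2 : (fun z => deriv ζ z • (f - P) z) = fun z => deriv ζ z • f z - deriv ζ z • P z := by
      ext z; rw [Pi.sub_apply, smul_sub]
    rw [e2, integral_sub (hζ.deriv.integrable_smul hf) (hζ.deriv.integrable_smul hPl), h ζ hζ, e1,
      sub_self]
  refine ⟨fun z => c + P z, fun a b ha hb => ?_, continuousOn_const.add hPc, ?_⟩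
  · rw [← hPs a b ha hb, add_sub_add_left_eq_sub]
  · filter_upwards [hc] with z hz hz'
    rw [← hz hz', Pi.sub_apply]; abel

end DuBoisReymond

end

end TaubWave

namespace TaubWave

noncomputable section

/-! ### Square integrals and measurability of maps into metric spaces -/

section L2

variable {α : Type*} [MeasurableSpace α] {μ : Measure α} {G : Type*} [NormedAddCommGroup G]

theorem eLpNorm_two_sq (f : α → G) : eLpNorm f 2 μ ^ 2 = ∫⁻ x, ‖f x‖ₑ ^ 2 ∂μ := by
  rw [eLpNorm_eq_lintegral_rpow_enorm_toReal two_ne_zero ENNReal.ofNat_ne_top]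
  rw [← ENNReal.rpow_natCast, ← ENNReal.rpow_mul]
  norm_num

theorem memLp_two_iff_lintegral {f : α → G} (hf : AEStronglyMeasurable f μ) :
    MemLp f 2 μ ↔ ∫⁻ x, ‖f x‖ₑ ^ 2 ∂μ < ⊤ := by
  rw [← eLpNorm_two_sq]
  constructor
  · intro h; exact ENNReal.pow_lt_top h.2
  · intro h
    refine ⟨hf, ?_⟩
    by_contra hn
    rw [not_lt, top_le_iff] at hn
    simp [hn] at h

theorem enorm_toLp_sq {f : α → G} (hf : MemLp f 2 μ) :
    ‖hf.toLp f‖ₑ ^ 2 = ∫⁻ x, ‖f x‖ₑ ^ 2 ∂μ := by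
  rw [Lp.enorm_toLp, eLpNorm_two_sq]

theorem enorm_Lp_sq (f : Lp G 2 μ) : ‖f‖ₑ ^ 2 = ∫⁻ x, ‖f x‖ₑ ^ 2 ∂μ := by
  rw [Lp.enorm_def, eLpNorm_two_sq]

end L2

/-- A map into a second countable metric space is measurable if its distances to all points are. -/
theorem measurable_of_measurable_edist {α Y : Type*} [MeasurableSpace α] [PseudoEMetricSpace Y]
    [SecondCountableTopology Y] [MeasurableSpace Y] [BorelSpace Y] {f : α → Y}
    (h : ∀ c, Measurable fun x => edist (f x) c) : Measurable f := by
  refine measurable_of_isOpen fun U hU => ?_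
  have hr : ∀ c ∈ U, ∃ r > 0, Metric.eball c r ⊆ U := fun c hc =>
    EMetric.isOpen_iff.1 hU c hc
  choose! r hr0 hr using hr
  obtain ⟨T, hTU, hTc, hT⟩ := TopologicalSpace.isOpen_biUnion_countable U
    (fun c => Metric.eball c (r c)) fun c _ => Metric.isOpen_eball
  have hU' : U = ⋃ c ∈ T, Metric.eball c (r c) := by
    rw [hT]
    refine subset_antisymm (fun c hc => mem_iUnion₂.2 ⟨c, hc, ?_⟩) (iUnion₂_subset hr)
    exact Metric.mem_eball_self (hr0 c hc)
  rw [hU', preimage_iUnion₂]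
  exact MeasurableSet.biUnion hTc fun c _ => measurableSet_lt (h c) measurable_const

/-! ### Horizontal slices as `L²`-valued functions of `z` -/

section Slices

variable {n : ℕ}

instance : Fact ((2 : ENNReal) ≠ ⊤) := ⟨by simp⟩

open Classical in
/-- The slice `f(·, z)` as an element of `L²(ℝⁿ)`, and `0` if it is not square integrable. -/
def slice (n : ℕ) (f : Ambient n → ℂ) (z : ℝ) : L2Horizontal n :=
  if h : MemLp (fun x : Horizontal n => f (x, z)) 2 volume then h.toLp _ else 0

theorem slice_of_memLp {f : Ambient n → ℂ} {z : ℝ}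
    (h : MemLp (fun x : Horizontal n => f (x, z)) 2 volume) : slice n f z = h.toLp _ := dif_pos h

theorem coeFn_slice {f : Ambient n → ℂ} {z : ℝ}
    (h : MemLp (fun x : Horizontal n => f (x, z)) 2 volume) :
    slice n f z =ᵐ[volume] fun x => f (x, z) := by
  rw [slice_of_memLp h]; exact h.coeFn_toLp

theorem aestronglyMeasurable_section {f : Ambient n → ℂ} (hf : StronglyMeasurable f) (z : ℝ) :
    AEStronglyMeasurable (fun x : Horizontal n => f (x, z)) volume :=
  (hf.comp_measurable (measurable_id.prodMk measurable_const)).aestronglyMeasurable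

/-- The space `L²` is separable, so it is enough that the distances to fixed elements `c` are
measurable. Where the section is square integrable, such a distance is the root of a Tonelli
integral; elsewhere it is constant. -/
theorem stronglyMeasurable_slice {f : Ambient n → ℂ} (hf : StronglyMeasurable f) :
    StronglyMeasurable (slice n f) := by
  borelize (L2Horizontal n)
  refine Measurable.stronglyMeasurable (measurable_of_measurable_edist fun c => ?_)
  have hGm : Measurable fun z : ℝ => ∫⁻ x : Horizontal n, ‖f (x, z)‖ₑ ^ 2 :=
    Measurable.lintegral_prod_left' (f := fun p : Ambient n => ‖f p‖ₑ ^ 2) (hf.enorm.pow_const 2)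
  have hcm : StronglyMeasurable (c : Horizontal n → ℂ) := Lp.stronglyMeasurable c
  have hDm : Measurable fun z : ℝ => ∫⁻ x : Horizontal n, ‖f (x, z) - c x‖ₑ ^ 2 :=
    Measurable.lintegral_prod_left' (f := fun p : Ambient n => ‖f p - c p.1‖ₑ ^ 2)
      ((hf.sub (hcm.comp_measurable measurable_fst)).enorm.pow_const 2)
  have hG : MeasurableSet {z : ℝ | ∫⁻ x : Horizontal n, ‖f (x, z)‖ₑ ^ 2 < ⊤} :=
    measurableSet_lt hGm measurable_const
  have heq : (fun z => edist (slice n f z) c)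
      = {z : ℝ | ∫⁻ x : Horizontal n, ‖f (x, z)‖ₑ ^ 2 < ⊤}.piecewise
        (fun z => (∫⁻ x : Horizontal n, ‖f (x, z) - c x‖ₑ ^ 2) ^ (1 / 2 : ℝ))
        (fun _ => edist 0 c) := by
    classical
    ext z
    by_cases hz : ∫⁻ x : Horizontal n, ‖f (x, z)‖ₑ ^ 2 < ⊤
    · have hzG : z ∈ {z : ℝ | ∫⁻ x : Horizontal n, ‖f (x, z)‖ₑ ^ 2 < ⊤} := hz
      rw [piecewise_eq_of_mem _ _ _ hzG]
      have hm := (memLp_two_iff_lintegral (aestronglyMeasurable_section hf z)).2 hz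
      rw [edist_eq_enorm_sub]
      have h1 : ‖slice n f z - c‖ₑ ^ 2 = ∫⁻ x : Horizontal n, ‖f (x, z) - c x‖ₑ ^ 2 := by
        rw [enorm_Lp_sq]
        refine lintegral_congr_ae ?_
        filter_upwards [Lp.coeFn_sub (slice n f z) c, coeFn_slice hm] with x h1 h2
        rw [h1, Pi.sub_apply, h2]
      rw [← h1, ← ENNReal.rpow_natCast, ← ENNReal.rpow_mul]
      norm_num
    · have hzG : z ∉ {z : ℝ | ∫⁻ x : Horizontal n, ‖f (x, z)‖ₑ ^ 2 < ⊤} := hz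
      rw [piecewise_eq_of_notMem _ _ _ hzG]
      have hm : ¬ MemLp (fun x : Horizontal n => f (x, z)) 2 volume := fun h =>
        hz ((memLp_two_iff_lintegral (aestronglyMeasurable_section hf z)).1 h)
      rw [slice, dif_neg hm]
  rw [heq]
  exact Measurable.piecewise hG (hDm.pow_const _) measurable_const

/-- The measure `z ^ s dx dz` on `Ω`. -/
def powMeasure (n : ℕ) (s : ℝ) : Measure (Ambient n) :=
  (volume.restrict (halfSpace n)).withDensity (fun p => ENNReal.ofReal (p.2 ^ s))

theorem measurableSet_halfSpace : MeasurableSet (halfSpace n) :=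
  measurableSet_lt measurable_const measurable_snd

theorem isOpen_halfSpace : IsOpen (halfSpace n) := isOpen_lt continuous_const continuous_snd

theorem weightedMeasure_eq (n : ℕ) : weightedMeasure n = powMeasure n 1 := by
  simp [weightedMeasure, powMeasure]

theorem restrict_halfSpace : (volume : Measure (Ambient n)).restrict (halfSpace n)
    = (volume : Measure (Horizontal n)).prod (volume.restrict (Ioi 0)) := by
  have h : halfSpace n = univ ×ˢ Ioi 0 := by ext p; simp [halfSpace]
  rw [h, Measure.volume_eq_prod, ← Measure.prod_restrict, Measure.restrict_univ]

theorem measurable_powDensity (s : ℝ) :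
    Measurable fun p : Ambient n => ENNReal.ofReal (p.2 ^ s) :=
  (measurable_snd.pow_const s).ennreal_ofReal

/-- The density is positive on the half space, so all weighted measures share their null sets with
Lebesgue measure. This permits changing the exponent in almost everywhere statements. -/
theorem ae_powMeasure_iff {s : ℝ} {P : Ambient n → Prop} :
    (∀ᵐ p ∂(powMeasure n s), P p) ↔ ∀ᵐ p ∂(volume.restrict (halfSpace n)), P p := by
  rw [powMeasure, ae_withDensity_iff (measurable_powDensity s)]
  refine eventually_congr ?_
  filter_upwards [ae_restrict_mem measurableSet_halfSpace] with p hp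
  have hp' : (0 : ℝ) < p.2 := hp
  have : ENNReal.ofReal (p.2 ^ s) ≠ 0 := by
    rw [Ne, ENNReal.ofReal_eq_zero, not_le]
    positivity
  simp [this]

theorem aestronglyMeasurable_powMeasure_iff {s : ℝ} {f : Ambient n → ℂ} :
    AEStronglyMeasurable f (powMeasure n s)
      ↔ AEStronglyMeasurable f (volume.restrict (halfSpace n)) := by
  constructor
  · rintro ⟨g, hg, h⟩; exact ⟨g, hg, ae_powMeasure_iff.1 h⟩
  · rintro ⟨g, hg, h⟩; exact ⟨g, hg, ae_powMeasure_iff.2 h⟩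

theorem lintegral_powMeasure {s : ℝ} {g : Ambient n → ENNReal}
    (hg : AEMeasurable g (volume.restrict (halfSpace n))) :
    ∫⁻ p, g p ∂(powMeasure n s)
      = ∫⁻ p in halfSpace n, ENNReal.ofReal (p.2 ^ s) * g p := by
  rw [powMeasure, lintegral_withDensity_eq_lintegral_mul₀ (measurable_powDensity s).aemeasurable hg]
  rfl

theorem integral_powMeasure {s : ℝ} (g : Ambient n → ℂ) :
    ∫ p, g p ∂(powMeasure n s) = ∫ p in halfSpace n, ((p.2 ^ s : ℝ) : ℂ) * g p := by
  rw [powMeasure, integral_withDensity_eq_integral_toReal_smul (measurable_powDensity s)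
    (Eventually.of_forall fun _ => ENNReal.ofReal_lt_top)]
  refine setIntegral_congr_fun measurableSet_halfSpace fun p hp => ?_
  have hp' : (0 : ℝ) < p.2 := hp
  rw [ENNReal.toReal_ofReal (by positivity), Complex.real_smul]

theorem lintegral_halfSpace {g : Ambient n → ENNReal} (hg : Measurable g) :
    ∫⁻ p in halfSpace n, g p = ∫⁻ z in Ioi 0, ∫⁻ x : Horizontal n, g (x, z) := by
  rw [restrict_halfSpace, lintegral_prod_symm' _ hg]

theorem ae_halfSpace_sections {P : Ambient n → Prop}
    (h : ∀ᵐ p ∂(volume.restrict (halfSpace n)), P p) :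
    ∀ᵐ z ∂(volume.restrict (Ioi (0 : ℝ))), ∀ᵐ x : Horizontal n, P (x, z) := by
  rw [restrict_halfSpace] at h
  have h' : ∀ᵐ q ∂((volume.restrict (Ioi (0 : ℝ))).prod (volume : Measure (Horizontal n))),
      P (q.2, q.1) := by
    rw [← Measure.prod_swap] at h
    exact ae_of_ae_map measurable_swap.aemeasurable h
  exact Measure.ae_ae_of_ae_prod h'

theorem lintegral_sq_powMeasure {s : ℝ} {f : Ambient n → ℂ} (hf : StronglyMeasurable f) :
    ∫⁻ p, ‖f p‖ₑ ^ 2 ∂(powMeasure n s)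
      = ∫⁻ z in Ioi 0, ENNReal.ofReal (z ^ s) * ∫⁻ x : Horizontal n, ‖f (x, z)‖ₑ ^ 2 := by
  have hm : Measurable fun p => ‖f p‖ₑ ^ 2 := hf.enorm.pow_const 2
  rw [lintegral_powMeasure hm.aemeasurable,
    lintegral_halfSpace (g := fun p => ENNReal.ofReal (p.2 ^ s) * ‖f p‖ₑ ^ 2)
      ((measurable_powDensity s).mul hm)]
  refine lintegral_congr fun z => ?_
  have hx : Measurable fun x : Horizontal n => ‖f (x, z)‖ₑ ^ 2 :=
    hm.comp (measurable_prodMk_right : Measurable fun x : Horizontal n => (x, z))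
  exact lintegral_const_mul (ENNReal.ofReal (z ^ s)) hx

theorem ae_memLp_section {s : ℝ} {f : Ambient n → ℂ} (hf : StronglyMeasurable f)
    (h2 : MemLp f 2 (powMeasure n s)) :
    ∀ᵐ z ∂(volume.restrict (Ioi (0 : ℝ))), MemLp (fun x : Horizontal n => f (x, z)) 2 volume := by
  have h := (memLp_two_iff_lintegral h2.1).1 h2
  rw [lintegral_sq_powMeasure hf] at h
  have hGm : Measurable fun z : ℝ => ∫⁻ x : Horizontal n, ‖f (x, z)‖ₑ ^ 2 :=
    Measurable.lintegral_prod_left' (f := fun p : Ambient n => ‖f p‖ₑ ^ 2) (hf.enorm.pow_const 2)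
  have hmeas : Measurable fun z : ℝ =>
      ENNReal.ofReal (z ^ s) * ∫⁻ x : Horizontal n, ‖f (x, z)‖ₑ ^ 2 :=
    ((measurable_id.pow_const s).ennreal_ofReal).mul hGm
  filter_upwards [ae_lt_top hmeas h.ne, ae_restrict_mem measurableSet_Ioi] with z hz hz0
  refine (memLp_two_iff_lintegral (aestronglyMeasurable_section hf z)).2 ?_
  have hz0' : (0 : ℝ) < z := hz0
  by_contra hn
  rw [not_lt, top_le_iff] at hn
  rw [hn, ENNReal.mul_top] at hz
  · exact lt_irrefl _ hz
  · rw [Ne, ENNReal.ofReal_eq_zero, not_le]; positivity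

theorem lintegral_slice_sq {s : ℝ} {f : Ambient n → ℂ} (hf : StronglyMeasurable f)
    (h2 : MemLp f 2 (powMeasure n s)) :
    ∫⁻ z in Ioi 0, ENNReal.ofReal (z ^ s) * ‖slice n f z‖ₑ ^ 2
      = ∫⁻ p, ‖f p‖ₑ ^ 2 ∂(powMeasure n s) := by
  rw [lintegral_sq_powMeasure hf]
  refine lintegral_congr_ae ?_
  filter_upwards [ae_memLp_section hf h2] with z hz
  rw [slice_of_memLp hz, enorm_toLp_sq]

theorem integrableOn_slice_sq {s : ℝ} {f : Ambient n → ℂ} (hf : StronglyMeasurable f)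
    (h2 : MemLp f 2 (powMeasure n s)) :
    IntegrableOn (fun z => z ^ s * ‖slice n f z‖ ^ 2) (Ioi 0) ∧
      ∫ z in Ioi 0, z ^ s * ‖slice n f z‖ ^ 2
        = (∫⁻ p, ‖f p‖ₑ ^ 2 ∂(powMeasure n s)).toReal := by
  have h := lintegral_slice_sq hf h2
  have hfin := (memLp_two_iff_lintegral h2.1).1 h2
  have hmeas : AEStronglyMeasurable (fun z => z ^ s * ‖slice n f z‖ ^ 2)
      (volume.restrict (Ioi 0)) :=
    (measurable_id.pow_const s).aestronglyMeasurable.mul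
      ((stronglyMeasurable_slice hf).norm.pow 2).aestronglyMeasurable
  have hnn : ∀ᵐ z ∂(volume.restrict (Ioi (0 : ℝ))), 0 ≤ z ^ s * ‖slice n f z‖ ^ 2 := by
    filter_upwards [ae_restrict_mem measurableSet_Ioi] with z hz
    have hz' : (0 : ℝ) < z := hz
    positivity
  have hconv : ∫⁻ z in Ioi 0, ENNReal.ofReal (z ^ s * ‖slice n f z‖ ^ 2)
      = ∫⁻ p, ‖f p‖ₑ ^ 2 ∂(powMeasure n s) := by
    rw [← h]
    refine setLIntegral_congr_fun measurableSet_Ioi fun z hz => ?_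
    have hz' : (0 : ℝ) < z := hz
    rw [ENNReal.ofReal_mul (by positivity), ENNReal.ofReal_pow (norm_nonneg _), ofReal_norm]
  constructor
  · refine ⟨hmeas, ?_⟩
    rw [hasFiniteIntegral_iff_ofReal hnn, hconv]
    exact hfin
  · rw [integral_eq_lintegral_of_nonneg_ae hnn hmeas, hconv]

/-- On compact subsets of `(0, ∞)` the weight can be divided out, and `‖u‖ ≤ ‖u‖² + 1` passes from
squares to first powers. -/
theorem locallyIntegrableOn_of_sq {s : ℝ} {X : Type*} [NormedAddCommGroup X] {u : ℝ → X}
    (hm : AEStronglyMeasurable u (volume.restrict (Ioi 0)))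
    (h : IntegrableOn (fun z => z ^ s * ‖u z‖ ^ 2) (Ioi 0)) :
    LocallyIntegrableOn u (Ioi 0) := by
  rw [locallyIntegrableOn_iff isOpen_Ioi.isLocallyClosed]
  intro k hk hkc
  have h1 : IntegrableOn (fun z => z ^ (-s) * (z ^ s * ‖u z‖ ^ 2)) k := by
    refine (h.mono_set hk).continuousOn_mul ?_ hkc
    exact (RadialSystem.continuousOn_rpow (-s)).mono hk
  have h2 : IntegrableOn (fun z => ‖u z‖ ^ 2) k := by
    refine h1.congr_fun (fun z hz => ?_) hkc.measurableSet
    have hz' : (0 : ℝ) < z := hk hz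
    simp only
    rw [← mul_assoc, ← Real.rpow_add hz']; simp
  have h3 : IntegrableOn (fun _ : ℝ => (1 : ℝ)) k := integrableOn_const hkc.measure_lt_top.ne
  refine Integrable.mono' (h2.add h3) (hm.mono_measure (Measure.restrict_mono hk le_rfl)) ?_
  refine Eventually.of_forall fun z => ?_
  simp only [Pi.add_apply]
  nlinarith [sq_nonneg (‖u z‖ - 1), norm_nonneg (u z)]

theorem isL2Loc_of_memLp {s : ℝ} {f : Ambient n → ℂ} (h2 : MemLp f 2 (powMeasure n s)) :
    IsL2Loc n f := by
  intro K hK hKs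
  have hm : AEStronglyMeasurable f (volume.restrict (halfSpace n)) :=
    aestronglyMeasurable_powMeasure_iff.1 h2.1
  have hmK := hm.mono_measure (Measure.restrict_mono hKs le_rfl)
  refine (memLp_two_iff_lintegral hmK).2 ?_
  have hc : ContinuousOn (fun p : Ambient n => p.2 ^ s) K :=
    (RadialSystem.continuousOn_rpow s).comp continuousOn_snd fun p hp => hKs hp
  obtain ⟨c, hc0, hcK⟩ := hK.exists_forall_le' hc (a := 0) fun p hp =>
    Real.rpow_pos_of_pos (hKs hp) s
  have h := (memLp_two_iff_lintegral h2.1).1 h2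
  rw [lintegral_powMeasure (hm.enorm.pow_const 2)] at h
  have hle : ENNReal.ofReal c * ∫⁻ p in K, ‖f p‖ₑ ^ 2 ≤
      ∫⁻ p in halfSpace n, ENNReal.ofReal (p.2 ^ s) * ‖f p‖ₑ ^ 2 := by
    rw [← lintegral_const_mul'' _ (hmK.enorm.pow_const 2)]
    refine le_trans ?_ (lintegral_mono_set hKs)
    refine setLIntegral_mono_ae' hK.measurableSet (Eventually.of_forall fun p hp => ?_)
    gcongr
    exact hcK p hp
  have := hle.trans_lt h
  by_contra hn
  rw [not_lt, top_le_iff] at hn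
  rw [hn, ENNReal.mul_top (by simpa using hc0)] at this
  exact lt_irrefl _ this

theorem integrableOn_mul_of_isL2Loc {f : Ambient n → ℂ} (h2 : IsL2Loc n f) {η : Ambient n → ℝ}
    (hη : Continuous η) (hηc : HasCompactSupport η) (hηs : tsupport η ⊆ halfSpace n) :
    IntegrableOn (fun p => f p * ((η p : ℝ) : ℂ)) (halfSpace n) := by
  have hK : IsCompact (tsupport η) := hηc
  have h1 : IntegrableOn f (tsupport η) := by
    have : IsFiniteMeasure ((volume : Measure (Ambient n)).restrict (tsupport η)) :=
      ⟨by simpa using hK.measure_lt_top⟩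
    exact (h2 _ hK hηs).integrable one_le_two
  have h3 : IntegrableOn (fun p => f p * ((η p : ℝ) : ℂ)) (tsupport η) :=
    h1.mul_continuousOn (Complex.continuous_ofReal.comp hη).continuousOn hK
  refine ((integrableOn_iff_integrable_of_support_subset fun p hp => ?_).1 h3).integrableOn
  by_contra hn
  exact hp (by simp [image_eq_zero_of_notMem_tsupport hn])

theorem memLp_ofReal_of_hasCompactSupport {χ : Horizontal n → ℝ} (hχ : Continuous χ)
    (hχc : HasCompactSupport χ) : MemLp (fun x => ((χ x : ℝ) : ℂ)) 2 volume :=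
  (Complex.continuous_ofReal.comp hχ).memLp_of_hasCompactSupport
    (hχc.comp_left Complex.ofReal_zero)

/-- The pairing of `L²(ℝⁿ)` with a compactly supported continuous function. -/
def pairing {χ : Horizontal n → ℝ} (hχ : Continuous χ) (hχc : HasCompactSupport χ) :
    L2Horizontal n →L[ℂ] ℂ :=
  innerSL ℂ ((memLp_ofReal_of_hasCompactSupport hχ hχc).toLp _)

theorem pairing_apply {χ : Horizontal n → ℝ} (hχ : Continuous χ) (hχc : HasCompactSupport χ)
    (u : L2Horizontal n) : pairing hχ hχc u = ∫ x, (χ x : ℂ) * u x := by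
  rw [pairing, innerSL_apply_apply, L2.inner_def]
  refine integral_congr_ae ?_
  filter_upwards [(memLp_ofReal_of_hasCompactSupport hχ hχc).coeFn_toLp] with x hx
  rw [hx]
  simp [mul_comm]

theorem tsupport_tensor_subset {χ : Horizontal n → ℝ} {ζ : ℝ → ℝ} :
    tsupport (fun p : Ambient n => χ p.1 * ζ p.2) ⊆ tsupport χ ×ˢ tsupport ζ := by
  refine closure_minimal (fun p hp => ?_) ((isClosed_tsupport χ).prod (isClosed_tsupport ζ))
  have hp' : χ p.1 * ζ p.2 ≠ 0 := hp
  exact ⟨subset_tsupport χ (left_ne_zero_of_mul hp'), subset_tsupport ζ (right_ne_zero_of_mul hp')⟩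

theorem hasCompactSupport_tensor {χ : Horizontal n → ℝ} (hχc : HasCompactSupport χ) {ζ : ℝ → ℝ}
    (hζ : HasCompactSupport ζ) :
    HasCompactSupport (fun p : Ambient n => χ p.1 * ζ p.2) :=
  HasCompactSupport.of_support_subset_isCompact (IsCompact.prod hχc hζ)
    ((subset_tsupport _).trans tsupport_tensor_subset)

theorem tsupport_tensor_subset_halfSpace {χ : Horizontal n → ℝ} {ζ : ℝ → ℝ}
    (hζ : IsVerticalTest ζ) :
    tsupport (fun p : Ambient n => χ p.1 * ζ p.2) ⊆ halfSpace n :=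
  fun _ hp => hζ.2.2 (tsupport_tensor_subset hp).2

/-- Fubini's theorem for the pairing with a tensor product. -/
theorem integral_halfSpace_tensor {s : ℝ} {f : Ambient n → ℂ} (hf : StronglyMeasurable f)
    (h2 : MemLp f 2 (powMeasure n s)) {χ : Horizontal n → ℝ} (hχ : Continuous χ)
    (hχc : HasCompactSupport χ) {ζ : ℝ → ℝ} (hζ : IsVerticalTest ζ) :
    ∫ p in halfSpace n, f p * ((χ p.1 * ζ p.2 : ℝ) : ℂ)
      = ∫ x, (χ x : ℂ) * (∫ z, ζ z • slice n f z : L2Horizontal n) x := by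
  have hint : IntegrableOn (fun p => f p * ((χ p.1 * ζ p.2 : ℝ) : ℂ)) (halfSpace n) :=
    integrableOn_mul_of_isL2Loc (isL2Loc_of_memLp h2) (η := fun p => χ p.1 * ζ p.2)
      ((hχ.comp continuous_fst).mul (hζ.1.continuous.comp continuous_snd))
      (hasCompactSupport_tensor hχc hζ.2.1) (tsupport_tensor_subset_halfSpace hζ)
  have hloc : LocallyIntegrableOn (slice n f) (Ioi 0) :=
    locallyIntegrableOn_of_sq (stronglyMeasurable_slice hf).aestronglyMeasurable
      (integrableOn_slice_sq hf h2).1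
  rw [← pairing_apply hχ hχc, ← ContinuousLinearMap.integral_comp_comm _ (hζ.integrable_smul hloc)]
  rw [IntegrableOn, restrict_halfSpace] at hint
  rw [restrict_halfSpace, integral_prod_symm _ hint]
  rw [← setIntegral_eq_integral_of_forall_compl_eq_zero (s := Ioi (0 : ℝ))
    (f := fun z => pairing hχ hχc (ζ z • slice n f z))]
  · refine integral_congr_ae ?_
    filter_upwards [ae_memLp_section hf h2] with z hz
    have hsm : pairing hχ hχc (ζ z • slice n f z) = (ζ z : ℂ) • pairing hχ hχc (slice n f z) := by
      rw [← map_smul]; congr 1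
    rw [hsm, pairing_apply, smul_eq_mul, ← integral_const_mul]
    refine integral_congr_ae ?_
    filter_upwards [coeFn_slice hz] with x hx
    rw [hx]; push_cast; ring
  · intro z hz
    have : ζ z = 0 := image_eq_zero_of_notMem_tsupport fun h => hz (hζ.2.2 h)
    simp [this]

end Slices

end

end TaubWave

namespace TaubWave

noncomputable section

/-! ### The energy space as the closed graph of the weak gradient -/

section EnergyGraph

variable {n : ℕ}

/-- The coordinate directions: `none` is the vertical one. -/
def coordDir (n : ℕ) : Option (Fin n) → Ambient n
  | none => verticalDir n
  | some i => horizontalDir n i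

/-- The exponents of the weights in the energy form. -/
def coordExp (n : ℕ) : Option (Fin n) → ℝ
  | none => 1
  | some _ => -(1 / (n : ℝ))

/-- The half space is a countable union of compact cylinders, and measurability on each of them is
part of local square integrability. -/
theorem aestronglyMeasurable_of_isL2Loc {ψ : Ambient n → ℂ} (h : IsL2Loc n ψ) :
    AEStronglyMeasurable ψ (volume.restrict (halfSpace n)) := by
  have hU : halfSpace n = ⋃ m : ℕ,
      Metric.closedBall (0 : Horizontal n) m ×ˢ Icc (1 / ((m : ℝ) + 1)) m := by
    ext p
    simp only [halfSpace, mem_ofPred_eq, mem_iUnion, mem_prod, mem_closedBall_zero_iff, mem_Icc]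
    constructor
    · intro hp
      obtain ⟨m₁, h₁⟩ := exists_nat_one_div_lt hp
      obtain ⟨m₂, h₂⟩ := exists_nat_ge ‖p.1‖
      obtain ⟨m₃, h₃⟩ := exists_nat_ge p.2
      refine ⟨m₁ + m₂ + m₃, ?_, ?_, ?_⟩
      · push_cast; linarith [Nat.cast_nonneg (α := ℝ) m₁, Nat.cast_nonneg (α := ℝ) m₃]
      · refine le_trans (one_div_le_one_div_of_le (by positivity) ?_) h₁.le
        push_cast; linarith [Nat.cast_nonneg (α := ℝ) m₂, Nat.cast_nonneg (α := ℝ) m₃]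
      · push_cast; linarith [Nat.cast_nonneg (α := ℝ) m₁, Nat.cast_nonneg (α := ℝ) m₂]
    · rintro ⟨m, -, h1, -⟩
      exact lt_of_lt_of_le (by positivity) h1
  rw [hU, aestronglyMeasurable_iUnion_iff]
  intro m
  refine (h _ ((isCompact_closedBall _ _).prod isCompact_Icc) ?_).1
  rw [hU]
  exact subset_iUnion (fun m : ℕ =>
    Metric.closedBall (0 : Horizontal n) m ×ˢ Icc (1 / ((m : ℝ) + 1)) (m : ℝ)) m

theorem continuous_rpow_mul {η : Ambient n → ℝ} (hη : Continuous η)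
    (hηs : tsupport η ⊆ halfSpace n) (s : ℝ) : Continuous fun p : Ambient n => p.2 ^ s * η p := by
  refine continuous_of_tsupport fun p hp => ?_
  have hp' : p ∈ halfSpace n := hηs (closure_mono (Function.support_mul_subset_right _ _) hp)
  exact (continuousAt_snd.rpow_const (Or.inl (ne_of_gt hp'))).mul hη.continuousAt

/-- In the weighted space the unweighted pairing with `η` is represented by `z ^ (-s) η`. -/
theorem memLp_rpow_mul_test {η : Ambient n → ℝ} (hη : Continuous η)
    (hηc : HasCompactSupport η) (hηs : tsupport η ⊆ halfSpace n) (s : ℝ) :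
    MemLp (fun p : Ambient n => ((p.2 ^ (-s) * η p : ℝ) : ℂ)) 2 (powMeasure n s) := by
  have hc : Continuous fun p : Ambient n => ((p.2 ^ (-s) * η p : ℝ) : ℂ) :=
    Complex.continuous_ofReal.comp (continuous_rpow_mul hη hηs (-s))
  have hm : AEStronglyMeasurable (fun p : Ambient n => ((p.2 ^ (-s) * η p : ℝ) : ℂ))
      (powMeasure n s) := hc.aestronglyMeasurable
  refine (memLp_two_iff_lintegral hm).2 ?_
  rw [lintegral_powMeasure (hc.measurable.enorm.pow_const 2).aemeasurable]
  have hc2 : Continuous fun p : Ambient n => p.2 ^ (-s) * (η p * η p) :=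
    continuous_rpow_mul (hη.mul hη)
      ((closure_mono (Function.support_mul_subset_left _ _)).trans hηs) (-s)
  have hint : Integrable (fun p : Ambient n => p.2 ^ (-s) * (η p * η p)) volume :=
    hc2.integrable_of_hasCompactSupport (hηc.mul_right.mul_left)
  refine lt_of_le_of_lt ?_ (hint.restrict (s := halfSpace n)).2
  refine setLIntegral_mono_ae' measurableSet_halfSpace (Eventually.of_forall fun p hp => ?_)
  have hp' : (0 : ℝ) < p.2 := hp
  have e1 : ‖((p.2 ^ (-s) * η p : ℝ) : ℂ)‖ₑ = ENNReal.ofReal |p.2 ^ (-s) * η p| := by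
    rw [← ofReal_norm, Complex.norm_real, Real.norm_eq_abs]
  rw [e1, Real.enorm_eq_ofReal_abs, ← ENNReal.ofReal_pow (abs_nonneg _), ← ENNReal.ofReal_mul (by positivity)]
  refine ENNReal.ofReal_le_ofReal (le_of_eq ?_)
  have hs : p.2 ^ s * p.2 ^ (-s) = 1 := by rw [← Real.rpow_add hp']; simp
  rw [sq_abs, abs_of_nonneg (mul_nonneg (by positivity) (mul_self_nonneg _))]
  linear_combination p.2 ^ (-s) * η p ^ 2 * hs

/-- The pairing of `L²(Ω, z ^ s dx dz)` with a compactly supported continuous function on `Ω`. -/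
theorem exists_testFunctional {η : Ambient n → ℝ} (hη : Continuous η)
    (hηc : HasCompactSupport η) (hηs : tsupport η ⊆ halfSpace n) (s : ℝ) :
    ∃ T : Lp ℂ 2 (powMeasure n s) →L[ℂ] ℂ,
      ∀ u, T u = ∫ p in halfSpace n, u p * ((η p : ℝ) : ℂ) := by
  refine ⟨innerSL ℂ ((memLp_rpow_mul_test hη hηc hηs s).toLp _), fun u => ?_⟩
  rw [innerSL_apply_apply, L2.inner_def]
  have h1 : ∫ p, inner ℂ (((memLp_rpow_mul_test hη hηc hηs s).toLp _ :
      Lp ℂ 2 (powMeasure n s)) p) (u p) ∂(powMeasure n s)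
      = ∫ p, u p * ((p.2 ^ (-s) * η p : ℝ) : ℂ) ∂(powMeasure n s) := by
    refine integral_congr_ae ?_
    filter_upwards [(memLp_rpow_mul_test hη hηc hηs s).coeFn_toLp] with p hp
    rw [hp, RCLike.inner_apply, Complex.conj_ofReal]
  rw [h1, integral_powMeasure]
  refine setIntegral_congr_fun measurableSet_halfSpace fun p hp => ?_
  have hp' : (0 : ℝ) < p.2 := hp
  have : p.2 ^ s * p.2 ^ (-s) = 1 := by rw [← Real.rpow_add hp']; simp
  calc ((p.2 ^ s : ℝ) : ℂ) * (u p * ((p.2 ^ (-s) * η p : ℝ) : ℂ))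
      = ((p.2 ^ s * p.2 ^ (-s) : ℝ) : ℂ) * (u p * (η p : ℂ)) := by push_cast; ring
    _ = _ := by rw [this]; simp

theorem IsTestFunction.fderiv_apply {η : Ambient n → ℝ} (hη : IsTestFunction n η) (v : Ambient n) :
    IsTestFunction n fun p => fderiv ℝ η p v := by
  refine ⟨(hη.1.fderiv_right (m := ∞) le_rfl).clm_apply contDiff_const, hη.2.1.fderiv_apply ℝ v, ?_⟩
  exact (tsupport_fderiv_apply_subset ℝ v).trans hη.2.2

/-- The ambient Hilbert space of the graph of the weak gradient. -/
abbrev GradientSpace (n : ℕ) : Type :=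
  WithLp 2 (H n × PiLp 2 fun i : Option (Fin n) => Lp ℂ 2 (powMeasure n (coordExp n i)))

theorem exists_testFunctional_H {η : Ambient n → ℝ} (hη : IsTestFunction n η) :
    ∃ T : H n →L[ℂ] ℂ, ∀ u, T u = ∫ p in halfSpace n, u p * ((η p : ℝ) : ℂ) := by
  unfold H
  rw [weightedMeasure_eq]
  exact exists_testFunctional hη.1.continuous hη.2.1 hη.2.2 1

/-- Each weak derivative identity is the vanishing of one continuous functional. Linearity of the
graph and its closedness, hence completeness, are read off from this. -/
theorem exists_weakDerivFunctional {η : Ambient n → ℝ} (hη : IsTestFunction n η)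
    (i : Option (Fin n)) : ∃ S : GradientSpace n →L[ℂ] ℂ, ∀ x, S x = 0 ↔
      ∫ p in halfSpace n, x.fst p * ((fderiv ℝ η p (coordDir n i) : ℝ) : ℂ)
        = - ∫ p in halfSpace n, x.snd i p * ((η p : ℝ) : ℂ) := by
  obtain ⟨T₁, h₁⟩ := exists_testFunctional_H (hη.fderiv_apply (coordDir n i))
  obtain ⟨T₂, h₂⟩ := exists_testFunctional hη.1.continuous hη.2.1 hη.2.2 (coordExp n i)
  refine ⟨T₁ ∘L (WithLp.fstL 2 ℂ _ _) + T₂ ∘L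
    (PiLp.proj 2 (fun i : Option (Fin n) => Lp ℂ 2 (powMeasure n (coordExp n i))) i)
      ∘L (WithLp.sndL 2 ℂ _ _), fun x => ?_⟩
  rw [← h₂ (x.snd i), ← h₁ x.fst, ← add_eq_zero_iff_eq_neg]
  rfl

/-- The graph of the weak gradient, with the energy norm. -/
def energyGraph (n : ℕ) : Submodule ℂ (GradientSpace n) where
  carrier := {x | ∀ (i : Option (Fin n)) (η : Ambient n → ℝ), IsTestFunction n η →
    ∫ p in halfSpace n, x.fst p * ((fderiv ℝ η p (coordDir n i) : ℝ) : ℂ)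
      = - ∫ p in halfSpace n, x.snd i p * ((η p : ℝ) : ℂ)}
  add_mem' {x y} hx hy i η hη := by
    obtain ⟨S, hS⟩ := exists_weakDerivFunctional hη i
    rw [← hS, map_add, (hS x).2 (hx i η hη), (hS y).2 (hy i η hη), add_zero]
  zero_mem' i η hη := by
    obtain ⟨S, hS⟩ := exists_weakDerivFunctional hη i
    rw [← hS, map_zero]
  smul_mem' c x hx i η hη := by
    obtain ⟨S, hS⟩ := exists_weakDerivFunctional hη i
    rw [← hS, map_smul, (hS x).2 (hx i η hη), smul_zero]

theorem isClosed_energyGraph : IsClosed (energyGraph n : Set (GradientSpace n)) := by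
  have : (energyGraph n : Set (GradientSpace n)) = ⋂ (i : Option (Fin n)) (η : Ambient n → ℝ)
      (_ : IsTestFunction n η), {x | ∫ p in halfSpace n,
        x.fst p * ((fderiv ℝ η p (coordDir n i) : ℝ) : ℂ)
          = - ∫ p in halfSpace n, x.snd i p * ((η p : ℝ) : ℂ)} := by
    ext x; simp only [mem_iInter]; rfl
  rw [this]
  refine isClosed_iInter fun i => isClosed_iInter fun η => isClosed_iInter fun hη => ?_
  obtain ⟨S, hS⟩ := exists_weakDerivFunctional hη i
  simp only [← hS]
  exact isClosed_eq S.continuous continuous_const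

instance : CompleteSpace (energyGraph n) := isClosed_energyGraph.completeSpace_coe

theorem ae_eq_of_isWeakDeriv {v : Ambient n} {φ ψ₁ ψ₂ : Ambient n → ℂ}
    (h₁ : IsWeakDeriv n v φ ψ₁) (h₂ : IsWeakDeriv n v φ ψ₂) :
    ψ₁ =ᵐ[volume.restrict (halfSpace n)] ψ₂ := by
  have hloc : ∀ ψ, IsL2Loc n ψ → LocallyIntegrableOn ψ (halfSpace n) volume := fun ψ hψ => by
    rw [locallyIntegrableOn_iff isOpen_halfSpace.isLocallyClosed]
    intro k hk hkc
    have : IsFiniteMeasure ((volume : Measure (Ambient n)).restrict k) :=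
      ⟨by simpa using hkc.measure_lt_top⟩
    exact (hψ k hkc hk).integrable one_le_two
  have h := isOpen_halfSpace.ae_eq_zero_of_integral_contDiff_smul_eq_zero (μ := volume)
    ((hloc _ h₁.1).sub (hloc _ h₂.1)) fun η hη hηc hηs => ?_
  · rw [Filter.EventuallyEq, ae_restrict_iff' measurableSet_halfSpace]
    filter_upwards [h] with p hp hps
    exact sub_eq_zero.1 (hp hps)
  · have hη' : IsTestFunction n η := ⟨hη, hηc, hηs⟩
    have e := (h₁.2 η hη').symm.trans (h₂.2 η hη')
    have hi := fun ψ (hψ : IsL2Loc n ψ) =>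
      integrableOn_mul_of_isL2Loc hψ hη.continuous hηc hηs
    rw [← setIntegral_eq_integral_of_forall_compl_eq_zero (s := halfSpace n)]
    · have : ∫ p in halfSpace n, η p • (ψ₁ - ψ₂) p
          = ∫ p in halfSpace n, (ψ₁ p * ((η p : ℝ) : ℂ) - ψ₂ p * ((η p : ℝ) : ℂ)) := by
        refine integral_congr_ae (Eventually.of_forall fun p => ?_)
        simp only [Pi.sub_apply, Complex.real_smul]; ring
      rw [this, integral_sub (hi _ h₁.1) (hi _ h₂.1)]
      rw [neg_inj] at e
      rw [e, sub_self]
    · intro p hp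
      rw [image_eq_zero_of_notMem_tsupport fun h => hp (hηs h), zero_smul]

theorem isWeakDeriv_weakDeriv {v : Ambient n} {φ : Ambient n → ℂ} (h : ∃ ψ, IsWeakDeriv n v φ ψ) :
    IsWeakDeriv n v φ (weakDeriv n v φ) := by
  rw [weakDeriv, dif_pos h]; exact h.choose_spec

end EnergyGraph

end

end TaubWave

namespace TaubWave

noncomputable section

/-! ### The energy form, its Hilbert space and the resolvent -/

section EnergyForm

variable {n : ℕ}

theorem ae_halfSpace_of_ae_H {P : Ambient n → Prop} (h : ∀ᵐ p ∂(weightedMeasure n), P p) :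
    ∀ᵐ p ∂(volume.restrict (halfSpace n)), P p := by
  rw [weightedMeasure_eq] at h; exact ae_powMeasure_iff.1 h

theorem memLp_H (φ : H n) : MemLp φ 2 (powMeasure n 1) := by
  rw [← weightedMeasure_eq]; exact Lp.memLp φ

theorem isWeakDeriv_of_mem_energyGraph {x : GradientSpace n} (hx : x ∈ energyGraph n)
    (i : Option (Fin n)) : IsWeakDeriv n (coordDir n i) x.fst (x.snd i) :=
  ⟨isL2Loc_of_memLp (Lp.memLp _), fun η hη => hx i η hη⟩

theorem weakDeriv_ae_eq_of_mem_energyGraph {x : GradientSpace n} (hx : x ∈ energyGraph n)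
    (i : Option (Fin n)) :
    weakDeriv n (coordDir n i) x.fst =ᵐ[volume.restrict (halfSpace n)] x.snd i :=
  ae_eq_of_isWeakDeriv (isWeakDeriv_weakDeriv ⟨_, isWeakDeriv_of_mem_energyGraph hx i⟩)
    (isWeakDeriv_of_mem_energyGraph hx i)

theorem energyIntegral_eq {φ : H n} (h : IsH1Loc n φ) :
    energyIntegral n φ
      = ∑ i, ∫⁻ p, ‖weakDeriv n (coordDir n i) φ p‖ₑ ^ 2 ∂(powMeasure n (coordExp n i)) := by
  have hm : ∀ i, AEMeasurable (fun p => ‖weakDeriv n (coordDir n i) φ p‖ₑ ^ 2)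
      (volume.restrict (halfSpace n)) := by
    rintro (_ | i)
    · exact (aestronglyMeasurable_of_isL2Loc (isWeakDeriv_weakDeriv h.2.1).1).enorm.pow_const 2
    · exact (aestronglyMeasurable_of_isL2Loc (isWeakDeriv_weakDeriv (h.2.2 i)).1).enorm.pow_const 2
  have hlin : ∀ i, ∫⁻ p, ‖weakDeriv n (coordDir n i) φ p‖ₑ ^ 2 ∂(powMeasure n (coordExp n i))
      = ∫⁻ p in halfSpace n, ENNReal.ofReal (p.2 ^ coordExp n i) *
        ‖weakDeriv n (coordDir n i) φ p‖ₑ ^ 2 := fun i => lintegral_powMeasure (hm i)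
  rw [Finset.sum_congr rfl fun i _ => hlin i, ← lintegral_finsetSum' _ fun i _ =>
    (show AEMeasurable (fun p : Ambient n => ENNReal.ofReal (p.2 ^ coordExp n i) *
      ‖weakDeriv n (coordDir n i) φ p‖ₑ ^ 2) _ from
      (measurable_powDensity _).aemeasurable.mul (hm i))]
  refine lintegral_congr fun p => ?_
  rw [Fintype.sum_option, Finset.mul_sum]
  simp [coordExp, coordDir]

theorem exists_lift_of_mem_energySpace {φ : H n} (h : φ ∈ energySpace n) :
    ∃ x ∈ energyGraph n, WithLp.fst x = φ := by
  obtain ⟨hH, hfin⟩ := h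
  have hwd : ∀ i, IsWeakDeriv n (coordDir n i) φ (weakDeriv n (coordDir n i) φ) := by
    rintro (_ | i)
    · exact isWeakDeriv_weakDeriv hH.2.1
    · exact isWeakDeriv_weakDeriv (hH.2.2 i)
  have hmem : ∀ i, MemLp (weakDeriv n (coordDir n i) φ) 2 (powMeasure n (coordExp n i)) := by
    intro i
    refine (memLp_two_iff_lintegral (aestronglyMeasurable_powMeasure_iff.2
      (aestronglyMeasurable_of_isL2Loc (hwd i).1))).2 ?_
    rw [energyIntegral_eq hH] at hfin
    exact lt_of_le_of_lt (Finset.single_le_sum (f := fun i =>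
      ∫⁻ p, ‖weakDeriv n (coordDir n i) φ p‖ₑ ^ 2 ∂(powMeasure n (coordExp n i)))
      (fun _ _ => zero_le) (Finset.mem_univ i)) hfin
  refine ⟨WithLp.toLp 2 (φ, WithLp.toLp 2 fun i => (hmem i).toLp _), fun i η hη => ?_, rfl⟩
  have h1 := (hwd i).2 η hη
  refine h1.trans ?_
  congr 1
  refine integral_congr_ae ?_
  filter_upwards [ae_powMeasure_iff.1 (hmem i).coeFn_toLp] with p hp
  exact congrArg (· * ((η p : ℝ) : ℂ)) hp.symm

theorem fst_mem_energySpace {x : GradientSpace n} (hx : x ∈ energyGraph n) :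
    x.fst ∈ energySpace n := by
  have hH : IsH1Loc n x.fst := ⟨isL2Loc_of_memLp (memLp_H _),
    ⟨_, isWeakDeriv_of_mem_energyGraph hx none⟩,
    fun i => ⟨_, isWeakDeriv_of_mem_energyGraph hx (some i)⟩⟩
  refine ⟨hH, ?_⟩
  rw [energyIntegral_eq hH]
  refine ENNReal.sum_lt_top.2 fun i _ => ?_
  have : ∫⁻ p, ‖weakDeriv n (coordDir n i) x.fst p‖ₑ ^ 2 ∂(powMeasure n (coordExp n i))
      = ∫⁻ p, ‖x.snd i p‖ₑ ^ 2 ∂(powMeasure n (coordExp n i)) := by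
    refine lintegral_congr_ae ?_
    filter_upwards [ae_powMeasure_iff.2 (weakDeriv_ae_eq_of_mem_energyGraph hx i)] with p hp
    rw [hp]
  rw [this]
  exact (memLp_two_iff_lintegral (Lp.aestronglyMeasurable _)).1 (Lp.memLp _)

theorem inner_powMeasure_eq {s : ℝ} (u v : Lp ℂ 2 (powMeasure n s)) :
    IntegrableOn (fun p => ((p.2 ^ s : ℝ) : ℂ) * (v p * starRingEnd ℂ (u p))) (halfSpace n) ∧
      inner ℂ u v = ∫ p in halfSpace n, ((p.2 ^ s : ℝ) : ℂ) * (v p * starRingEnd ℂ (u p)) := by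
  have h := L2.integrable_inner (𝕜 := ℂ) u v
  constructor
  · have h := (integrable_withDensity_iff_integrable_smul' (measurable_powDensity s)
      (Eventually.of_forall fun _ => ENNReal.ofReal_lt_top)).1 h
    refine IntegrableOn.congr_fun h (fun p hp => ?_) measurableSet_halfSpace
    have hp' : (0 : ℝ) < p.2 := hp
    simp only [RCLike.inner_apply]
    rw [ENNReal.toReal_ofReal (by positivity), Complex.real_smul]
  · rw [L2.inner_def, integral_powMeasure]
    rfl

/-- The order of the arguments is reversed because `inner ℂ` is conjugate linear in its first slot
and the form in its second. -/
theorem energyForm_fst {x y : GradientSpace n} (hx : x ∈ energyGraph n) (hy : y ∈ energyGraph n) :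
    energyForm n x.fst y.fst = inner ℂ y.snd x.snd := by
  rw [PiLp.inner_apply]
  rw [Finset.sum_congr rfl fun i _ => (inner_powMeasure_eq (y.snd i) (x.snd i)).2,
    ← integral_finsetSum _ fun i _ => (inner_powMeasure_eq (y.snd i) (x.snd i)).1, energyForm]
  refine integral_congr_ae ?_
  have hx' := ae_all_iff.2 (weakDeriv_ae_eq_of_mem_energyGraph hx)
  have hy' := ae_all_iff.2 (weakDeriv_ae_eq_of_mem_energyGraph hy)
  filter_upwards [hx', hy'] with p h1 h2
  rw [Fintype.sum_option, Finset.mul_sum, ← h1 none, ← h2 none]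
  simp only [← h1, ← h2]
  simp [coordExp, coordDir]

/-- The energy space as a Hilbert space. -/
def EnergyDomain (n : ℕ) : Type := energyGraph n

instance : NormedAddCommGroup (EnergyDomain n) :=
  inferInstanceAs (NormedAddCommGroup (energyGraph n))

instance : InnerProductSpace ℂ (EnergyDomain n) :=
  inferInstanceAs (InnerProductSpace ℂ (energyGraph n))

instance : CompleteSpace (EnergyDomain n) := inferInstanceAs (CompleteSpace (energyGraph n))

/-- An element of the energy space together with its weak gradient. -/
def EnergyDomain.graph (x : EnergyDomain n) : GradientSpace n := Subtype.val x

theorem EnergyDomain.graph_mem (x : EnergyDomain n) : x.graph ∈ energyGraph n := Subtype.property x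

theorem norm_sq_gradientSpace (x : GradientSpace n) :
    ‖x‖ ^ 2 = ‖x.fst‖ ^ 2 + ∑ i, ‖x.snd i‖ ^ 2 := by
  rw [WithLp.prod_norm_sq_eq_of_L2, PiLp.norm_sq_eq_of_L2]

theorem EnergyDomain.norm_sq (x : EnergyDomain n) :
    ‖x‖ ^ 2 = ‖x.graph.fst‖ ^ 2 + ∑ i, ‖x.graph.snd i‖ ^ 2 := norm_sq_gradientSpace x.graph

theorem EnergyDomain.inner_eq (x y : EnergyDomain n) :
    inner ℂ x y = inner ℂ x.graph.fst y.graph.fst + inner ℂ x.graph.snd y.graph.snd :=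
  WithLp.prod_inner_apply x.graph y.graph

theorem EnergyDomain.norm_fst_le (x : EnergyDomain n) : ‖x.graph.fst‖ ≤ ‖x‖ := by
  refine le_of_sq_le_sq ?_ (norm_nonneg _)
  have h := x.norm_sq
  have : 0 ≤ ∑ i, ‖x.graph.snd i‖ ^ 2 := Finset.sum_nonneg fun i _ => by positivity
  linarith

/-- The embedding of the energy space into `H`. -/
def energyEmbed (n : ℕ) : EnergyDomain n →L[ℂ] H n :=
  LinearMap.mkContinuous
    { toFun := fun x => x.graph.fst
      map_add' := fun _ _ => rfl
      map_smul' := fun _ _ => rfl } 1 fun x => by rw [one_mul]; exact x.norm_fst_le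

theorem energyEmbed_apply (x : EnergyDomain n) : energyEmbed n x = x.graph.fst := rfl

theorem norm_energyEmbed_le : ‖energyEmbed n‖ ≤ 1 :=
  LinearMap.mkContinuous_norm_le _ zero_le_one _

/-- Weak derivatives are unique, so an element of the graph over zero has zero gradient. -/
theorem energyEmbed_injective : Function.Injective (energyEmbed n) := by
  rw [injective_iff_map_eq_zero]
  intro x hx
  rw [energyEmbed_apply] at hx
  have h0 : ∀ i, x.graph.snd i = 0 := fun i => by
    have h1 := isWeakDeriv_of_mem_energyGraph x.graph_mem i
    have h2 := isWeakDeriv_of_mem_energyGraph (energyGraph n).zero_mem i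
    rw [hx] at h1
    exact Lp.ext (ae_powMeasure_iff.2 (ae_eq_of_isWeakDeriv h1 h2))
  rw [← norm_eq_zero, ← sq_eq_zero_iff, x.norm_sq, hx]
  simp [h0]

theorem mem_range_energyEmbed {φ : H n} (h : φ ∈ energySpace n) : φ ∈ range (energyEmbed n) := by
  obtain ⟨x, hx, rfl⟩ := exists_lift_of_mem_energySpace h
  exact ⟨⟨x, hx⟩, rfl⟩

/-- This makes `energyEmbed ∘ energyAdjoint` the resolvent: pairing `j* h` with `y` in the energy
space is the weak form of `(1 + A) φ = h`. -/
theorem energyForm_energyEmbed (x y : EnergyDomain n) :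
    energyForm n (energyEmbed n x) (energyEmbed n y)
      = inner ℂ y x - inner ℂ (energyEmbed n y) (energyEmbed n x) := by
  rw [energyEmbed_apply, energyEmbed_apply, energyForm_fst x.graph_mem y.graph_mem,
    EnergyDomain.inner_eq]
  simp

/-- The adjoint of the embedding of the energy space. -/
def energyAdjoint (n : ℕ) : H n →L[ℂ] EnergyDomain n := ContinuousLinearMap.adjoint (energyEmbed n)

/-- Membership in the domain bounds the energy pairing with `f` by the `H` norm on the range of the
embedding. Hahn-Banach extends this functional to `H` and Riesz represents it by the preimage. No
density of the energy space in `H` is needed. -/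
theorem exists_eq_of_mem_operatorDomain {f : H n} (hf : f ∈ operatorDomain n) :
    ∃ h : H n, f = energyEmbed n (energyAdjoint n h) := by
  obtain ⟨hfE, C, hC0, hC⟩ := hf
  obtain ⟨x, rfl⟩ := mem_range_energyEmbed hfE
  have hb : ∀ y : EnergyDomain n, ‖inner ℂ x y‖ ≤ (C + ‖energyEmbed n x‖) * ‖energyEmbed n y‖ := by
    intro y
    have h1 := hC (energyEmbed n y) (fst_mem_energySpace y.graph_mem)
    rw [energyForm_energyEmbed] at h1
    have h2 : ‖inner ℂ (energyEmbed n y) (energyEmbed n x)‖ ≤ ‖energyEmbed n y‖ * ‖energyEmbed n x‖ := norm_inner_le_norm _ _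
    have h3 : inner ℂ y x = (inner ℂ y x - inner ℂ (energyEmbed n y) (energyEmbed n x)) + inner ℂ (energyEmbed n y) (energyEmbed n x) := by ring
    have h4 : ‖inner ℂ x y‖ = ‖inner ℂ y x‖ := norm_inner_symm (𝕜 := ℂ) x y
    rw [h4, h3]
    refine (norm_add_le _ _).trans ?_
    nlinarith
  let e : EnergyDomain n ≃ₗ[ℂ] LinearMap.range (energyEmbed n : EnergyDomain n →ₗ[ℂ] H n) :=
    LinearEquiv.ofInjective _ energyEmbed_injective
  let ℓ : LinearMap.range (energyEmbed n : EnergyDomain n →ₗ[ℂ] H n) →L[ℂ] ℂ :=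
    LinearMap.mkContinuous ((innerSL ℂ x : EnergyDomain n →ₗ[ℂ] ℂ) ∘ₗ e.symm.toLinearMap)
      (C + ‖energyEmbed n x‖) fun u => by
        obtain ⟨y, rfl⟩ := e.surjective u
        change ‖inner ℂ x (e.symm (e y))‖ ≤ _
        rw [e.symm_apply_apply]
        exact hb y
  obtain ⟨L, hL, -⟩ := exists_extension_norm_eq _ ℓ
  refine ⟨(InnerProductSpace.toDual ℂ (H n)).symm L, ?_⟩
  congr 1
  refine ext_inner_right ℂ fun y => ?_
  rw [energyAdjoint, ContinuousLinearMap.adjoint_inner_left, InnerProductSpace.toDual_symm_apply]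
  have := hL (e y)
  have h2 : ℓ (e y) = inner ℂ x y := by simp [ℓ]
  rw [← h2, ← this]
  rfl

end EnergyForm

end

end TaubWave

/-! ### Solutions remain in the domain of the operator -/

namespace TaubWave

noncomputable section

/-- A function whose pairings with all vectors have continuous derivatives is differentiable. -/
theorem hasDerivWithinAt_of_forall_inner {X : Type*} [NormedAddCommGroup X]
    [InnerProductSpace ℂ X] [CompleteSpace X] {ψ w : ℝ → X} (hw : ContinuousOn w (Ici 0))
    (h : ∀ x : X, ∀ t : ℝ, 0 ≤ t →
      HasDerivWithinAt (fun s => inner ℂ x (ψ s)) (inner ℂ x (w t)) (Ici 0) t) {t : ℝ}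
    (ht : 0 ≤ t) : HasDerivWithinAt ψ (w t) (Ici 0) t := by
  have hwc : Continuous fun t : ℝ => w (max t 0) :=
    hw.comp_continuous (continuous_id.max continuous_const) fun t => le_max_right t 0
  set F : ℝ → X := fun t => ∫ s in (0 : ℝ)..t, w (max s 0) with hF
  have hFd : ∀ t, HasDerivAt F (w (max t 0)) t := fun t =>
    intervalIntegral.integral_hasDerivAt_right (hwc.intervalIntegrable _ _)
      hwc.stronglyMeasurable.stronglyMeasurableAtFilter hwc.continuousAt
  have hFd' : ∀ t, 0 ≤ t → HasDerivWithinAt F (w t) (Ici 0) t := fun t ht => by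
    have := (hFd t).hasDerivWithinAt (s := Ici 0)
    rwa [max_eq_left ht] at this
  have hconst : ∀ x : X, ∀ t, 0 ≤ t → inner ℂ x (ψ t) - inner ℂ x (F t) = inner ℂ x (ψ 0) := by
    intro x t ht
    have hd : ∀ s, 0 ≤ s →
        HasDerivWithinAt (fun s => inner ℂ x (ψ s) - inner ℂ x (F s)) 0 (Ici 0) s := by
      intro s hs
      have h2 : HasDerivWithinAt (fun s => inner ℂ x (F s)) (inner ℂ x (w s)) (Ici 0) s :=
        ((innerSL ℂ x).restrictScalars ℝ).hasFDerivAt.comp_hasDerivWithinAt s (hFd' s hs)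
      have := (h x s hs).sub h2
      rw [sub_self] at this
      exact this
    have := constant_of_has_deriv_right_zero (a := 0) (b := t)
      (f := fun s => inner ℂ x (ψ s) - inner ℂ x (F s))
      (fun s hs => ((hd s hs.1).continuousWithinAt).mono fun _ hy => hy.1)
      (fun s hs => (hd s hs.1).mono (Ici_subset_Ici.2 hs.1)) t ⟨ht, le_rfl⟩
    rw [this]
    simp [hF]
  have heq : ∀ t, 0 ≤ t → ψ t = ψ 0 + F t := fun t ht => by
    refine ext_inner_left ℂ fun x => ?_
    rw [inner_add_right, ← hconst x t ht]; ring
  exact ((hFd' t ht).const_add (ψ 0)).congr (fun s hs => heq s hs) (heq t ht)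

section Solution

variable {n : ℕ}

/-- The resolvent `(1 + A)⁻¹` of the operator associated with the energy form. -/
theorem inner_resolvent (h : H n) (y : EnergyDomain n) :
    inner ℂ y (energyAdjoint n h) = inner ℂ (energyEmbed n y) h := by
  rw [energyAdjoint, ContinuousLinearMap.adjoint_inner_right]

theorem inner_resolvent_left (h : H n) (y : EnergyDomain n) :
    inner ℂ (energyAdjoint n h) y = inner ℂ h (energyEmbed n y) := by
  rw [energyAdjoint, ContinuousLinearMap.adjoint_inner_left]

/-- A solution with initial data in the domain of the operator stays in the domain, continuously
for the graph norm. -/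
theorem IsSolution.exists_continuousOn_resolvent {f g : H n} (hf : f ∈ operatorDomain n)
    (hg : g ∈ energySpace n) {φ : ℝ → H n} (h : IsSolution n f g φ) :
    ∃ θ : ℝ → H n, ContinuousOn θ (Ici 0) ∧
      ∀ t, 0 ≤ t → φ t = energyEmbed n (energyAdjoint n (θ t)) := by
  obtain ⟨hE, -, h0, φ', hd, -, h0', hweak⟩ := h
  obtain ⟨f', rfl⟩ := exists_eq_of_mem_operatorDomain hf
  obtain ⟨g', rfl⟩ := mem_range_energyEmbed hg
  have hφc : ContinuousOn φ (Ici 0) := fun t ht => (hd t ht).continuousWithinAt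
  let J : H n →L[ℂ] H n := energyEmbed n ∘L energyAdjoint n
  have hJ : ∀ x y : H n, inner ℂ (J x) y = inner ℂ x (J y) := fun x y => by
    have h1 : inner ℂ (energyEmbed n (energyAdjoint n x)) y
        = inner ℂ (energyAdjoint n x) (energyAdjoint n y) := (inner_resolvent y _).symm
    have h2 : inner ℂ x (energyEmbed n (energyAdjoint n y))
        = inner ℂ (energyAdjoint n x) (energyAdjoint n y) := (inner_resolvent_left x _).symm
    exact h1.trans h2.symm
  refine exists_continuousOn_preimage (energyEmbed n) norm_energyEmbed_le energyEmbed_injective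
    φ φ' hd (fun t ht => ?_) (fun t ht => mem_range_energyEmbed (hE t ht)) f' g' h0 h0'
  refine hasDerivWithinAt_of_forall_inner (ψ := fun s => J (φ' s)) (w := fun t => J (φ t) - φ t)
    ((J.continuous.comp_continuousOn hφc).sub hφc) (fun x t ht => ?_) ht
  obtain ⟨y, hy⟩ := mem_range_energyEmbed (hE t ht)
  -- Testing with `J x` is possible for every `x ∈ H` and turns the form into a bounded expression:
  -- `b(φ, J x) = ⟨x, φ - J φ⟩`. This upgrades the weak equation to a strong one for `J φ'`.
  have h1 := hweak (J x) (fst_mem_energySpace (energyAdjoint n x).graph_mem) t ht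
  have h2 : -energyForm n (φ t) (J x) = inner ℂ x (J (φ t) - φ t) := by
    rw [← hy]
    change -energyForm n (energyEmbed n y) (energyEmbed n (energyAdjoint n x)) = _
    rw [energyForm_energyEmbed, inner_resolvent_left, inner_sub_right, ← hJ]
    simp only [J, ContinuousLinearMap.comp_apply]
    ring
  rw [h2] at h1
  simpa only [hJ] using h1

end Solution

end

end TaubWave

namespace TaubWave

noncomputable section

/-! ### The Fourier transform of weak derivative identities -/

section Fourier

variable {E : Type*} [NormedAddCommGroup E] [InnerProductSpace ℝ E] [FiniteDimensional ℝ E]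
  [MeasurableSpace E] [BorelSpace E]

theorem integrable_smul_of_memLp_two {u : E → ℝ} {Q : E → ℂ} (hu : MemLp u 2 volume)
    (hQ : MemLp Q 2 volume) : Integrable (fun x => u x • Q x) volume :=
  memLp_one_iff_integrable.1 (hQ.smul hu)

/-- An identity `Q = ∑ i, ∂_{m i} (Y i)` between square integrable functions, valid against smooth
compactly supported functions, is valid against smooth functions in `H¹`. -/
theorem integral_smul_eq_of_forall_hasCompactSupport {κ : Type*} [Fintype κ] {m : κ → E}
    {Q : E → ℂ} {Y : κ → E → ℂ} (hQ : MemLp Q 2 volume) (hY : ∀ i, MemLp (Y i) 2 volume)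
    (h : ∀ χ : E → ℝ, ContDiff ℝ ∞ χ → HasCompactSupport χ →
      ∫ x, χ x • Q x = -∑ i, ∫ x, fderiv ℝ χ x (m i) • Y i x)
    {u : E → ℝ} (hu : ContDiff ℝ ∞ u) (hu2 : MemLp u 2 volume)
    (hu' : ∀ i, MemLp (fun x => fderiv ℝ u x (m i)) 2 volume) :
    ∫ x, u x • Q x = -∑ i, ∫ x, fderiv ℝ u x (m i) • Y i x := by
  let ρ : ContDiffBump (0 : E) := ⟨1, 2, one_pos, one_lt_two⟩
  have hρ : ContDiff ℝ ∞ ρ := ρ.contDiff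
  have hρ1 : ρ 0 = 1 := ρ.one_of_mem_closedBall
    (Metric.mem_closedBall_self ρ.rIn_pos.le)
  obtain ⟨C, hC⟩ := (hρ.continuous_fderiv (by simp)).bounded_above_of_compact_support
    (ρ.hasCompactSupport.fderiv ℝ)
  -- Cutoffs `ρ (c x)` with `c → 0` exhaust the space, and their derivatives carry a factor `c`, so
  -- the commutator term disappears in the limit.
  let c : ℕ → ℝ := fun k => ((k : ℝ) + 1)⁻¹
  have hc0 : Tendsto c atTop (𝓝 0) := by
    simpa [c] using tendsto_one_div_add_atTop_nhds_zero_nat (𝕜 := ℝ)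
  have hcpos : ∀ k, 0 < c k := fun k => by positivity
  have hc1 : ∀ k, c k ≤ 1 := fun k => by
    refine inv_le_one_of_one_le₀ ?_
    linarith [Nat.cast_nonneg (α := ℝ) k]
  let r : ℕ → E → ℝ := fun k x => ρ (c k • x)
  have hr : ∀ k, ContDiff ℝ ∞ (r k) := fun k => hρ.comp (contDiff_const_smul (c k))
  have hrc : ∀ k, HasCompactSupport (r k) := fun k =>
    ρ.hasCompactSupport.comp_smul (hcpos k).ne'
  have hr' : ∀ k x v, fderiv ℝ (r k) x v = c k * fderiv ℝ ρ (c k • x) v := fun k x v => by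
    have := fderiv_comp_smul (𝕜 := ℝ) (f := ρ) (c k) (x := x)
    change fderiv ℝ (fun x => ρ (c k • x)) x v = _
    rw [this]; rfl
  have hr1 : ∀ x, Tendsto (fun k => r k x) atTop (𝓝 1) := fun x => by
    have : Tendsto (fun k => ρ (c k • x)) atTop (𝓝 (ρ ((0 : ℝ) • x))) :=
      (ρ.continuous.tendsto _).comp (hc0.smul_const x)
    simpa [zero_smul, hρ1] using this
  have hrle : ∀ k x, |r k x| ≤ 1 := fun k x => by
    rw [abs_of_nonneg ρ.nonneg]; exact ρ.le_one
  have hr'le : ∀ k x i, |fderiv ℝ (r k) x (m i)| ≤ c k * (C * ‖m i‖) := fun k x i => by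
    rw [hr', abs_mul, abs_of_pos (hcpos k)]
    refine mul_le_mul_of_nonneg_left ?_ (hcpos k).le
    exact (ContinuousLinearMap.le_opNorm _ _).trans
      (mul_le_mul_of_nonneg_right (hC _) (norm_nonneg _))
  have hr'0 : ∀ x i, Tendsto (fun k => fderiv ℝ (r k) x (m i)) atTop (𝓝 0) := fun x i => by
    refine squeeze_zero_norm (fun k => hr'le k x i) ?_
    simpa using hc0.mul_const (C * ‖m i‖)
  have hC0 : 0 ≤ C := (norm_nonneg _).trans (hC 0)
  have hfd : ∀ k x i, fderiv ℝ (fun x => r k x * u x) x (m i)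
      = r k x * fderiv ℝ u x (m i) + u x * fderiv ℝ (r k) x (m i) := fun k x i => by
    rw [fderiv_fun_mul ((hr k).differentiable (by simp) x) (hu.differentiable (by simp) x)]
    rfl
  have hk : ∀ k, ∫ x, (r k x * u x) • Q x = -∑ i, ∫ x,
      (r k x * fderiv ℝ u x (m i) + u x * fderiv ℝ (r k) x (m i)) • Y i x := fun k => by
    rw [h (fun x => r k x * u x) ((hr k).mul hu) (hrc k).mul_right]
    simp only [hfd]
  have hL : Tendsto (fun k => ∫ x, (r k x * u x) • Q x) atTop (𝓝 (∫ x, u x • Q x)) := by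
    refine tendsto_integral_of_dominated_convergence (fun x => ‖u x • Q x‖) (fun k => ?_)
      (integrable_smul_of_memLp_two hu2 hQ).norm (fun k => ?_) ?_
    · exact (((hr k).continuous.mul hu.continuous).aestronglyMeasurable).smul hQ.1
    · refine Eventually.of_forall fun x => ?_
      rw [mul_smul, norm_smul]
      exact mul_le_of_le_one_left (norm_nonneg _) (hrle k x)
    · refine Eventually.of_forall fun x => ?_
      simpa using ((hr1 x).mul_const (u x)).smul_const (Q x)
  have hR : Tendsto (fun k => -∑ i, ∫ x,
      (r k x * fderiv ℝ u x (m i) + u x * fderiv ℝ (r k) x (m i)) • Y i x) atTop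
      (𝓝 (-∑ i, ∫ x, fderiv ℝ u x (m i) • Y i x)) := by
    refine (tendsto_finsetSum _ fun i _ => ?_).neg
    refine tendsto_integral_of_dominated_convergence
      (fun x => ‖fderiv ℝ u x (m i) • Y i x‖ + (C * ‖m i‖) * ‖u x • Y i x‖) (fun k => ?_)
      ((integrable_smul_of_memLp_two (hu' i) (hY i)).norm.add
        ((integrable_smul_of_memLp_two hu2 (hY i)).norm.const_mul _)) (fun k => ?_) ?_
    · have h1 : Continuous fun x => fderiv ℝ u x (m i) :=
        (hu.continuous_fderiv (by simp)).clm_apply continuous_const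
      have h2 : Continuous fun x => fderiv ℝ (r k) x (m i) :=
        ((hr k).continuous_fderiv (by simp)).clm_apply continuous_const
      exact (((hr k).continuous.mul h1).add (hu.continuous.mul h2)).aestronglyMeasurable.smul
        (hY i).1
    · refine Eventually.of_forall fun x => ?_
      rw [add_smul]
      refine (norm_add_le _ _).trans (add_le_add ?_ ?_)
      · rw [mul_smul, norm_smul]
        exact mul_le_of_le_one_left (norm_nonneg _) (hrle k x)
      · rw [mul_comm, mul_smul, norm_smul]
        refine mul_le_mul_of_nonneg_right ((hr'le k x i).trans ?_) (norm_nonneg _)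
        exact mul_le_of_le_one_left (by positivity) (hc1 k)
    · refine Eventually.of_forall fun x => ?_
      have h1 := ((hr1 x).mul_const (fderiv ℝ u x (m i))).add ((hr'0 x i).const_mul (u x))
      simpa using h1.smul_const (Y i x)
  exact tendsto_nhds_unique hL (hR.congr fun k => (hk k).symm)

/-- The identities are known for real test functions; this transfers them to complex Schwartz
functions. -/
theorem integral_smul_eq_re_add_im {g Y : E → ℂ} (hg : MemLp g 2 volume) (hY : MemLp Y 2 volume) :
    ∫ x, g x • Y x = (∫ x, (g x).re • Y x) + Complex.I * ∫ x, (g x).im • Y x := by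
  have h1 : Integrable (fun x => (g x).re • Y x) volume := integrable_smul_of_memLp_two hg.re hY
  have h2 : Integrable (fun x => (g x).im • Y x) volume := integrable_smul_of_memLp_two hg.im hY
  rw [← integral_const_mul, ← integral_add h1 (h2.const_mul _)]
  refine integral_congr_ae (Eventually.of_forall fun x => ?_)
  simp only [smul_eq_mul, Complex.real_smul]
  conv_lhs => rw [← Complex.re_add_im (g x)]
  ring

theorem sum_temperedDistribution_apply {κ : Type*} (s : Finset κ) (f : κ → 𝓢'(E, ℂ))
    (g : 𝓢(E, ℂ)) : (∑ i ∈ s, f i) g = ∑ i ∈ s, f i g :=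
  map_sum ({ toFun := fun f => f g, map_zero' := rfl, map_add' := fun _ _ => rfl } :
    𝓢'(E, ℂ) →+ ℂ) f s

open LineDeriv FourierTransform in
/-- The Fourier transform of the identity `Q = ∑ i, ∂_{m i} (Y i)`. -/
theorem fourier_ae_eq_of_forall_hasCompactSupport {κ : Type*} [Fintype κ] {m : κ → E}
    {Q : Lp ℂ 2 (volume : Measure E)} {Y : κ → Lp ℂ 2 (volume : Measure E)}
    (h : ∀ χ : E → ℝ, ContDiff ℝ ∞ χ → HasCompactSupport χ →
      ∫ x, χ x • Q x = -∑ i, ∫ x, fderiv ℝ χ x (m i) • Y i x) :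
    (𝓕 Q : Lp ℂ 2 (volume : Measure E)) =ᵐ[volume] fun ξ =>
      ∑ i, (2 * Real.pi * inner ℝ ξ (m i) : ℝ) • (Complex.I * (𝓕 (Y i) : Lp ℂ 2 volume) ξ) := by
  -- The identity holds between tempered distributions once it is extended from compactly supported
  -- to Schwartz test functions.
  have hdist : (Q : 𝓢'(E, ℂ)) = ∑ i, ∂_{m i} (Y i : 𝓢'(E, ℂ)) := by
    ext g
    have hre : ContDiff ℝ ∞ fun x => (g x).re := Complex.reCLM.contDiff.comp g.smooth'
    have him : ContDiff ℝ ∞ fun x => (g x).im := Complex.imCLM.contDiff.comp g.smooth'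
    have hgd : Differentiable ℝ g := g.differentiable
    have hre' : ∀ x v, fderiv ℝ (fun x => (g x).re) x v = ((∂_{v} g : 𝓢(E, ℂ)) x).re := fun x v => by
      rw [SchwartzMap.lineDerivOp_apply_eq_fderiv]
      have := (Complex.reCLM.hasFDerivAt.comp x (hgd x).hasFDerivAt).fderiv
      change fderiv ℝ (Complex.reCLM ∘ g) x v = _
      rw [this]; rfl
    have him' : ∀ x v, fderiv ℝ (fun x => (g x).im) x v = ((∂_{v} g : 𝓢(E, ℂ)) x).im := fun x v => by
      rw [SchwartzMap.lineDerivOp_apply_eq_fderiv]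
      have := (Complex.imCLM.hasFDerivAt.comp x (hgd x).hasFDerivAt).fderiv
      change fderiv ℝ (Complex.imCLM ∘ g) x v = _
      rw [this]; rfl
    have hg2 : MemLp g 2 volume := g.memLp 2
    have hg2' : ∀ v : E, MemLp (∂_{v} g : 𝓢(E, ℂ)) 2 volume := fun v => (∂_{v} g : 𝓢(E, ℂ)).memLp 2
    have e1 := integral_smul_eq_of_forall_hasCompactSupport (Lp.memLp Q) (fun i => Lp.memLp (Y i))
      h hre hg2.re fun i => by simp only [hre']; exact (hg2' (m i)).re
    have e2 := integral_smul_eq_of_forall_hasCompactSupport (Lp.memLp Q) (fun i => Lp.memLp (Y i))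
      h him hg2.im fun i => by simp only [him']; exact (hg2' (m i)).im
    rw [sum_temperedDistribution_apply, Lp.toTemperedDistribution_apply, integral_smul_eq_re_add_im hg2 (Lp.memLp Q),
      e1, e2]
    simp only [TemperedDistribution.lineDerivOp_apply_apply, map_neg,
      Lp.toTemperedDistribution_apply]
    simp only [integral_smul_eq_re_add_im (hg2' _) (Lp.memLp _), hre', him', Finset.sum_neg_distrib,
      Finset.sum_add_distrib, ← Finset.mul_sum]
    ring
  have hF : ((𝓕 Q : Lp ℂ 2 (volume : Measure E)) : 𝓢'(E, ℂ)) = ∑ i, (2 * Real.pi * Complex.I) •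
      TemperedDistribution.smulLeftCLM ℂ (fun x => ((inner ℝ x (m i) : ℝ) : ℂ))
        ((𝓕 (Y i) : Lp ℂ 2 (volume : Measure E)) : 𝓢'(E, ℂ)) := by
    rw [← Lp.fourier_toTemperedDistribution_eq, hdist, fourier_sum]
    refine Finset.sum_congr rfl fun i _ => ?_
    rw [TemperedDistribution.fourier_lineDerivOp_eq, Lp.fourier_toTemperedDistribution_eq]
  -- The factor `ξ` is unbounded, so a single term need not be square integrable. Local
  -- integrability is enough to compare both sides against test functions.
  have hloc : ∀ i, LocallyIntegrable (fun ξ => (2 * Real.pi * inner ℝ ξ (m i) : ℝ) •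
      (Complex.I * (𝓕 (Y i) : Lp ℂ 2 (volume : Measure E)) ξ)) volume := fun i => by
    have h1 : LocallyIntegrable (fun ξ => Complex.I * (𝓕 (Y i) : Lp ℂ 2 (volume : Measure E)) ξ)
        volume := ((Lp.memLp (𝓕 (Y i) : Lp ℂ 2 (volume : Measure E))).locallyIntegrable
          one_le_two).smul Complex.I
    rw [← locallyIntegrableOn_univ] at h1 ⊢
    refine h1.continuousOn_smul isOpen_univ.isLocallyClosed (Continuous.continuousOn ?_)
    fun_prop
  refine ae_eq_of_integral_contDiff_smul_eq
    ((Lp.memLp _).locallyIntegrable one_le_two) (locallyIntegrable_finsetSum _ fun i _ => hloc i) ?_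
  intro χ hχ hχc
  have hχc' : HasCompactSupport fun x => ((χ x : ℝ) : ℂ) := hχc.comp_left Complex.ofReal_zero
  have hχ' : ContDiff ℝ ∞ fun x => ((χ x : ℝ) : ℂ) := Complex.ofRealCLM.contDiff.comp hχ
  have hg := congrArg (fun f : 𝓢'(E, ℂ) => f (hχc'.toSchwartzMap hχ')) hF
  simp only [sum_temperedDistribution_apply, Lp.toTemperedDistribution_apply] at hg
  have e1 : ∫ x, χ x • (𝓕 Q : Lp ℂ 2 (volume : Measure E)) x
      = ∫ x, (hχc'.toSchwartzMap hχ') x • (𝓕 Q : Lp ℂ 2 (volume : Measure E)) x := by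
    refine integral_congr_ae (Eventually.of_forall fun x => ?_)
    simp
  rw [e1, hg]
  simp only [Finset.smul_sum]
  rw [integral_finsetSum _ fun i _ => ?_]
  · refine Finset.sum_congr rfl fun i _ => ?_
    change (2 * Real.pi * Complex.I) • (TemperedDistribution.smulLeftCLM ℂ _ _) _ = _
    rw [TemperedDistribution.smulLeftCLM_apply_apply, Lp.toTemperedDistribution_apply,
      smul_eq_mul, ← integral_const_mul]
    refine integral_congr_ae (Eventually.of_forall fun x => ?_)
    have ht : (fun x : E => ((inner ℝ x (m i) : ℝ) : ℂ)).HasTemperateGrowth := by fun_prop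
    simp only [SchwartzMap.smulLeftCLM_apply_apply ht, HasCompactSupport.toSchwartzMap_toFun,
      smul_eq_mul, Complex.real_smul]
    push_cast
    ring
  · exact (hloc i).integrable_smul_left_of_hasCompactSupport hχ.continuous hχc

end Fourier

end

end TaubWave

namespace TaubWave

noncomputable section

/-! ### Multiplication by bounded real symbols on `L²` -/

section Symbols

variable {E : Type*} [MeasurableSpace E] {μ : Measure E}

/-- Bounded measurable real functions, which act on `L²` by multiplication. -/
def IsBoundedSymbol (m : E → ℝ) : Prop := Measurable m ∧ ∃ C, ∀ x, |m x| ≤ C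

theorem IsBoundedSymbol.mul {a b : E → ℝ} (ha : IsBoundedSymbol a) (hb : IsBoundedSymbol b) :
    IsBoundedSymbol fun x => a x * b x := by
  obtain ⟨ha, C, hC⟩ := ha
  obtain ⟨hb, D, hD⟩ := hb
  refine ⟨ha.mul hb, C * D, fun x => ?_⟩
  rw [abs_mul]
  exact mul_le_mul (hC x) (hD x) (abs_nonneg _) ((abs_nonneg _).trans (hC x))

theorem isBoundedSymbol_indicator {A : Set E} (hA : MeasurableSet A) {m : E → ℝ}
    (hm : Measurable m) {C : ℝ} (hC0 : 0 ≤ C) (hC : ∀ x ∈ A, |m x| ≤ C) :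
    IsBoundedSymbol (A.indicator m) := by
  refine ⟨hm.indicator hA, C, fun x => ?_⟩
  by_cases hx : x ∈ A
  · rw [indicator_of_mem hx]; exact hC x hx
  · rw [indicator_of_notMem hx, abs_zero]; exact hC0

theorem IsBoundedSymbol.memLp {m : E → ℝ} (hm : IsBoundedSymbol m) (u : Lp ℂ 2 μ) :
    MemLp (fun x => (m x : ℂ) * u x) 2 μ := by
  obtain ⟨hm, C, hC⟩ := hm
  refine MemLp.of_le_mul (c := C) (Lp.memLp u)
    ((Complex.measurable_ofReal.comp hm).aestronglyMeasurable.mul (Lp.aestronglyMeasurable u))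
    (Eventually.of_forall fun x => ?_)
  rw [norm_mul, Complex.norm_real, Real.norm_eq_abs]
  exact mul_le_mul_of_nonneg_right (hC x) (norm_nonneg _)

open Classical in
/-- Multiplication by a bounded symbol on `L²`. -/
def symbolMul (μ : Measure E) (m : E → ℝ) : Lp ℂ 2 μ →L[ℂ] Lp ℂ 2 μ :=
  if hm : IsBoundedSymbol m then
    LinearMap.mkContinuous
      { toFun := fun u => (hm.memLp u).toLp _
        map_add' := fun u v => by
          rw [← MemLp.toLp_add (hm.memLp u) (hm.memLp v)]
          refine (MemLp.toLp_eq_toLp_iff _ _).2 ?_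
          filter_upwards [Lp.coeFn_add u v] with x hx
          rw [hx]; simp only [Pi.add_apply]; ring
        map_smul' := fun c u => by
          rw [RingHom.id_apply, ← MemLp.toLp_const_smul c (hm.memLp u)]
          refine (MemLp.toLp_eq_toLp_iff _ _).2 ?_
          filter_upwards [Lp.coeFn_smul c u] with x hx
          rw [hx]; simp only [Pi.smul_apply, smul_eq_mul]; ring }
      hm.2.choose fun u => by
        refine Lp.norm_le_mul_norm_of_ae_le_mul ?_
        filter_upwards [(hm.memLp u).coeFn_toLp] with x hx
        change ‖(hm.memLp u).toLp _ x‖ ≤ _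
        rw [hx, norm_mul, Complex.norm_real, Real.norm_eq_abs]
        exact mul_le_mul_of_nonneg_right (hm.2.choose_spec x) (norm_nonneg _)
  else 0

variable {m : E → ℝ}

theorem coeFn_symbolMul (hm : IsBoundedSymbol m) (u : Lp ℂ 2 μ) :
    symbolMul μ m u =ᵐ[μ] fun x => (m x : ℂ) * u x := by
  rw [symbolMul, dif_pos hm]
  exact (hm.memLp u).coeFn_toLp

theorem symbolMul_symbolMul {a b : E → ℝ} (ha : IsBoundedSymbol a) (hb : IsBoundedSymbol b)
    (u : Lp ℂ 2 μ) : symbolMul μ a (symbolMul μ b u) = symbolMul μ (fun x => a x * b x) u := by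
  refine Lp.ext ?_
  filter_upwards [coeFn_symbolMul ha (symbolMul μ b u), coeFn_symbolMul hb u,
    coeFn_symbolMul (ha.mul hb) u] with x h1 h2 h3
  rw [h1, h2, h3]; push_cast; ring

theorem integrable_symbol_mul_sq (hm : IsBoundedSymbol m) (u : Lp ℂ 2 μ) :
    Integrable (fun x => m x * ‖u x‖ ^ 2) μ := by
  obtain ⟨hm, C, hC⟩ := hm
  refine ((Lp.memLp u).integrable_norm_pow two_ne_zero).bdd_mul hm.aestronglyMeasurable (c := C)
    (Eventually.of_forall fun x => hC x)

theorem inner_symbolMul (hm : IsBoundedSymbol m) (u : Lp ℂ 2 μ) :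
    (inner ℂ (symbolMul μ m u) u).re = ∫ x, m x * ‖u x‖ ^ 2 ∂μ := by
  rw [L2.inner_def]
  have : ∫ x, inner ℂ (symbolMul μ m u x) (u x) ∂μ = ((∫ x, m x * ‖u x‖ ^ 2 ∂μ : ℝ) : ℂ) := by
    rw [← integral_complex_ofReal]
    refine integral_congr_ae ?_
    filter_upwards [coeFn_symbolMul hm u] with x hx
    rw [hx, RCLike.inner_apply, map_mul, Complex.conj_ofReal]
    push_cast
    rw [← Complex.mul_conj']
    ring
  rw [this, Complex.ofReal_re]

theorem norm_sq_L2 (u : Lp ℂ 2 μ) : ‖u‖ ^ 2 = ∫ x, ‖u x‖ ^ 2 ∂μ := by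
  have h := L2.inner_def (𝕜 := ℂ) u u
  rw [inner_self_eq_norm_sq_to_K] at h
  have h2 : ∫ x, inner ℂ (u x) (u x) ∂μ = ((∫ x, ‖u x‖ ^ 2 ∂μ : ℝ) : ℂ) := by
    rw [← integral_complex_ofReal]
    refine integral_congr_ae (Eventually.of_forall fun x => ?_)
    simp only [inner_self_eq_norm_sq_to_K]
    norm_cast
  rw [h2] at h
  exact Complex.ofReal_injective ((Complex.ofReal_pow _ _).trans h)

theorem norm_sq_symbolMul (hm : IsBoundedSymbol m) (u : Lp ℂ 2 μ) :
    ‖symbolMul μ m u‖ ^ 2 = ∫ x, m x ^ 2 * ‖u x‖ ^ 2 ∂μ := by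
  rw [norm_sq_L2]
  refine integral_congr_ae ?_
  filter_upwards [coeFn_symbolMul hm u] with x hx
  rw [hx, norm_mul, Complex.norm_real, mul_pow, Real.norm_eq_abs, sq_abs]

/-- This pointwise comparison has two uses: with `m = k` the symbol of `-Δ` it gives the upper bound
`K² ≤ R K`, and with `m` an indicator it gives the spectral gap on an annulus. -/
theorem norm_sq_symbolMul_le {k : E → ℝ} (hm : IsBoundedSymbol m) (hk : IsBoundedSymbol k) {R : ℝ}
    (h : ∀ x, m x ^ 2 ≤ R * k x) (u : Lp ℂ 2 μ) :
    ‖symbolMul μ m u‖ ^ 2 ≤ R * (inner ℂ (symbolMul μ k u) u).re := by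
  rw [norm_sq_symbolMul hm, inner_symbolMul hk, ← integral_const_mul]
  have hm2 : IsBoundedSymbol fun x => m x ^ 2 := by simpa only [sq] using hm.mul hm
  refine integral_mono (integrable_symbol_mul_sq hm2 u)
    ((integrable_symbol_mul_sq hk u).const_mul R) fun x => ?_
  simp only
  rw [← mul_assoc]
  exact mul_le_mul_of_nonneg_right (h x) (by positivity)

theorem enorm_sq_symbolMul_indicator {A : Set E} (hA : MeasurableSet A) (u : Lp ℂ 2 μ) :
    ‖symbolMul μ (A.indicator 1) u‖ₑ ^ 2 = ∫⁻ x in A, ‖u x‖ₑ ^ 2 ∂μ := by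
  have hm : IsBoundedSymbol (A.indicator (1 : E → ℝ)) :=
    isBoundedSymbol_indicator hA measurable_const zero_le_one fun x _ => by simp
  rw [enorm_Lp_sq, ← lintegral_indicator hA]
  refine lintegral_congr_ae ?_
  filter_upwards [coeFn_symbolMul hm u] with x hx
  rw [hx]
  by_cases hxA : x ∈ A <;> simp [hxA]

end Symbols

end

end TaubWave

namespace TaubWave

noncomputable section

/-! ### The weak equation for the resolvent and its slices -/

section WeakEquation

variable {n : ℕ}

theorem memLp_test {η : Ambient n → ℝ} (hη : Continuous η)
    (hηc : HasCompactSupport η) (hηs : tsupport η ⊆ halfSpace n) (s : ℝ) :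
    MemLp (fun p => ((η p : ℝ) : ℂ)) 2 (powMeasure n s) := by
  have h := memLp_rpow_mul_test (continuous_rpow_mul hη hηs s) hηc.mul_left
    ((closure_mono (Function.support_mul_subset_right _ _)).trans hηs) s
  refine h.ae_eq (ae_powMeasure_iff.2 ?_)
  filter_upwards [ae_restrict_mem measurableSet_halfSpace] with p hp
  have hp' : (0 : ℝ) < p.2 := hp
  rw [← mul_assoc, ← Real.rpow_add hp']
  simp

theorem integral_test_mul_fderiv {η ζ : Ambient n → ℝ} (hη : IsTestFunction n η)
    (hζ : IsTestFunction n ζ) (v : Ambient n) :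
    ∫ p in halfSpace n, ((η p : ℝ) : ℂ) * ((fderiv ℝ ζ p v : ℝ) : ℂ)
      = -∫ p in halfSpace n, ((fderiv ℝ η p v : ℝ) : ℂ) * ((ζ p : ℝ) : ℂ) := by
  have hη' := hη.fderiv_apply v
  have hζ' := hζ.fderiv_apply v
  rw [setIntegral_eq_integral_of_forall_compl_eq_zero,
    setIntegral_eq_integral_of_forall_compl_eq_zero]
  · simp only [← Complex.ofReal_mul]
    rw [integral_complex_ofReal, integral_complex_ofReal, ← Complex.ofReal_neg]
    congr 1
    have : (volume : Measure (Ambient n)).IsAddHaarMeasure :=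
      Measure.prod.instIsAddHaarMeasure (volume : Measure (Horizontal n)) (volume : Measure ℝ)
    refine integral_mul_fderiv_eq_neg_fderiv_mul_of_integrable ?_ ?_ ?_
      (fun p _ => hη.1.differentiable (by simp) p) (fun p _ => hζ.1.differentiable (by simp) p)
    · exact (hη'.1.continuous.mul hζ.1.continuous).integrable_of_hasCompactSupport hζ.2.1.mul_left
    · exact (hη.1.continuous.mul hζ'.1.continuous).integrable_of_hasCompactSupport hη.2.1.mul_right
    · exact (hη.1.continuous.mul hζ.1.continuous).integrable_of_hasCompactSupport hη.2.1.mul_right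
  · intro p hp
    rw [image_eq_zero_of_notMem_tsupport fun h => hp (hζ.2.2 h)]; simp
  · intro p hp
    rw [image_eq_zero_of_notMem_tsupport fun h => hp (hη.2.2 h)]; simp

/-- Test functions lie in the energy space with their classical gradient, so they may be inserted in
the resolvent identity. -/
theorem exists_testElement {η : Ambient n → ℝ} (hη : IsTestFunction n η) :
    ∃ y : EnergyDomain n,
      (∀ᵐ p ∂(weightedMeasure n), y.graph.fst p = ((η p : ℝ) : ℂ)) ∧
      ∀ i, ∀ᵐ p ∂(powMeasure n (coordExp n i)),
        y.graph.snd i p = ((fderiv ℝ η p (coordDir n i) : ℝ) : ℂ) := by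
  have h0 : MemLp (fun p => ((η p : ℝ) : ℂ)) 2 (weightedMeasure n) := by
    rw [weightedMeasure_eq]; exact memLp_test hη.1.continuous hη.2.1 hη.2.2 1
  have hi : ∀ i, MemLp (fun p => ((fderiv ℝ η p (coordDir n i) : ℝ) : ℂ)) 2
      (powMeasure n (coordExp n i)) := fun i =>
    memLp_test (hη.fderiv_apply _).1.continuous (hη.fderiv_apply _).2.1 (hη.fderiv_apply _).2.2 _
  let x : GradientSpace n := WithLp.toLp 2 (h0.toLp _, WithLp.toLp 2 fun i => (hi i).toLp _)
  have hx : x ∈ energyGraph n := by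
    intro i ζ hζ
    have e1 : ∫ p in halfSpace n, x.fst p * ((fderiv ℝ ζ p (coordDir n i) : ℝ) : ℂ)
        = ∫ p in halfSpace n, ((η p : ℝ) : ℂ) * ((fderiv ℝ ζ p (coordDir n i) : ℝ) : ℂ) := by
      refine integral_congr_ae ?_
      filter_upwards [ae_halfSpace_of_ae_H h0.coeFn_toLp] with p hp
      exact congrArg (· * ((fderiv ℝ ζ p (coordDir n i) : ℝ) : ℂ)) hp
    have e2 : ∫ p in halfSpace n, x.snd i p * ((ζ p : ℝ) : ℂ)
        = ∫ p in halfSpace n, ((fderiv ℝ η p (coordDir n i) : ℝ) : ℂ) * ((ζ p : ℝ) : ℂ) := by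
      refine integral_congr_ae ?_
      filter_upwards [ae_powMeasure_iff.1 (hi i).coeFn_toLp] with p hp
      exact congrArg (· * ((ζ p : ℝ) : ℂ)) hp
    rw [e1, e2]
    exact integral_test_mul_fderiv hη hζ _
  exact ⟨⟨x, hx⟩, h0.coeFn_toLp, fun i => (hi i).coeFn_toLp⟩

theorem integral_weightedMeasure (g : Ambient n → ℂ) :
    ∫ p, g p ∂(weightedMeasure n) = ∫ p in halfSpace n, (p.2 : ℂ) * g p := by
  rw [weightedMeasure_eq, integral_powMeasure]
  simp only [Real.rpow_one]

/-- The element `h - φ = A φ` for `φ = (1 + A)⁻¹ h`. -/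
def residual (h : H n) : H n := h - (energyAdjoint n h).graph.fst

/-- The weak form of `A φ = h - φ` for `φ = (1 + A)⁻¹ h`. -/
theorem resolvent_weak_equation (h : H n) {η : Ambient n → ℝ} (hη : IsTestFunction n η) :
    ∑ i, ∫ p in halfSpace n, (energyAdjoint n h).graph.snd i p *
        ((p.2 ^ coordExp n i * fderiv ℝ η p (coordDir n i) : ℝ) : ℂ)
      = ∫ p in halfSpace n, residual h p * ((p.2 * η p : ℝ) : ℂ) := by
  obtain ⟨y, hy0, hy⟩ := exists_testElement hη
  set x := energyAdjoint n h with hx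
  have h1 := inner_resolvent h y
  rw [← hx, EnergyDomain.inner_eq, energyEmbed_apply, PiLp.inner_apply] at h1
  -- The `H` part of the energy inner product moves to the other side and turns `h` into the
  -- residual `h - φ = A φ`.
  have h2 : ∑ i, inner ℂ (y.graph.snd i) (x.graph.snd i) = inner ℂ y.graph.fst (residual h) := by
    rw [residual, inner_sub_right, ← h1, ← hx]; ring
  have e1 : ∀ i, inner ℂ (y.graph.snd i) (x.graph.snd i) = ∫ p in halfSpace n, x.graph.snd i p *
        ((p.2 ^ coordExp n i * fderiv ℝ η p (coordDir n i) : ℝ) : ℂ) := fun i => by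
    rw [(inner_powMeasure_eq _ _).2]
    refine integral_congr_ae ?_
    filter_upwards [ae_powMeasure_iff.1 (hy i)] with p hp
    rw [hp, Complex.conj_ofReal]; push_cast; ring
  have e2 : inner ℂ y.graph.fst (residual h)
      = ∫ p in halfSpace n, residual h p * ((p.2 * η p : ℝ) : ℂ) := by
    rw [L2.inner_def]
    have : ∫ p, inner ℂ (y.graph.fst p) (residual h p) ∂(weightedMeasure n)
        = ∫ p, residual h p * ((η p : ℝ) : ℂ) ∂(weightedMeasure n) := by
      refine integral_congr_ae ?_
      filter_upwards [hy0] with p hp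
      rw [hp, RCLike.inner_apply, Complex.conj_ofReal]
    rw [this, integral_weightedMeasure]
    refine integral_congr_ae (Eventually.of_forall fun p => ?_)
    push_cast; ring
  rw [← e2, ← h2]
  exact Finset.sum_congr rfl fun i _ => (e1 i).symm

section Tensor

variable {χ : Horizontal n → ℝ} {ζ : ℝ → ℝ}

theorem isTestFunction_tensor (hχ : ContDiff ℝ ∞ χ) (hχc : HasCompactSupport χ)
    (hζ : IsVerticalTest ζ) : IsTestFunction n fun p => χ p.1 * ζ p.2 :=
  ⟨(hχ.comp contDiff_fst).mul (hζ.1.comp contDiff_snd), hasCompactSupport_tensor hχc hζ.2.1,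
    tsupport_tensor_subset_halfSpace hζ⟩

theorem fderiv_tensor (hχ : ContDiff ℝ ∞ χ) (hζ : ContDiff ℝ ∞ ζ) (p v : Ambient n) :
    fderiv ℝ (fun p : Ambient n => χ p.1 * ζ p.2) p v
      = χ p.1 * (v.2 * deriv ζ p.2) + ζ p.2 * fderiv ℝ χ p.1 v.1 := by
  have h1 : HasFDerivAt (fun p : Ambient n => χ p.1)
      ((fderiv ℝ χ p.1).comp (ContinuousLinearMap.fst ℝ _ _)) p :=
    ((hχ.differentiable (by simp) p.1).hasFDerivAt).comp p hasFDerivAt_fst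
  have h2 : HasFDerivAt (fun p : Ambient n => ζ p.2)
      ((fderiv ℝ ζ p.2).comp (ContinuousLinearMap.snd ℝ _ _)) p :=
    ((hζ.differentiable (by simp) p.2).hasFDerivAt).comp p hasFDerivAt_snd
  rw [(h1.fun_mul h2).fderiv]
  have h3 : fderiv ℝ ζ p.2 v.2 = v.2 * deriv ζ p.2 := by
    rw [fderiv_eq_smul_deriv, smul_eq_mul]
  simp [h3]

end Tensor

theorem locallyIntegrableOn_slice {s : ℝ} {f : Ambient n → ℂ} (hf : StronglyMeasurable f)
    (h2 : MemLp f 2 (powMeasure n s)) : LocallyIntegrableOn (slice n f) (Ioi 0) :=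
  locallyIntegrableOn_of_sq (stronglyMeasurable_slice hf).aestronglyMeasurable
    (integrableOn_slice_sq hf h2).1

/-- Fubini's theorem for a weighted pairing with a tensor product. -/
theorem integral_halfSpace_weighted_tensor {s : ℝ} {f : Ambient n → ℂ} (hf : StronglyMeasurable f)
    (h2 : MemLp f 2 (powMeasure n s)) {χ : Horizontal n → ℝ} (hχ : Continuous χ)
    (hχc : HasCompactSupport χ) {ζ : ℝ → ℝ} (hζ : IsVerticalTest ζ) (r : ℝ) :
    ∫ p in halfSpace n, f p * ((p.2 ^ r * (χ p.1 * ζ p.2) : ℝ) : ℂ)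
      = ∫ x, χ x • (∫ z, (z ^ r * ζ z) • slice n f z : L2Horizontal n) x := by
  have := integral_halfSpace_tensor hf h2 hχ hχc (hζ.mul_rpow r)
  simp only [Complex.real_smul]
  rw [← this]
  refine integral_congr_ae (Eventually.of_forall fun p => ?_)
  simp only
  congr 2
  ring

theorem integral_smul_sub {χ : Horizontal n → ℝ} (hχ : Continuous χ) (hχc : HasCompactSupport χ)
    (u v : L2Horizontal n) :
    ∫ x, χ x • (u - v) x = (∫ x, χ x • u x) - ∫ x, χ x • v x := by
  simp only [Complex.real_smul, ← pairing_apply hχ hχc, map_sub]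

theorem L2Horizontal_ext {u v : L2Horizontal n}
    (h : ∀ χ : Horizontal n → ℝ, ContDiff ℝ ∞ χ → HasCompactSupport χ →
      ∫ x, χ x • u x = ∫ x, χ x • v x) : u = v :=
  Lp.ext (ae_eq_of_integral_contDiff_smul_eq ((Lp.memLp u).locallyIntegrable one_le_two)
    ((Lp.memLp v).locallyIntegrable one_le_two) h)

/-- The vertical derivative of the slices. -/
theorem slice_weakDeriv (x : EnergyDomain n) {ζ : ℝ → ℝ} (hζ : IsVerticalTest ζ) :
    ∫ z, deriv ζ z • slice n x.graph.fst z = -∫ z, ζ z • slice n (x.graph.snd none) z := by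
  rw [eq_neg_iff_add_eq_zero, ← sub_neg_eq_add, sub_eq_zero]
  refine L2Horizontal_ext fun χ hχ hχc => ?_
  have h := x.graph_mem none _ (isTestFunction_tensor hχ hχc hζ)
  have h1 := integral_halfSpace_weighted_tensor (Lp.stronglyMeasurable x.graph.fst)
    (memLp_H x.graph.fst) hχ.continuous hχc hζ.deriv 0
  have h2 := integral_halfSpace_weighted_tensor (Lp.stronglyMeasurable (x.graph.snd none))
    (Lp.memLp (x.graph.snd none)) hχ.continuous hχc hζ 0
  simp only [Real.rpow_zero, one_mul] at h1 h2
  have h3 := integral_smul_sub hχ.continuous hχc 0 (∫ z, ζ z • slice n (x.graph.snd none) z)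
  have h0 : ∫ y : Horizontal n, χ y • (0 : L2Horizontal n) y = 0 := by
    simp only [Complex.real_smul, ← pairing_apply hχ.continuous hχc, map_zero]
  rw [zero_sub, h0, zero_sub] at h3
  rw [h3, ← h1, ← h2, ← h]
  refine integral_congr_ae (Eventually.of_forall fun p => ?_)
  simp [fderiv_tensor hχ hζ.1, coordDir, verticalDir]

/-- The horizontal derivatives of the slices. -/
theorem slice_horizontal (x : EnergyDomain n) (i : Fin n) {ζ : ℝ → ℝ} (hζ : IsVerticalTest ζ)
    {χ : Horizontal n → ℝ} (hχ : ContDiff ℝ ∞ χ) (hχc : HasCompactSupport χ) :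
    ∫ y, χ y • (∫ z, ζ z • slice n (x.graph.snd (some i)) z : L2Horizontal n) y
      = -∫ y, fderiv ℝ χ y (EuclideanSpace.single i 1) •
        (∫ z, ζ z • slice n x.graph.fst z : L2Horizontal n) y := by
  have h := x.graph_mem (some i) _ (isTestFunction_tensor hχ hχc hζ)
  have h1 := integral_halfSpace_weighted_tensor (Lp.stronglyMeasurable x.graph.fst)
    (memLp_H x.graph.fst) (χ := fun y => fderiv ℝ χ y (EuclideanSpace.single i 1))
    ((hχ.continuous_fderiv (by simp)).clm_apply continuous_const)
    (hχc.fderiv_apply ℝ _) hζ 0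
  have h2 := integral_halfSpace_weighted_tensor (Lp.stronglyMeasurable (x.graph.snd (some i)))
    (Lp.memLp (x.graph.snd (some i))) hχ.continuous hχc hζ 0
  simp only [Real.rpow_zero, one_mul] at h1 h2
  rw [← h1, ← h2, eq_neg_iff_add_eq_zero, add_comm, ← eq_neg_iff_add_eq_zero, ← h]
  refine integral_congr_ae (Eventually.of_forall fun p => ?_)
  simp only [fderiv_tensor hχ hζ.1]
  simp [coordDir, horizontalDir, mul_comm]

/-- The equation `A φ = h - φ` for the slices of `φ = (1 + A)⁻¹ h`. -/
theorem slice_equation (h : H n) {ζ : ℝ → ℝ} (hζ : IsVerticalTest ζ)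
    {χ : Horizontal n → ℝ} (hχ : ContDiff ℝ ∞ χ) (hχc : HasCompactSupport χ) :
    ∫ y, χ y • ((∫ z, (z * deriv ζ z) • slice n ((energyAdjoint n h).graph.snd none) z)
        - ∫ z, (z * ζ z) • slice n (residual h) z : L2Horizontal n) y
      = -∑ i, ∫ y, fderiv ℝ χ y (EuclideanSpace.single i 1) •
        (∫ z, (z ^ (-(1 / (n : ℝ))) * ζ z) • slice n ((energyAdjoint n h).graph.snd (some i)) z :
          L2Horizontal n) y := by
  have h0 := resolvent_weak_equation h (isTestFunction_tensor hχ hχc hζ)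
  rw [Fintype.sum_option] at h0
  set x := energyAdjoint n h with hx
  have h1 := integral_halfSpace_weighted_tensor (Lp.stronglyMeasurable (x.graph.snd none))
    (Lp.memLp (x.graph.snd none)) hχ.continuous hχc hζ.deriv 1
  have h2 := integral_halfSpace_weighted_tensor (Lp.stronglyMeasurable (residual h))
    (memLp_H _) hχ.continuous hχc hζ 1
  have h3 := fun i : Fin n => integral_halfSpace_weighted_tensor
    (Lp.stronglyMeasurable (x.graph.snd (some i)))
    (Lp.memLp (x.graph.snd (some i))) (χ := fun y => fderiv ℝ χ y (EuclideanSpace.single i 1))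
    ((hχ.continuous_fderiv (by simp)).clm_apply continuous_const)
    (hχc.fderiv_apply ℝ _) hζ (-(1 / (n : ℝ)))
  simp only [Real.rpow_one] at h1 h2
  rw [integral_smul_sub hχ.continuous hχc, ← h1, ← h2, ← h0]
  simp only [← h3]
  rw [sub_eq_iff_eq_add]
  simp only [fderiv_tensor hχ hζ.1]
  simp [coordDir, horizontalDir, verticalDir, coordExp, mul_comm, mul_left_comm]

end WeakEquation

end

end TaubWave

namespace TaubWave

noncomputable section

/-! ### Frequency bands of the slices -/

section Bands

variable {n : ℕ}

/-- The symbol of the derivative in direction `v`, divided by `i` and cut off to `A`. -/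
def derivSymbol (A : Set (Horizontal n)) (v : Horizontal n) : Horizontal n → ℝ :=
  A.indicator fun ξ => 2 * Real.pi * inner ℝ ξ v

/-- The symbol of `-Δ`, cut off to `A`. -/
def laplaceSymbol (A : Set (Horizontal n)) : Horizontal n → ℝ :=
  A.indicator fun ξ => (2 * Real.pi * ‖ξ‖) ^ 2

variable {A : Set (Horizontal n)} {ρ : ℝ}

theorem isBoundedSymbol_one (hA : MeasurableSet A) :
    IsBoundedSymbol (A.indicator (1 : Horizontal n → ℝ)) :=
  isBoundedSymbol_indicator hA measurable_const zero_le_one fun x _ => by simp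

theorem isBoundedSymbol_derivSymbol (hA : MeasurableSet A) (hρ : ∀ ξ ∈ A, ‖ξ‖ ≤ ρ)
    (v : Horizontal n) : IsBoundedSymbol (derivSymbol A v) := by
  refine isBoundedSymbol_indicator hA (by fun_prop) (C := 2 * Real.pi * (|ρ| * ‖v‖))
    (by positivity) fun ξ hξ => ?_
  rw [abs_mul, abs_of_pos Real.two_pi_pos]
  refine mul_le_mul_of_nonneg_left ((abs_real_inner_le_norm ξ v).trans ?_) Real.two_pi_pos.le
  exact mul_le_mul_of_nonneg_right ((hρ ξ hξ).trans (le_abs_self ρ)) (norm_nonneg _)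

theorem isBoundedSymbol_laplaceSymbol (hA : MeasurableSet A) (hρ : ∀ ξ ∈ A, ‖ξ‖ ≤ ρ) :
    IsBoundedSymbol (laplaceSymbol A) := by
  refine isBoundedSymbol_indicator hA (by fun_prop) (C := (2 * Real.pi * ρ) ^ 2)
    (by positivity) fun ξ hξ => ?_
  rw [abs_of_nonneg (by positivity)]
  have := hρ ξ hξ
  gcongr

open FourierTransform in
/-- The Fourier transform, cut off to `A`. -/
def bandFourier (A : Set (Horizontal n)) : L2Horizontal n →L[ℂ] L2Horizontal n :=
  symbolMul volume (A.indicator 1) ∘L fourierCLM ℂ (L2Horizontal n)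

open FourierTransform

theorem bandFourier_apply (u : L2Horizontal n) :
    bandFourier A u = symbolMul volume (A.indicator 1) (𝓕 u) := rfl

theorem norm_bandFourier_le (hA : MeasurableSet A) (u : L2Horizontal n) :
    ‖bandFourier A u‖ ≤ ‖u‖ := by
  rw [← Lp.norm_fourier_eq u, bandFourier_apply]
  refine Lp.norm_le_norm_of_ae_le ?_
  filter_upwards [coeFn_symbolMul (isBoundedSymbol_one hA) (𝓕 u : L2Horizontal n)] with ξ hξ
  rw [hξ]
  by_cases h : ξ ∈ A <;> simp [h]

theorem derivSymbol_band (hA : MeasurableSet A) (hρ : ∀ ξ ∈ A, ‖ξ‖ ≤ ρ) (v : Horizontal n)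
    (u : L2Horizontal n) :
    symbolMul volume (derivSymbol A v) (bandFourier A u)
      = symbolMul volume (derivSymbol A v) (𝓕 u) := by
  rw [bandFourier_apply, symbolMul_symbolMul (isBoundedSymbol_derivSymbol hA hρ v)
    (isBoundedSymbol_one hA)]
  refine congrArg (fun m => symbolMul volume m (𝓕 u : L2Horizontal n)) (funext fun ξ => ?_)
  by_cases h : ξ ∈ A <;> simp [derivSymbol, h]

theorem laplaceSymbol_band (hA : MeasurableSet A) (hρ : ∀ ξ ∈ A, ‖ξ‖ ≤ ρ)
    (u : L2Horizontal n) :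
    symbolMul volume (laplaceSymbol A) (bandFourier A u)
      = symbolMul volume (laplaceSymbol A) (𝓕 u) := by
  rw [bandFourier_apply, symbolMul_symbolMul (isBoundedSymbol_laplaceSymbol hA hρ)
    (isBoundedSymbol_one hA)]
  refine congrArg (fun m => symbolMul volume m (𝓕 u : L2Horizontal n)) (funext fun ξ => ?_)
  by_cases h : ξ ∈ A <;> simp [laplaceSymbol, h]

theorem sum_derivSymbol_sq (ξ : Horizontal n) :
    ∑ i, derivSymbol A (EuclideanSpace.single i 1) ξ ^ 2 = laplaceSymbol A ξ := by
  by_cases h : ξ ∈ A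
  · simp only [derivSymbol, laplaceSymbol, indicator_of_mem h, mul_pow, ← Finset.mul_sum,
      EuclideanSpace.norm_sq_eq, EuclideanSpace.inner_single_right]
    simp
  · simp [derivSymbol, laplaceSymbol, h]

theorem symbolMul_laplaceSymbol (hA : MeasurableSet A) (hρ : ∀ ξ ∈ A, ‖ξ‖ ≤ ρ)
    (u : L2Horizontal n) : symbolMul volume (laplaceSymbol A) u
      = ∑ i, symbolMul volume (derivSymbol A (EuclideanSpace.single i 1))
        (symbolMul volume (derivSymbol A (EuclideanSpace.single i 1)) u) := by
  have hd := fun i : Fin n => isBoundedSymbol_derivSymbol hA hρ (EuclideanSpace.single i (1 : ℝ))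
  simp only [fun i : Fin n => symbolMul_symbolMul (hd i) (hd i) u]
  refine Lp.ext ?_
  have hs := ae_all_iff.2 fun i : Fin n => coeFn_symbolMul ((hd i).mul (hd i)) u
  filter_upwards [coeFn_symbolMul (isBoundedSymbol_laplaceSymbol hA hρ) u, hs,
    Lp.coeFn_finsetSum Finset.univ fun i : Fin n => symbolMul volume (fun ξ =>
      derivSymbol A (EuclideanSpace.single i 1) ξ * derivSymbol A (EuclideanSpace.single i 1) ξ) u]
    with ξ h1 h2 h3
  rw [h1, h3, Finset.sum_apply, Finset.sum_congr rfl fun i _ => h2 i, ← Finset.sum_mul,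
    ← sum_derivSymbol_sq]
  push_cast
  simp only [sq]

theorem inner_laplaceSymbol (hA : MeasurableSet A) (hρ : ∀ ξ ∈ A, ‖ξ‖ ≤ ρ)
    (u : L2Horizontal n) : (inner ℂ (symbolMul volume (laplaceSymbol A) u) u).re
      = ∑ i, ‖symbolMul volume (derivSymbol A (EuclideanSpace.single i 1)) u‖ ^ 2 := by
  have hd := fun i : Fin n => isBoundedSymbol_derivSymbol hA hρ (EuclideanSpace.single i (1 : ℝ))
  rw [inner_symbolMul (isBoundedSymbol_laplaceSymbol hA hρ),
    Finset.sum_congr rfl fun i _ => norm_sq_symbolMul (hd i) u, ← integral_finsetSum]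
  · refine integral_congr_ae (Eventually.of_forall fun ξ => ?_)
    simp only [← Finset.sum_mul, sum_derivSymbol_sq]
  · intro i _
    simpa only [sq] using integrable_symbol_mul_sq ((hd i).mul (hd i)) u

/-- The Fourier transform, cut off to `A`, of the identity `Q = ∑ i, ∂_{m i} (Y i)`. -/
theorem bandFourier_eq_sum (hA : MeasurableSet A) (hρ : ∀ ξ ∈ A, ‖ξ‖ ≤ ρ) {κ : Type*} [Fintype κ]
    {m : κ → Horizontal n} {Q : L2Horizontal n} {Y : κ → L2Horizontal n}
    (h : ∀ χ : Horizontal n → ℝ, ContDiff ℝ ∞ χ → HasCompactSupport χ →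
      ∫ x, χ x • Q x = -∑ i, ∫ x, fderiv ℝ χ x (m i) • Y i x) :
    bandFourier A Q
      = ∑ i, Complex.I • symbolMul volume (derivSymbol A (m i)) (𝓕 (Y i) : L2Horizontal n) := by
  refine Lp.ext ?_
  have hs := ae_all_iff.2 fun i : κ =>
    coeFn_symbolMul (isBoundedSymbol_derivSymbol hA hρ (m i)) (𝓕 (Y i) : L2Horizontal n)
  have hI := ae_all_iff.2 fun i : κ => Lp.coeFn_smul Complex.I
    (symbolMul volume (derivSymbol A (m i)) (𝓕 (Y i) : L2Horizontal n))
  filter_upwards [coeFn_symbolMul (isBoundedSymbol_one hA) (𝓕 Q : L2Horizontal n), hs, hI,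
    fourier_ae_eq_of_forall_hasCompactSupport h,
    Lp.coeFn_finsetSum Finset.univ fun i : κ => Complex.I •
      symbolMul volume (derivSymbol A (m i)) (𝓕 (Y i) : L2Horizontal n)] with ξ h1 h2 h3 h4 h5
  rw [bandFourier_apply, h1, h5, h4, Finset.sum_apply, Finset.mul_sum]
  refine Finset.sum_congr rfl fun i _ => ?_
  rw [h3, Pi.smul_apply, h2, smul_eq_mul, Complex.real_smul]
  by_cases hξ : ξ ∈ A
  · simp only [derivSymbol, indicator_of_mem hξ]; simp; ring
  · simp [derivSymbol, hξ]

theorem locallyIntegrableOn_clm_comp {X Y : Type*} [NormedAddCommGroup X] [NormedSpace ℂ X]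
    [NormedAddCommGroup Y] [NormedSpace ℂ Y] (L : X →L[ℂ] Y) {f : ℝ → X}
    (hf : LocallyIntegrableOn f (Ioi 0)) : LocallyIntegrableOn (fun z => L (f z)) (Ioi 0) := by
  rw [locallyIntegrableOn_iff isOpen_Ioi.isLocallyClosed] at hf ⊢
  exact fun k hk hkc => L.integrable_comp (hf k hk hkc)

theorem integral_smul_clm_comp (L : L2Horizontal n →L[ℂ] L2Horizontal n) {ζ : ℝ → ℝ}
    (hζ : IsVerticalTest ζ) {f : ℝ → L2Horizontal n} (hf : LocallyIntegrableOn f (Ioi 0)) :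
    ∫ z, ζ z • L (f z) = L (∫ z, ζ z • f z) := by
  rw [← ContinuousLinearMap.integral_comp_comm _ (hζ.integrable_smul hf)]
  refine integral_congr_ae (Eventually.of_forall fun z => ?_)
  exact ((L.restrictScalars ℝ).map_smul (ζ z) (f z)).symm

/-- The horizontal derivatives of the slices, on the Fourier side. -/
theorem bandFourier_slice_horizontal (hA : MeasurableSet A) (hρ : ∀ ξ ∈ A, ‖ξ‖ ≤ ρ)
    (x : EnergyDomain n) (i : Fin n) :
    ∀ᵐ z : ℝ, z ∈ Ioi 0 → bandFourier A (slice n (x.graph.snd (some i)) z)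
      = Complex.I • symbolMul volume (derivSymbol A (EuclideanSpace.single i 1))
        (𝓕 (slice n x.graph.fst z) : L2Horizontal n) := by
  let D : L2Horizontal n →L[ℂ] L2Horizontal n :=
    Complex.I • (symbolMul volume (derivSymbol A (EuclideanSpace.single i 1)) ∘L
      fourierCLM ℂ (L2Horizontal n))
  have hv := locallyIntegrableOn_slice (Lp.stronglyMeasurable (x.graph.snd (some i)))
    (Lp.memLp (x.graph.snd (some i)))
  have hu := locallyIntegrableOn_slice (Lp.stronglyMeasurable x.graph.fst) (memLp_H x.graph.fst)
  have h1 := locallyIntegrableOn_clm_comp (bandFourier A) hv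
  have h2 := locallyIntegrableOn_clm_comp D hu
  -- The relation is only available after integration in `z` against test functions; the fundamental
  -- lemma of the calculus of variations localizes it to almost every `z`.
  have h := isOpen_Ioi.ae_eq_zero_of_integral_contDiff_smul_eq_zero (μ := volume) (h1.sub h2)
    fun ζ hζ hζc hζs => ?_
  · filter_upwards [h] with z hz hz0
    exact sub_eq_zero.1 (hz hz0)
  · have ht : IsVerticalTest ζ := ⟨hζ, hζc, hζs⟩
    simp only [Pi.sub_apply, smul_sub]
    rw [integral_sub (ht.integrable_smul h1) (ht.integrable_smul h2),
      integral_smul_clm_comp _ ht hv, integral_smul_clm_comp _ ht hu, sub_eq_zero]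
    have := bandFourier_eq_sum hA hρ (κ := Unit)
      (m := fun _ => EuclideanSpace.single i (1 : ℝ))
      (Q := ∫ z, ζ z • slice n (x.graph.snd (some i)) z)
      (Y := fun _ => ∫ z, ζ z • slice n x.graph.fst z)
      (fun χ hχ hχc => by simpa using slice_horizontal x i ht hχ hχc)
    rw [this, Finset.univ_unique, Finset.sum_singleton]
    rfl

/-- The equation `A φ = h - φ` for the slices, on the Fourier side. -/
theorem bandFourier_slice_equation (hA : MeasurableSet A) (hρ : ∀ ξ ∈ A, ‖ξ‖ ≤ ρ) (h : H n)
    {ζ : ℝ → ℝ} (hζ : IsVerticalTest ζ) :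
    ∫ z, (z * deriv ζ z) • bandFourier A (slice n ((energyAdjoint n h).graph.snd none) z)
      = (∫ z, (z * ζ z) • bandFourier A (slice n (residual h) z))
        - ∫ z, (z ^ (-(1 / (n : ℝ))) * ζ z) • symbolMul volume (laplaceSymbol A)
          (bandFourier A (slice n (energyAdjoint n h).graph.fst z)) := by
  have h0 := bandFourier_eq_sum hA hρ (κ := Fin n) (m := fun i => EuclideanSpace.single i (1 : ℝ))
    (fun χ hχ hχc => slice_equation h hζ hχ hχc)
  set x := energyAdjoint n h with hx
  have hνt := hζ.mul_rpow (-(1 / (n : ℝ)))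
  have h1t : IsVerticalTest fun z => z * ζ z := by simpa using hζ.mul_rpow 1
  have h1t' : IsVerticalTest fun z => z * deriv ζ z := by simpa using hζ.deriv.mul_rpow 1
  have hv := locallyIntegrableOn_slice (Lp.stronglyMeasurable (x.graph.snd none))
    (Lp.memLp (x.graph.snd none))
  have hu := locallyIntegrableOn_slice (Lp.stronglyMeasurable x.graph.fst) (memLp_H x.graph.fst)
  have hr := locallyIntegrableOn_slice (Lp.stronglyMeasurable (residual h)) (memLp_H (residual h))
  -- The horizontal derivative of the slice contributes one factor `i` times the derivative symbol,
  -- and the divergence in the equation another. The product `i²` gives minus the sum of squares,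
  -- which is minus the symbol of `-Δ`.
  have hY : ∀ i : Fin n, symbolMul volume (derivSymbol A (EuclideanSpace.single i 1))
      (𝓕 (∫ z, (z ^ (-(1 / (n : ℝ))) * ζ z) • slice n (x.graph.snd (some i)) z :
        L2Horizontal n) : L2Horizontal n)
      = Complex.I • symbolMul volume (derivSymbol A (EuclideanSpace.single i 1))
        (symbolMul volume (derivSymbol A (EuclideanSpace.single i 1))
          (𝓕 (∫ z, (z ^ (-(1 / (n : ℝ))) * ζ z) • slice n x.graph.fst z :
            L2Horizontal n) : L2Horizontal n)) := fun i => by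
    have := bandFourier_eq_sum hA hρ (κ := Unit)
      (m := fun _ => EuclideanSpace.single i (1 : ℝ))
      (Q := ∫ z, (z ^ (-(1 / (n : ℝ))) * ζ z) • slice n (x.graph.snd (some i)) z)
      (Y := fun _ => ∫ z, (z ^ (-(1 / (n : ℝ))) * ζ z) • slice n x.graph.fst z)
      (fun χ hχ hχc => by simpa using slice_horizontal x i hνt hχ hχc)
    rw [Finset.univ_unique, Finset.sum_singleton] at this
    rw [← derivSymbol_band hA hρ, this, map_smul]
  simp only [hY, smul_smul, Complex.I_mul_I, neg_smul, one_smul, Finset.sum_neg_distrib] at h0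
  rw [← symbolMul_laplaceSymbol hA hρ, ← laplaceSymbol_band hA hρ, map_sub,
    ← integral_smul_clm_comp _ h1t' hv, ← integral_smul_clm_comp _ h1t hr,
    ← integral_smul_clm_comp _ hνt hu,
    ← integral_smul_clm_comp _ hνt (locallyIntegrableOn_clm_comp (bandFourier A) hu)] at h0
  rw [sub_eq_iff_eq_add.1 h0]
  abel

end Bands

end

end TaubWave

namespace TaubWave

noncomputable section

/-! ### The vertical system satisfied by a band -/

section BandSystem

variable {n : ℕ}

theorem integral_slice_sq {s : ℝ} (f : Lp ℂ 2 (powMeasure n s)) :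
    IntegrableOn (fun z => z ^ s * ‖slice n f z‖ ^ 2) (Ioi 0) ∧
      ∫ z in Ioi 0, z ^ s * ‖slice n f z‖ ^ 2 = ‖f‖ ^ 2 := by
  obtain ⟨h1, h2⟩ := integrableOn_slice_sq (Lp.stronglyMeasurable f) (Lp.memLp f)
  refine ⟨h1, ?_⟩
  rw [h2, ← enorm_Lp_sq, ENNReal.toReal_pow, toReal_enorm]

theorem integral_slice_sq_H (f : H n) :
    IntegrableOn (fun z => z * ‖slice n f z‖ ^ 2) (Ioi 0) ∧
      ∫ z in Ioi 0, z * ‖slice n f z‖ ^ 2 = ‖f‖ ^ 2 := by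
  obtain ⟨h1, h2⟩ := integrableOn_slice_sq (Lp.stronglyMeasurable f) (memLp_H f)
  simp only [Real.rpow_one] at h1 h2
  refine ⟨h1, ?_⟩
  rw [h2, ← weightedMeasure_eq, ← enorm_Lp_sq, ENNReal.toReal_pow, toReal_enorm]

/-- The continuous version of the slices of an element of the energy space. -/
theorem exists_sliceTrace (x : EnergyDomain n) :
    ∃ u : ℝ → L2Horizontal n, IsSliceTrace n x.graph.fst u ∧
      (∀ a b, 0 < a → 0 < b → u b - u a = ∫ z in a..b, slice n (x.graph.snd none) z) ∧
      ∀ᵐ z : ℝ, z ∈ Ioi 0 → slice n x.graph.fst z = u z := by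
  obtain ⟨u, hu, huc, hua⟩ := exists_primitive_of_weakDeriv
    (locallyIntegrableOn_slice (Lp.stronglyMeasurable x.graph.fst) (memLp_H x.graph.fst))
    (locallyIntegrableOn_slice (Lp.stronglyMeasurable (x.graph.snd none))
      (Lp.memLp (x.graph.snd none))) fun ζ hζ => slice_weakDeriv x hζ
  refine ⟨u, ⟨huc, ?_⟩, hu, hua⟩
  rw [← ae_restrict_iff' measurableSet_Ioi] at hua
  filter_upwards [hua, ae_memLp_section (Lp.stronglyMeasurable x.graph.fst)
    (memLp_H x.graph.fst)] with z hz hm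
  rw [← hz]
  exact (coeFn_slice hm).symm

variable {A : Set (Horizontal n)} {ρ : ℝ}

/-- The symbol is at most `(2πρ)²` on the band, so its square is at most that constant times itself.
This is the hypothesis `hK` of the vertical system. -/
theorem laplaceSymbol_bound (hA : MeasurableSet A) (hρ : ∀ ξ ∈ A, ‖ξ‖ ≤ ρ)
    (w : L2Horizontal n) : ‖symbolMul volume (laplaceSymbol A) w‖ ^ 2
      ≤ (2 * Real.pi * ρ) ^ 2 * (inner ℂ (symbolMul volume (laplaceSymbol A) w) w).re := by
  refine norm_sq_symbolMul_le (isBoundedSymbol_laplaceSymbol hA hρ)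
    (isBoundedSymbol_laplaceSymbol hA hρ) (fun ξ => ?_) w
  by_cases h : ξ ∈ A
  · simp only [laplaceSymbol, indicator_of_mem h]
    rw [sq ((2 * Real.pi * ‖ξ‖) ^ 2)]
    have := hρ ξ h
    gcongr
  · simp [laplaceSymbol, h]

theorem inner_laplaceSymbol_bandFourier (hA : MeasurableSet A) (hρ : ∀ ξ ∈ A, ‖ξ‖ ≤ ρ)
    (w : L2Horizontal n) :
    (inner ℂ (symbolMul volume (laplaceSymbol A) (bandFourier A w)) (bandFourier A w)).re
      = ∑ i, ‖symbolMul volume (derivSymbol A (EuclideanSpace.single i 1))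
          (FourierTransform.fourier w : L2Horizontal n)‖ ^ 2 := by
  rw [inner_laplaceSymbol hA hρ]
  simp only [derivSymbol_band hA hρ]

/-- The horizontal energy of a band. -/
theorem ae_inner_laplaceSymbol_slice (hA : MeasurableSet A) (hρ : ∀ ξ ∈ A, ‖ξ‖ ≤ ρ)
    (x : EnergyDomain n) : ∀ᵐ z : ℝ, z ∈ Ioi 0 →
      (inner ℂ (symbolMul volume (laplaceSymbol A) (bandFourier A (slice n x.graph.fst z)))
        (bandFourier A (slice n x.graph.fst z))).re
      = ∑ i, ‖bandFourier A (slice n (x.graph.snd (some i)) z)‖ ^ 2 := by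
  filter_upwards [ae_all_iff.2 fun i => bandFourier_slice_horizontal hA hρ x i] with z hz hz0
  rw [inner_laplaceSymbol_bandFourier hA hρ]
  refine Finset.sum_congr rfl fun i _ => ?_
  rw [hz i hz0, norm_smul, Complex.norm_I, one_mul]

theorem integrableOn_weight_bandFourier (hA : MeasurableSet A) {s : ℝ} {f : ℝ → L2Horizontal n}
    (hf : AEStronglyMeasurable f (volume.restrict (Ioi 0)))
    (h : IntegrableOn (fun z => z ^ s * ‖f z‖ ^ 2) (Ioi 0)) :
    IntegrableOn (fun z => z ^ s * ‖bandFourier A (f z)‖ ^ 2) (Ioi 0) ∧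
      ∫ z in Ioi 0, z ^ s * ‖bandFourier A (f z)‖ ^ 2 ≤ ∫ z in Ioi 0, z ^ s * ‖f z‖ ^ 2 := by
  have hle : ∀ z ∈ Ioi (0 : ℝ), z ^ s * ‖bandFourier A (f z)‖ ^ 2 ≤ z ^ s * ‖f z‖ ^ 2 := by
    intro z hz
    have hz' : (0 : ℝ) < z := hz
    have := norm_bandFourier_le hA (f z)
    gcongr
  have hi : IntegrableOn (fun z => z ^ s * ‖bandFourier A (f z)‖ ^ 2) (Ioi 0) := by
    refine Integrable.mono' h ((measurable_id.pow_const s).aestronglyMeasurable.mul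
      (((bandFourier A).continuous.comp_aestronglyMeasurable hf).norm.pow 2)) ?_
    filter_upwards [ae_restrict_mem measurableSet_Ioi] with z hz
    have hz' : (0 : ℝ) < z := hz
    rw [Real.norm_of_nonneg (by positivity)]
    exact hle z hz
  exact ⟨hi, setIntegral_mono_on hi h measurableSet_Ioi hle⟩

/-- The vertical profile of a frequency band of a solution of `A φ = h - φ`. -/
theorem exists_radialSystem_band (hA : MeasurableSet A) (hρ : ∀ ξ ∈ A, ‖ξ‖ ≤ ρ) (h : H n)
    {u : ℝ → L2Horizontal n} (huc : ContinuousOn u (Ioi 0))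
    (hu : ∀ a b, 0 < a → 0 < b →
      u b - u a = ∫ z in a..b, slice n ((energyAdjoint n h).graph.snd none) z)
    (hua : ∀ᵐ z : ℝ, z ∈ Ioi 0 → slice n (energyAdjoint n h).graph.fst z = u z) :
    (∃ Q, RadialSystem (1 / (n : ℝ)) (symbolMul volume (laplaceSymbol A))
      (fun z => bandFourier A (u z)) Q (fun z => bandFourier A (slice n (residual h) z))) ∧
    (∫ z in Ioi 0, z * ‖bandFourier A (u z)‖ ^ 2 ≤ ‖(energyAdjoint n h).graph.fst‖ ^ 2) ∧
    (∫ z in Ioi 0, z ^ (-(1 / (n : ℝ))) * (inner ℂ (symbolMul volume (laplaceSymbol A)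
      (bandFourier A (u z))) (bandFourier A (u z))).re
        ≤ ∑ i : Fin n, ‖(energyAdjoint n h).graph.snd (some i)‖ ^ 2) ∧
    (∫ z in Ioi 0, z * ‖bandFourier A (slice n (residual h) z)‖ ^ 2 ≤ ‖residual h‖ ^ 2) := by
  set x := energyAdjoint n h with hx
  set K := symbolMul volume (laplaceSymbol A) with hK
  set B := bandFourier A with hB
  have hua' := (ae_restrict_iff' measurableSet_Ioi).2 hua
  have hv := locallyIntegrableOn_slice (Lp.stronglyMeasurable (x.graph.snd none))
    (Lp.memLp (x.graph.snd none))
  have hφ := locallyIntegrableOn_slice (Lp.stronglyMeasurable x.graph.fst) (memLp_H x.graph.fst)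
  have hr := locallyIntegrableOn_slice (Lp.stronglyMeasurable (residual h)) (memLp_H (residual h))
  have hul : LocallyIntegrableOn u (Ioi 0) := huc.locallyIntegrableOn measurableSet_Ioi
  have hmeas : ∀ f : Ambient n → ℂ, StronglyMeasurable f →
      AEStronglyMeasurable (slice n f) (volume.restrict (Ioi 0)) := fun f hf =>
    (stronglyMeasurable_slice hf).aestronglyMeasurable
  have hmass := integrableOn_weight_bandFourier hA (s := 1)
    (hmeas _ (Lp.stronglyMeasurable x.graph.fst))
    (by simpa using (integral_slice_sq_H x.graph.fst).1)
  have hsource := integrableOn_weight_bandFourier hA (s := 1)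
    (hmeas _ (Lp.stronglyMeasurable (residual h)))
    (by simpa using (integral_slice_sq_H (residual h)).1)
  have hvert := integrableOn_weight_bandFourier hA (s := 1)
    (hmeas _ (Lp.stronglyMeasurable (x.graph.snd none))) (integral_slice_sq (x.graph.snd none)).1
  have hhor := fun i : Fin n => integrableOn_weight_bandFourier hA (s := -(1 / (n : ℝ)))
    (hmeas _ (Lp.stronglyMeasurable (x.graph.snd (some i))))
    (integral_slice_sq (x.graph.snd (some i))).1
  simp only [Real.rpow_one] at hmass hsource hvert
  have hmass_eq : (fun z => z * ‖B (slice n x.graph.fst z)‖ ^ 2)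
      =ᵐ[volume.restrict (Ioi 0)] fun z => z * ‖B (u z)‖ ^ 2 := by
    filter_upwards [hua'] with z hz
    rw [hz]
  have hhor_eq : (fun z => ∑ i : Fin n, z ^ (-(1 / (n : ℝ))) *
        ‖B (slice n (x.graph.snd (some i)) z)‖ ^ 2)
      =ᵐ[volume.restrict (Ioi 0)] fun z => z ^ (-(1 / (n : ℝ))) *
        (inner ℂ (K (B (u z))) (B (u z))).re := by
    filter_upwards [hua', (ae_restrict_iff' measurableSet_Ioi).2
      (ae_inner_laplaceSymbol_slice hA hρ x)] with z hz h1
    rw [← hz, h1, Finset.mul_sum]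
  have hhorI : IntegrableOn (fun z => ∑ i : Fin n, z ^ (-(1 / (n : ℝ))) *
      ‖B (slice n (x.graph.snd (some i)) z)‖ ^ 2) (Ioi 0) :=
    integrable_finsetSum _ fun i _ => (hhor i).1
  refine ⟨?_, ?_, ?_, ?_⟩
  · have hp : LocallyIntegrableOn (fun z => z ^ (-(1 / (n : ℝ))) • K (B (u z))
        - z • B (slice n (residual h) z)) (Ioi 0) := by
      refine LocallyIntegrableOn.sub ?_ ?_
      · exact (locallyIntegrableOn_clm_comp (K ∘L B) hul).continuousOn_smul
          isOpen_Ioi.isLocallyClosed (RadialSystem.continuousOn_rpow _)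
      · exact (locallyIntegrableOn_clm_comp B hr).continuousOn_smul
          isOpen_Ioi.isLocallyClosed continuousOn_id
    have hf : LocallyIntegrableOn (fun z => z • B (slice n (x.graph.snd none) z)) (Ioi 0) :=
      (locallyIntegrableOn_clm_comp B hv).continuousOn_smul isOpen_Ioi.isLocallyClosed
        continuousOn_id
    -- The flux `Q` is the continuous version of `z ∂_z` of the band; the slice equation identifies
    -- its weak derivative.
    obtain ⟨Q, hQ, hQc, hQa⟩ := exists_primitive_of_weakDeriv hf hp fun ζ hζ => by
      have h1t : IsVerticalTest fun z => z * ζ z := by simpa using hζ.mul_rpow 1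
      have hνt := hζ.mul_rpow (-(1 / (n : ℝ)))
      have e := bandFourier_slice_equation hA hρ h hζ
      have e1 : ∫ z, deriv ζ z • z • B (slice n (x.graph.snd none) z)
          = ∫ z, (z * deriv ζ z) • B (slice n (x.graph.snd none) z) := by
        refine integral_congr_ae (Eventually.of_forall fun z => ?_)
        simp only [smul_smul, mul_comm]
      have e2 : ∫ z, (z ^ (-(1 / (n : ℝ))) * ζ z) • K (B (slice n x.graph.fst z))
          = ∫ z, (z ^ (-(1 / (n : ℝ))) * ζ z) • K (B (u z)) := by
        refine integral_congr_ae ?_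
        filter_upwards [hua] with z hz
        by_cases hz0 : z ∈ Ioi (0 : ℝ)
        · rw [hz hz0]
        · rw [image_eq_zero_of_notMem_tsupport fun hs => hz0 (hζ.2.2 hs)]; simp
      have e3 : ∫ z, ζ z • (z ^ (-(1 / (n : ℝ))) • K (B (u z)) - z • B (slice n (residual h) z))
          = (∫ z, (z ^ (-(1 / (n : ℝ))) * ζ z) • K (B (u z)))
            - ∫ z, (z * ζ z) • B (slice n (residual h) z) := by
        have hKB : LocallyIntegrableOn (fun z => K (B (u z))) (Ioi 0) :=
          locallyIntegrableOn_clm_comp (K ∘L B) hul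
        rw [← integral_sub (hνt.integrable_smul hKB)
          (h1t.integrable_smul (locallyIntegrableOn_clm_comp B hr))]
        refine integral_congr_ae (Eventually.of_forall fun z => ?_)
        simp only [smul_sub, smul_smul, mul_comm]
      rw [e1, e3, ← e2, neg_sub]
      exact e
    have hQa' := (ae_restrict_iff' measurableSet_Ioi).2 hQa
    refine ⟨Q, ?_, fun a b ha hab => hQ a b ha (ha.trans_le hab),
      B.continuous.comp_aestronglyMeasurable (hmeas _ (Lp.stronglyMeasurable (residual h))),
      ?_, hhorI.congr hhor_eq, hmass.1.congr hmass_eq, hsource.1⟩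
    · intro z hz
      have hqc : ContinuousOn (fun t => t⁻¹ • Q t) (Ioi 0) :=
        (continuousOn_id.inv₀ fun t ht => ne_of_gt ht).smul hQc
      -- Since `s⁻¹ Q` is continuous, the band is a primitive of a continuous function and
      -- differentiable at every point, not only almost everywhere.
      have hVeq : ∀ᶠ t in 𝓝 z, B (u t) = B (u z) + ∫ s in z..t, s⁻¹ • Q s := by
        filter_upwards [Ioi_mem_nhds hz] with t ht
        have hi := intervalIntegrable_of_locallyIntegrableOn_Ioi hv hz ht
        have h1 : B (u t) - B (u z) = ∫ s in z..t, B (slice n (x.graph.snd none) s) := by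
          rw [← map_sub, hu z t hz ht, ← ContinuousLinearMap.intervalIntegral_comp_comm _ hi]
        rw [← sub_eq_iff_eq_add', h1]
        refine intervalIntegral.integral_congr_ae ?_
        filter_upwards [hQa] with s hs hst
        have hs0 : 0 < s := (lt_min hz ht).trans hst.1
        rw [← hs hs0, smul_smul, inv_mul_cancel₀ hs0.ne', one_smul]
      have hd : HasDerivAt (fun t => B (u z) + ∫ s in z..t, s⁻¹ • Q s) (z⁻¹ • Q z) z := by
        refine (intervalIntegral.integral_hasDerivAt_right (by simp) ?_ ?_).const_add _
        · exact hqc.stronglyMeasurableAtFilter isOpen_Ioi z hz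
        · exact hqc.continuousAt (Ioi_mem_nhds hz)
      exact hd.congr_of_eventuallyEq hVeq
    · refine hvert.1.congr ?_
      filter_upwards [hQa', ae_restrict_mem measurableSet_Ioi] with z hz hz0
      have hz' : (0 : ℝ) < z := hz0
      rw [← hz, norm_smul, Real.norm_of_nonneg hz'.le, mul_pow, ← mul_assoc]
      congr 1
      field_simp
  · rw [← integral_congr_ae hmass_eq, ← (integral_slice_sq_H x.graph.fst).2]
    exact hmass.2
  · rw [← integral_congr_ae hhor_eq, integral_finsetSum _ fun i _ => (hhor i).1]
    exact Finset.sum_le_sum fun i _ => (hhor i).2.trans_eq (integral_slice_sq _).2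
  · rw [← (integral_slice_sq_H (residual h)).2]
    exact hsource.2

end BandSystem

end

end TaubWave

namespace TaubWave

noncomputable section

/-! ### Dyadic annuli and their penetration depth -/

section Dyadic

variable {n : ℕ}

/-- The dyadic annulus `2 ^ j ≤ |ξ| < 2 ^ (j + 1)`. -/
def annulus (n j : ℕ) : Set (Horizontal n) := {ξ | 2 ^ j ≤ ‖ξ‖ ∧ ‖ξ‖ < 2 ^ (j + 1)}

/-- The dyadic ball `|ξ| < 2 ^ j`. -/
def dyadicBall (n j : ℕ) : Set (Horizontal n) := {ξ | ‖ξ‖ < 2 ^ j}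

theorem measurableSet_annulus (j : ℕ) : MeasurableSet (annulus n j) :=
  (measurableSet_le measurable_const measurable_norm).inter
    (measurableSet_lt measurable_norm measurable_const)

theorem measurableSet_dyadicBall (j : ℕ) : MeasurableSet (dyadicBall n j) :=
  measurableSet_lt measurable_norm measurable_const

theorem pairwise_disjoint_annulus : Pairwise (Function.onFun Disjoint (annulus n)) := by
  have key : ∀ i j, i < j → Disjoint (annulus n i) (annulus n j) := fun i j hij => by
    refine disjoint_left.2 fun ξ hi hj => ?_
    have h1 : (2 : ℝ) ^ (i + 1) ≤ 2 ^ j := pow_le_pow_right₀ one_le_two hij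
    exact absurd (hi.2.trans_le (h1.trans hj.1)) (lt_irrefl _)
  intro i j hij
  rcases lt_or_gt_of_ne hij with h | h
  · exact key i j h
  · exact (key j i h).symm

theorem compl_dyadicBall_subset (J : ℕ) :
    (dyadicBall n J)ᶜ ⊆ ⋃ j, annulus n (J + j) := by
  intro ξ hξ
  have hξ' : (2 : ℝ) ^ J ≤ ‖ξ‖ := not_lt.1 hξ
  have h1 : (1 : ℝ) ≤ ‖ξ‖ := (one_le_pow₀ one_le_two).trans hξ'
  obtain ⟨k, hk1, hk2⟩ := exists_nat_pow_near h1 one_lt_two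
  have hJk : J ≤ k := by
    by_contra hlt
    have : (2 : ℝ) ^ (k + 1) ≤ 2 ^ J := pow_le_pow_right₀ one_le_two (by omega)
    linarith
  refine mem_iUnion.2 ⟨k - J, ?_⟩
  rw [Nat.add_sub_cancel' hJk]
  exact ⟨hk1, hk2⟩

open FourierTransform in
theorem enorm_bandFourier_sq {A : Set (Horizontal n)} (hA : MeasurableSet A) (w : L2Horizontal n) :
    ‖bandFourier A w‖ₑ ^ 2 = ∫⁻ ξ in A, ‖(𝓕 w : L2Horizontal n) ξ‖ₑ ^ 2 := by
  rw [bandFourier_apply, enorm_sq_symbolMul_indicator hA]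

open FourierTransform in
theorem lintegral_fourier_sq (w : L2Horizontal n) :
    ∫⁻ ξ, ‖(𝓕 w : L2Horizontal n) ξ‖ₑ ^ 2 = ‖w‖ₑ ^ 2 := by
  rw [← enorm_Lp_sq, ← ofReal_norm, Lp.norm_fourier_eq, ofReal_norm]

/-- The annuli are disjoint in frequency, so by Plancherel their contributions add up to at most the
whole. -/
theorem tsum_enorm_bandFourier_sq_le (w : L2Horizontal n) :
    ∑' j, ‖bandFourier (annulus n j) w‖ₑ ^ 2 ≤ ‖w‖ₑ ^ 2 := by
  simp only [enorm_bandFourier_sq (measurableSet_annulus _)]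
  rw [← lintegral_iUnion measurableSet_annulus pairwise_disjoint_annulus, ← lintegral_fourier_sq]
  exact setLIntegral_le_lintegral _ _

/-- The part of the squared norm of `f` that belongs to a dyadic annulus. -/
def bandMass (f : ℝ → L2Horizontal n) (j : ℕ) : ENNReal :=
  ∫⁻ z in Ioi 0, ENNReal.ofReal z * ‖bandFourier (annulus n j) (f z)‖ₑ ^ 2

theorem tsum_bandMass_le (F : H n) : ∑' j, bandMass (slice n F) j ≤ ‖F‖ₑ ^ 2 := by
  have hm : StronglyMeasurable (slice n F) := stronglyMeasurable_slice (Lp.stronglyMeasurable F)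
  have hF : ∫⁻ z in Ioi 0, ENNReal.ofReal z * ‖slice n F z‖ₑ ^ 2 = ‖F‖ₑ ^ 2 := by
    have := lintegral_slice_sq (Lp.stronglyMeasurable F) (memLp_H F)
    simp only [Real.rpow_one] at this
    rw [this, ← weightedMeasure_eq, ← enorm_Lp_sq]
  unfold bandMass
  rw [← lintegral_tsum fun j => ?_, ← hF]
  · refine lintegral_mono fun z => ?_
    simp only
    rw [ENNReal.tsum_mul_left]
    gcongr
    exact tsum_enorm_bandFourier_sq_le _
  · have h1 : StronglyMeasurable fun z => bandFourier (annulus n j) (slice n F z) :=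
      (bandFourier (annulus n j)).continuous.comp_stronglyMeasurable hm
    exact (ENNReal.measurable_ofReal.mul (h1.enorm.pow_const 2)).aemeasurable

theorem ofReal_integral_band (F : H n) (j : ℕ) :
    ENNReal.ofReal (∫ z in Ioi 0, z * ‖bandFourier (annulus n j) (slice n F z)‖ ^ 2)
      = bandMass (slice n F) j := by
  have hm : StronglyMeasurable (slice n F) := stronglyMeasurable_slice (Lp.stronglyMeasurable F)
  have hi := (integrableOn_weight_bandFourier (measurableSet_annulus j) (s := 1)
    hm.aestronglyMeasurable (by simpa using (integral_slice_sq_H F).1)).1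
  simp only [Real.rpow_one] at hi
  rw [ofReal_integral_eq_lintegral_ofReal hi, bandMass]
  · refine setLIntegral_congr_fun measurableSet_Ioi fun z hz => ?_
    have hz' : (0 : ℝ) < z := hz
    rw [ENNReal.ofReal_mul hz'.le, ENNReal.ofReal_pow (norm_nonneg _), ofReal_norm]
  · filter_upwards [ae_restrict_mem measurableSet_Ioi] with z hz
    have hz' : (0 : ℝ) < z := hz
    positivity

/-- The Sobolev exponent of the boundary trace. -/
def traceExp (n : ℕ) : ℝ := 2 * (n : ℝ) / ((n : ℝ) - 1)

/-- The depth to which a dyadic band of frequencies penetrates. -/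
def bandDepth (n j : ℕ) : ℝ := (Real.pi * 2 ^ j) ^ (-traceExp n)

theorem bandDepth_pos (j : ℕ) : 0 < bandDepth n j := by unfold bandDepth; positivity

theorem traceExp_pos (hn : 2 ≤ n) : 0 < traceExp n := by
  have : (2 : ℝ) ≤ n := by exact_mod_cast hn
  unfold traceExp
  have : (0 : ℝ) < n - 1 := by linarith
  positivity

/-- This relation dictates the depth: `ℓ` is chosen so that the coercivity constant `4 ℓ ^ (ν - 1)`
with `ν = 1 / n` equals the lower bound of `(2π|ξ|)²` on the annulus. It works because `traceExp n *
(1 - 1 / n) = 2`. -/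
theorem bandDepth_rpow (hn : 2 ≤ n) (j : ℕ) :
    4 * bandDepth n j ^ (1 / (n : ℝ) - 1) = (2 * Real.pi * 2 ^ j) ^ 2 := by
  have hn' : (2 : ℝ) ≤ n := by exact_mod_cast hn
  have h1 : (n : ℝ) - 1 ≠ 0 := by linarith
  rw [bandDepth, ← Real.rpow_mul (by positivity)]
  have : -traceExp n * (1 / (n : ℝ) - 1) = 2 := by
    unfold traceExp
    field_simp
    ring
  rw [this, Real.rpow_two]
  ring

theorem bandDepth_le (hn : 2 ≤ n) (j : ℕ) : bandDepth n j ≤ ((2 : ℝ) ^ j) ^ (-traceExp n) := by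
  have := traceExp_pos hn
  unfold bandDepth
  refine Real.rpow_le_rpow_of_nonpos (by positivity) ?_ (by linarith)
  have : (1 : ℝ) ≤ Real.pi := by linarith [Real.pi_gt_three]
  nlinarith [pow_pos (two_pos : (0 : ℝ) < 2) j]

theorem bandDepth_antitone (hn : 2 ≤ n) {i j : ℕ} (hij : i ≤ j) :
    bandDepth n j ≤ bandDepth n i := by
  have := traceExp_pos hn
  unfold bandDepth
  refine Real.rpow_le_rpow_of_nonpos (by positivity) ?_ (by linarith)
  have : (2 : ℝ) ^ i ≤ 2 ^ j := pow_le_pow_right₀ one_le_two hij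
  gcongr

theorem tendsto_bandDepth (hn : 2 ≤ n) : Tendsto (bandDepth n) atTop (𝓝 0) := by
  have h1 : Tendsto (fun j : ℕ => Real.pi * (2 : ℝ) ^ j) atTop atTop :=
    (tendsto_pow_atTop_atTop_of_one_lt one_lt_two).const_mul_atTop Real.pi_pos
  exact (tendsto_rpow_neg_atTop (traceExp_pos hn)).comp h1

/-- On the annulus the symbol `(2π|ξ|)²` is at least `(2π 2^j)²`. -/
theorem coercive_annulus (j : ℕ) (w : L2Horizontal n) :
    (2 * Real.pi * 2 ^ j) ^ 2 * ‖bandFourier (annulus n j) w‖ ^ 2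
      ≤ (inner ℂ (symbolMul volume (laplaceSymbol (annulus n j)) (bandFourier (annulus n j) w))
        (bandFourier (annulus n j) w)).re := by
  have hA := measurableSet_annulus (n := n) j
  have hρ : ∀ ξ ∈ annulus n j, ‖ξ‖ ≤ 2 ^ (j + 1) := fun ξ hξ => hξ.2.le
  have h := norm_sq_symbolMul_le (isBoundedSymbol_one hA) (isBoundedSymbol_laplaceSymbol hA hρ)
    (R := ((2 * Real.pi * 2 ^ j) ^ 2)⁻¹) (fun ξ => ?_) (bandFourier (annulus n j) w)
  · have hproj : symbolMul volume ((annulus n j).indicator 1) (bandFourier (annulus n j) w)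
        = bandFourier (annulus n j) w := by
      rw [bandFourier_apply, symbolMul_symbolMul (isBoundedSymbol_one hA) (isBoundedSymbol_one hA)]
      refine congrArg (fun m => symbolMul volume m _) (funext fun ξ => ?_)
      by_cases hξ : ξ ∈ annulus n j <;> simp [hξ]
    rw [hproj] at h
    rwa [inv_mul_eq_div, le_div_iff₀' (by positivity)] at h
  · by_cases hξ : ξ ∈ annulus n j
    · rw [indicator_of_mem hξ, laplaceSymbol, indicator_of_mem hξ, Pi.one_apply, one_pow,
        inv_mul_eq_div, one_le_div (by positivity)]
      have := hξ.1
      gcongr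
    · simp [laplaceSymbol, hξ]

end Dyadic

end

end TaubWave

namespace TaubWave

noncomputable section

/-! ### Existence and size of the boundary trace -/

section BoundaryTrace

variable {n : ℕ}

theorem norm_energyAdjoint_le (h : H n) : ‖energyAdjoint n h‖ ≤ ‖h‖ := by
  have h1 : ‖energyAdjoint n‖ ≤ 1 := by
    rw [energyAdjoint, ContinuousLinearMap.adjoint.norm_map]; exact norm_energyEmbed_le
  exact (ContinuousLinearMap.le_of_opNorm_le _ h1 h).trans_eq (one_mul _)

theorem norm_residual_le (h : H n) : ‖residual h‖ ≤ 2 * ‖h‖ := by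
  have h1 := (energyAdjoint n h).norm_fst_le.trans (norm_energyAdjoint_le h)
  have h2 := norm_sub_le h (energyAdjoint n h).graph.fst
  rw [residual]
  linarith

/-- The estimate of a dyadic band near the boundary. -/
theorem enorm_band_sq_le (hn : 2 ≤ n) (h : H n)
    {u : ℝ → L2Horizontal n} (huc : ContinuousOn u (Ioi 0))
    (hu : ∀ a b, 0 < a → 0 < b →
      u b - u a = ∫ z in a..b, slice n ((energyAdjoint n h).graph.snd none) z)
    (hua : ∀ᵐ z : ℝ, z ∈ Ioi 0 → slice n (energyAdjoint n h).graph.fst z = u z) (j : ℕ) {δ : ℝ}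
    (hδ : 0 < δ) :
    ‖bandFourier (annulus n j) (u δ)‖ₑ ^ 2
      ≤ ENNReal.ofReal ((bandDepth n j ^ 2 + δ ^ 2) / 4) * bandMass (slice n (residual h)) j := by
  have hn' : (2 : ℝ) ≤ n := by exact_mod_cast hn
  have hA := measurableSet_annulus (n := n) j
  have hρ : ∀ ξ ∈ annulus n j, ‖ξ‖ ≤ 2 ^ (j + 1) := fun ξ hξ => hξ.2.le
  obtain ⟨⟨Q, hQ⟩, -⟩ := exists_radialSystem_band hA hρ h huc hu hua
  have hν : 1 / (n : ℝ) ≤ 1 / 2 := one_div_le_one_div_of_le two_pos hn'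
  have := hQ.norm_sq_le_of_coercive (by positivity) hν (laplaceSymbol_bound hA hρ)
    (bandDepth_pos (n := n) j) (fun z _ => by
      rw [bandDepth_rpow hn]; exact coercive_annulus j (u z)) hδ
  rw [← ofReal_integral_band, ← ENNReal.ofReal_mul (by positivity), ← ofReal_norm,
    ← ENNReal.ofReal_pow (norm_nonneg _)]
  exact ENNReal.ofReal_le_ofReal this

/-- The estimate of the high frequencies near the boundary. -/
theorem norm_tail_sq_le (hn : 2 ≤ n) (h : H n)
    {u : ℝ → L2Horizontal n} (huc : ContinuousOn u (Ioi 0))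
    (hu : ∀ a b, 0 < a → 0 < b →
      u b - u a = ∫ z in a..b, slice n ((energyAdjoint n h).graph.snd none) z)
    (hua : ∀ᵐ z : ℝ, z ∈ Ioi 0 → slice n (energyAdjoint n h).graph.fst z = u z) (J : ℕ) {δ : ℝ}
    (hδ : 0 < δ) :
    ‖bandFourier (dyadicBall n J)ᶜ (u δ)‖ ^ 2
      ≤ (bandDepth n J ^ 2 + δ ^ 2) / 4 * ‖residual h‖ ^ 2 := by
  -- Only a covering by annuli is needed here; the depths decrease with the index, so the largest
  -- one can be taken out of the sum.
  have h1 : ‖bandFourier (dyadicBall n J)ᶜ (u δ)‖ₑ ^ 2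
      ≤ ∑' j, ‖bandFourier (annulus n (J + j)) (u δ)‖ₑ ^ 2 := by
    rw [enorm_bandFourier_sq (measurableSet_dyadicBall J).compl]
    simp only [enorm_bandFourier_sq (measurableSet_annulus _)]
    exact (lintegral_mono_set (compl_dyadicBall_subset J)).trans (lintegral_iUnion_le _ _)
  have h2 : ∑' j, ‖bandFourier (annulus n (J + j)) (u δ)‖ₑ ^ 2
      ≤ ENNReal.ofReal ((bandDepth n J ^ 2 + δ ^ 2) / 4) * ‖residual h‖ₑ ^ 2 := by
    calc _ ≤ ∑' j, ENNReal.ofReal ((bandDepth n J ^ 2 + δ ^ 2) / 4) *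
          bandMass (slice n (residual h)) (J + j) := by
          refine ENNReal.tsum_le_tsum fun j =>
            (enorm_band_sq_le hn h huc hu hua (J + j) hδ).trans ?_
          have := bandDepth_antitone hn (Nat.le_add_right J j)
          have := bandDepth_pos (n := n) (J + j)
          gcongr
      _ ≤ ENNReal.ofReal ((bandDepth n J ^ 2 + δ ^ 2) / 4) *
          ∑' j, bandMass (slice n (residual h)) j := by
          rw [ENNReal.tsum_mul_left]
          exact mul_le_mul' le_rfl
            (ENNReal.tsum_comp_le_tsum_of_injective (add_right_injective J) _)
      _ ≤ _ := by
          gcongr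
          exact tsum_bandMass_le _
  have h3 := h1.trans h2
  rw [← ofReal_norm, ← ofReal_norm, ← ENNReal.ofReal_pow (norm_nonneg _),
    ← ENNReal.ofReal_pow (norm_nonneg _), ← ENNReal.ofReal_mul (by positivity),
    ENNReal.ofReal_le_ofReal_iff (by positivity)] at h3
  exact h3

theorem norm_le_band_add_compl {A : Set (Horizontal n)} (hA : MeasurableSet A)
    (w : L2Horizontal n) : ‖w‖ ≤ ‖bandFourier A w‖ + ‖bandFourier Aᶜ w‖ := by
  rw [← Lp.norm_fourier_eq w]
  refine le_trans (le_of_eq ?_) (norm_add_le _ _)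
  congr 1
  refine Lp.ext ?_
  filter_upwards [Lp.coeFn_add (bandFourier A w) (bandFourier Aᶜ w),
    coeFn_symbolMul (isBoundedSymbol_one hA) (FourierTransform.fourier w : L2Horizontal n),
    coeFn_symbolMul (isBoundedSymbol_one hA.compl)
      (FourierTransform.fourier w : L2Horizontal n)] with ξ h1 h2 h3
  rw [h1, Pi.add_apply, bandFourier_apply, bandFourier_apply, h2, h3]
  by_cases hξ : ξ ∈ A <;> simp [hξ]

/-- A family in `L²` converges if its low frequencies do and its high frequencies are uniformly
small. -/
theorem exists_tendsto_of_bands {u : ℝ → L2Horizontal n} {c : ℕ → ℝ} {C : ℝ}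
    (hc : Tendsto c atTop (𝓝 0))
    (hlow : ∀ J, ∃ w, Tendsto (fun δ => bandFourier (dyadicBall n J) (u δ)) (𝓝[>] 0) (𝓝 w))
    (hhigh : ∀ J δ, 0 < δ →
      ‖bandFourier (dyadicBall n J)ᶜ (u δ)‖ ^ 2 ≤ (c J ^ 2 + δ ^ 2) / 4 * C ^ 2) :
    ∃ τ, Tendsto u (𝓝[>] 0) (𝓝 τ) := by
  refine cauchy_map_iff_exists_tendsto.1 (Metric.cauchy_iff.2 ⟨inferInstance, fun ε hε => ?_⟩)
  have hcC : Tendsto (fun J => c J ^ 2 / 4 * C ^ 2) atTop (𝓝 0) := by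
    have := ((hc.pow 2).div_const 4).mul_const (C ^ 2)
    simpa using this
  have hδC : Tendsto (fun δ : ℝ => δ ^ 2 / 4 * C ^ 2) (𝓝[>] 0) (𝓝 0) := by
    have h0 : Continuous fun δ : ℝ => δ ^ 2 / 4 * C ^ 2 := by fun_prop
    have := (h0.tendsto 0).mono_left (nhdsWithin_le_nhds (s := Ioi 0))
    simpa using this
  -- Half of `(ε / 4)²` is allotted to the depth and half to `δ`. Two low parts within `ε / 8` of
  -- their limit and two high parts below `ε / 4` add up to `3ε / 4`.
  have hε2 : 0 < (ε / 4) ^ 2 / 2 := by positivity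
  obtain ⟨J, hJ⟩ := (hcC.eventually (gt_mem_nhds hε2)).exists
  obtain ⟨w, hw⟩ := hlow J
  have ev : ∀ᶠ δ in 𝓝[>] (0 : ℝ), ‖bandFourier (dyadicBall n J) (u δ) - w‖ < ε / 8
      ∧ ‖bandFourier (dyadicBall n J)ᶜ (u δ)‖ < ε / 4 := by
    filter_upwards [(tendsto_iff_norm_sub_tendsto_zero.1 hw).eventually
      (gt_mem_nhds (show (0 : ℝ) < ε / 8 by positivity)), hδC.eventually (gt_mem_nhds hε2),
      self_mem_nhdsWithin] with δ h1 h2 h3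
    refine ⟨h1, ?_⟩
    refine lt_of_pow_lt_pow_left₀ 2 (by positivity) ((hhigh J δ h3).trans_lt ?_)
    linarith
  refine ⟨_, image_mem_map ev, ?_⟩
  rintro _ ⟨a, ⟨ha1, ha2⟩, rfl⟩ _ ⟨b, ⟨hb1, hb2⟩, rfl⟩
  rw [dist_eq_norm]
  have h1 := norm_le_band_add_compl (measurableSet_dyadicBall J) (u a - u b)
  rw [map_sub, map_sub] at h1
  have h2 := norm_sub_le (bandFourier (dyadicBall n J)ᶜ (u a))
    (bandFourier (dyadicBall n J)ᶜ (u b))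
  have h3 := norm_sub_le (bandFourier (dyadicBall n J) (u a) - w)
    (bandFourier (dyadicBall n J) (u b) - w)
  rw [sub_sub_sub_cancel_right] at h3
  linarith

/-- The constant in the estimate of the low frequencies of the boundary trace. -/
def lowConst : ℝ := 256 * (1 + (2 * Real.pi) ^ 2 + 4)

theorem lowConst_nonneg : 0 ≤ lowConst := by unfold lowConst; positivity

theorem norm_dyadicBall (J : ℕ) : ∀ ξ ∈ dyadicBall n J, ‖ξ‖ ≤ 2 ^ J := fun _ hξ => le_of_lt hξ

/-- The low frequencies of the boundary trace. -/
theorem norm_lowBand_sq_le (hn : 2 ≤ n) (h : H n)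
    {u : ℝ → L2Horizontal n} (huc : ContinuousOn u (Ioi 0))
    (hu : ∀ a b, 0 < a → 0 < b →
      u b - u a = ∫ z in a..b, slice n ((energyAdjoint n h).graph.snd none) z)
    (hua : ∀ᵐ z : ℝ, z ∈ Ioi 0 → slice n (energyAdjoint n h).graph.fst z = u z)
    {τ : L2Horizontal n} (hτ : Tendsto u (𝓝[>] 0) (𝓝 τ)) :
    ‖bandFourier (dyadicBall n 0) τ‖ ^ 2 ≤ lowConst * ‖h‖ ^ 2 := by
  have hn' : (2 : ℝ) ≤ n := by exact_mod_cast hn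
  have hν : 1 / (n : ℝ) ≤ 1 / 2 := one_div_le_one_div_of_le two_pos hn'
  have hband : Tendsto (fun δ => bandFourier (dyadicBall n 0) (u δ)) (𝓝[>] 0)
      (𝓝 (bandFourier (dyadicBall n 0) τ)) :=
    ((bandFourier (dyadicBall n 0)).continuous.tendsto τ).comp hτ
  have hball := exists_radialSystem_band (measurableSet_dyadicBall 0) (norm_dyadicBall 0) h huc
    hu hua
  obtain ⟨⟨Q, hQ⟩, hm, hh, hs⟩ := hball
  have h1 := hQ.norm_limit_sq_le (by positivity) hν
    (laplaceSymbol_bound (measurableSet_dyadicBall 0) (norm_dyadicBall 0)) hband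
  have h2 : ‖(energyAdjoint n h).graph.fst‖ ^ 2
      + ∑ i, ‖(energyAdjoint n h).graph.snd i‖ ^ 2 ≤ ‖h‖ ^ 2 := by
    rw [← (energyAdjoint n h).norm_sq]
    exact pow_le_pow_left₀ (norm_nonneg _) (norm_energyAdjoint_le h) 2
  rw [Fintype.sum_option] at h2
  have h3 : ‖residual h‖ ^ 2 ≤ (2 * ‖h‖) ^ 2 :=
    pow_le_pow_left₀ (norm_nonneg _) (norm_residual_le h) 2
  have h4 : 0 ≤ ∑ i : Fin n, ‖(energyAdjoint n h).graph.snd (some i)‖ ^ 2 :=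
    Finset.sum_nonneg fun i _ => sq_nonneg _
  have h5 : 0 ≤ ‖(energyAdjoint n h).graph.snd none‖ ^ 2 := sq_nonneg _
  have h6 : 0 ≤ ‖(energyAdjoint n h).graph.fst‖ ^ 2 := sq_nonneg _
  have hS := (le_add_of_nonneg_left h5).trans ((le_add_of_nonneg_left h6).trans h2)
  have hf := (le_add_of_nonneg_right (add_nonneg h5 h4)).trans h2
  have h7 : (2 * Real.pi * 2 ^ 0) ^ 2 * (∫ z in Ioi 0, z ^ (-(1 / (n : ℝ))) *
      (inner ℂ (symbolMul volume (laplaceSymbol (dyadicBall n 0))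
      (bandFourier (dyadicBall n 0) (u z))) (bandFourier (dyadicBall n 0) (u z))).re)
      ≤ (2 * Real.pi) ^ 2 * ‖h‖ ^ 2 := by
    rw [pow_zero, mul_one]
    exact mul_le_mul_of_nonneg_left (hh.trans hS) (sq_nonneg _)
  calc ‖bandFourier (dyadicBall n 0) τ‖ ^ 2
      ≤ 256 * (‖h‖ ^ 2 + (2 * Real.pi) ^ 2 * ‖h‖ ^ 2 + (2 * ‖h‖) ^ 2) :=
        h1.trans (mul_le_mul_of_nonneg_left
          (add_le_add (add_le_add (hm.trans hf) h7) (hs.trans h3)) (by norm_num))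
    _ = lowConst * ‖h‖ ^ 2 := by rw [lowConst]; ring

/-- The high frequencies of the boundary trace. -/
theorem enorm_highBand_sq_le (hn : 2 ≤ n) (h : H n)
    {u : ℝ → L2Horizontal n} (huc : ContinuousOn u (Ioi 0))
    (hu : ∀ a b, 0 < a → 0 < b →
      u b - u a = ∫ z in a..b, slice n ((energyAdjoint n h).graph.snd none) z)
    (hua : ∀ᵐ z : ℝ, z ∈ Ioi 0 → slice n (energyAdjoint n h).graph.fst z = u z)
    {τ : L2Horizontal n} (hτ : Tendsto u (𝓝[>] 0) (𝓝 τ)) (j : ℕ) :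
    ‖bandFourier (annulus n j) τ‖ₑ ^ 2
      ≤ ENNReal.ofReal (bandDepth n j ^ 2 / 4) * bandMass (slice n (residual h)) j := by
  have hband : Tendsto (fun δ => bandFourier (annulus n j) (u δ)) (𝓝[>] 0)
      (𝓝 (bandFourier (annulus n j) τ)) :=
    ((bandFourier (annulus n j)).continuous.tendsto τ).comp hτ
  have hfin : bandMass (slice n (residual h)) j ≠ ⊤ := by
    rw [← ofReal_integral_band]; exact ENNReal.ofReal_ne_top
  have t1 : Tendsto (fun δ => ‖bandFourier (annulus n j) (u δ)‖ₑ ^ 2) (𝓝[>] 0)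
      (𝓝 (‖bandFourier (annulus n j) τ‖ₑ ^ 2)) :=
    ((ENNReal.continuous_pow 2).comp continuous_enorm).continuousAt.tendsto.comp hband
  have t2 : Tendsto (fun δ : ℝ => ENNReal.ofReal ((bandDepth n j ^ 2 + δ ^ 2) / 4) *
      bandMass (slice n (residual h)) j) (𝓝[>] 0)
      (𝓝 (ENNReal.ofReal (bandDepth n j ^ 2 / 4) * bandMass (slice n (residual h)) j)) := by
    have hc : Continuous fun δ : ℝ => ENNReal.ofReal ((bandDepth n j ^ 2 + δ ^ 2) / 4) *
        bandMass (slice n (residual h)) j :=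
      (ENNReal.continuous_mul_const hfin).comp (ENNReal.continuous_ofReal.comp (by fun_prop))
    have := (hc.tendsto 0).mono_left (nhdsWithin_le_nhds (s := Ioi 0))
    simpa using this
  refine le_of_tendsto_of_tendsto t1 t2 ?_
  filter_upwards [self_mem_nhdsWithin] with δ hδ
  exact enorm_band_sq_le hn h huc hu hua j hδ

-- On the unit ball the Sobolev weight is bounded; on the annulus `j` it is at most a constant times
-- `2^(2jα)` with `α = traceExp n`, which the factor `bandDepth n j ^ 2` cancels exactly. What is
-- left sums to the squared norm of the residual.
open FourierTransform in
theorem lintegral_weight_fourier_sq_le (hn : 2 ≤ n) {h : H n} {τ : L2Horizontal n}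
    (hlow : ‖bandFourier (dyadicBall n 0) τ‖ ^ 2 ≤ lowConst * ‖h‖ ^ 2)
    (hhigh : ∀ j, ‖bandFourier (annulus n j) τ‖ₑ ^ 2
      ≤ ENNReal.ofReal (bandDepth n j ^ 2 / 4) * bandMass (slice n (residual h)) j) :
    ∫⁻ ξ, ENNReal.ofReal ((1 + ‖ξ‖ ^ 2) ^ traceExp n) * ‖(𝓕 τ : L2Horizontal n) ξ‖ₑ ^ 2
      ≤ ENNReal.ofReal (2 ^ traceExp n * lowConst + 5 ^ traceExp n) * ‖h‖ₑ ^ 2 := by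
  have hα := traceExp_pos hn
  have hC₀ := lowConst_nonneg
  set α := traceExp n with hαdef
  set μτ : Horizontal n → ENNReal := fun ξ =>
    ENNReal.ofReal ((1 + ‖ξ‖ ^ 2) ^ α) * ‖(𝓕 τ : L2Horizontal n) ξ‖ₑ ^ 2 with hμτ
  have hlow' : ∫⁻ ξ in dyadicBall n 0, μτ ξ ≤ ENNReal.ofReal (2 ^ α * lowConst) * ‖h‖ₑ ^ 2 := by
    calc ∫⁻ ξ in dyadicBall n 0, μτ ξ
        ≤ ∫⁻ ξ in dyadicBall n 0, ENNReal.ofReal (2 ^ α) * ‖(𝓕 τ : L2Horizontal n) ξ‖ₑ ^ 2 := by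
          refine setLIntegral_mono_ae' (measurableSet_dyadicBall 0)
            (Eventually.of_forall fun ξ hξ => ?_)
          have hξ1 : ‖ξ‖ ≤ 1 := by simpa using norm_dyadicBall 0 ξ hξ
          have : 1 + ‖ξ‖ ^ 2 ≤ 2 := by nlinarith [norm_nonneg ξ]
          simp only [hμτ]
          gcongr
      _ = ENNReal.ofReal (2 ^ α) * ‖bandFourier (dyadicBall n 0) τ‖ₑ ^ 2 := by
          rw [lintegral_const_mul' _ _ ENNReal.ofReal_ne_top,
            enorm_bandFourier_sq (measurableSet_dyadicBall 0)]
      _ ≤ _ := by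
          rw [← ofReal_norm, ← ofReal_norm, ← ENNReal.ofReal_pow (norm_nonneg _),
            ← ENNReal.ofReal_pow (norm_nonneg _), ← ENNReal.ofReal_mul (by positivity),
            ← ENNReal.ofReal_mul (by positivity)]
          refine ENNReal.ofReal_le_ofReal ?_
          rw [mul_assoc]
          exact mul_le_mul_of_nonneg_left hlow (by positivity)
  have hhigh' : ∀ j, ∫⁻ ξ in annulus n j, μτ ξ
      ≤ ENNReal.ofReal (5 ^ α / 4) * bandMass (slice n (residual h)) j := by
    intro j
    -- The cancellation of the weight against the squared depth; `5` comes from `1 + |ξ|² ≤ 1 + 4 ·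
    -- 4^j ≤ 5 · 4^j`.
    have hmain : (5 * ((2 : ℝ) ^ j) ^ 2) ^ α * bandDepth n j ^ 2 ≤ 5 ^ α := by
      have h1 : bandDepth n j ^ 2 ≤ (((2 : ℝ) ^ j) ^ (-α)) ^ 2 :=
        pow_le_pow_left₀ (bandDepth_pos j).le (bandDepth_le hn j) 2
      have h2 : (((2 : ℝ) ^ j) ^ 2) ^ α * (((2 : ℝ) ^ j) ^ (-α)) ^ 2 = 1 := by
        rw [← Real.rpow_natCast, ← Real.rpow_natCast (((2 : ℝ) ^ j) ^ (-α)),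
          ← Real.rpow_mul (by positivity), ← Real.rpow_mul (by positivity),
          ← Real.rpow_add (by positivity)]
        have : ((2 : ℕ) : ℝ) * α + -α * ((2 : ℕ) : ℝ) = 0 := by ring
        rw [this, Real.rpow_zero]
      rw [Real.mul_rpow (by norm_num) (by positivity), mul_assoc]
      calc (5 : ℝ) ^ α * ((((2 : ℝ) ^ j) ^ 2) ^ α * bandDepth n j ^ 2)
          ≤ 5 ^ α * ((((2 : ℝ) ^ j) ^ 2) ^ α * (((2 : ℝ) ^ j) ^ (-α)) ^ 2) := by gcongr
        _ = 5 ^ α := by rw [h2, mul_one]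
    calc ∫⁻ ξ in annulus n j, μτ ξ
        ≤ ∫⁻ ξ in annulus n j, ENNReal.ofReal ((5 * ((2 : ℝ) ^ j) ^ 2) ^ α) *
            ‖(𝓕 τ : L2Horizontal n) ξ‖ₑ ^ 2 := by
          refine setLIntegral_mono_ae' (measurableSet_annulus j)
            (Eventually.of_forall fun ξ hξ => ?_)
          have h1 : (1 : ℝ) ≤ 2 ^ j := one_le_pow₀ one_le_two
          have h2 : ‖ξ‖ ≤ 2 * 2 ^ j := by
            have := hξ.2.le; rw [pow_succ] at this; linarith
          have : 1 + ‖ξ‖ ^ 2 ≤ 5 * ((2 : ℝ) ^ j) ^ 2 := by nlinarith [norm_nonneg ξ]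
          simp only [hμτ]
          gcongr
      _ = ENNReal.ofReal ((5 * ((2 : ℝ) ^ j) ^ 2) ^ α) * ‖bandFourier (annulus n j) τ‖ₑ ^ 2 := by
          rw [lintegral_const_mul' _ _ ENNReal.ofReal_ne_top,
            enorm_bandFourier_sq (measurableSet_annulus j)]
      _ ≤ ENNReal.ofReal ((5 * ((2 : ℝ) ^ j) ^ 2) ^ α) *
          (ENNReal.ofReal (bandDepth n j ^ 2 / 4) * bandMass (slice n (residual h)) j) := by
          gcongr; exact hhigh j
      _ ≤ _ := by
          rw [← mul_assoc, ← ENNReal.ofReal_mul (by positivity)]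
          gcongr
          linarith
  have hsum : ∑' j, ∫⁻ ξ in annulus n j, μτ ξ ≤ ENNReal.ofReal (5 ^ α) * ‖h‖ₑ ^ 2 := by
    calc _ ≤ ∑' j, ENNReal.ofReal (5 ^ α / 4) * bandMass (slice n (residual h)) j :=
          ENNReal.tsum_le_tsum hhigh'
      _ ≤ ENNReal.ofReal (5 ^ α / 4) * ‖residual h‖ₑ ^ 2 := by
          rw [ENNReal.tsum_mul_left]
          gcongr
          exact tsum_bandMass_le _
      _ ≤ _ := by
          rw [← ofReal_norm, ← ofReal_norm, ← ENNReal.ofReal_pow (norm_nonneg _),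
            ← ENNReal.ofReal_pow (norm_nonneg _), ← ENNReal.ofReal_mul (by positivity),
            ← ENNReal.ofReal_mul (by positivity)]
          refine ENNReal.ofReal_le_ofReal ?_
          have h3 : ‖residual h‖ ^ 2 ≤ (2 * ‖h‖) ^ 2 :=
            pow_le_pow_left₀ (norm_nonneg _) (norm_residual_le h) 2
          calc (5 : ℝ) ^ α / 4 * ‖residual h‖ ^ 2 ≤ 5 ^ α / 4 * (2 * ‖h‖) ^ 2 := by gcongr
            _ = _ := by ring
  rw [← lintegral_add_compl _ (measurableSet_dyadicBall (n := n) 0),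
    ENNReal.ofReal_add (by positivity) (by positivity), add_mul]
  refine add_le_add hlow' (le_trans ?_ hsum)
  have := compl_dyadicBall_subset (n := n) 0
  simp only [zero_add] at this
  exact (lintegral_mono_set this).trans (lintegral_iUnion_le _ _)

open FourierTransform in
/-- Existence and regularity of the boundary trace of an element of the domain of the operator. -/
theorem exists_boundaryTrace (hn : 2 ≤ n) (h : H n) : ∃ τ : L2Horizontal n,
    IsBoundaryTrace n (energyEmbed n (energyAdjoint n h)) τ ∧
    ∫⁻ ξ, ENNReal.ofReal ((1 + ‖ξ‖ ^ 2) ^ traceExp n) * ‖(𝓕 τ : L2Horizontal n) ξ‖ₑ ^ 2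
      ≤ ENNReal.ofReal (2 ^ traceExp n * lowConst + 5 ^ traceExp n) * ‖h‖ₑ ^ 2 := by
  have hn' : (2 : ℝ) ≤ n := by exact_mod_cast hn
  have hν : 1 / (n : ℝ) ≤ 1 / 2 := one_div_le_one_div_of_le two_pos hn'
  obtain ⟨u, hus, hu, hua⟩ := exists_sliceTrace (energyAdjoint n h)
  obtain ⟨τ, hτ⟩ := exists_tendsto_of_bands (u := u) (tendsto_bandDepth hn)
    -- On a ball of frequencies `K` is bounded, so the vertical system supplies the limit. The
    -- bounds there grow with `J`, so the tail estimate is what makes the convergence uniform over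
    -- all frequencies.
    (fun J => by
      obtain ⟨⟨Q, hQ⟩, -⟩ := exists_radialSystem_band (measurableSet_dyadicBall J)
        (norm_dyadicBall J) h hus.1 hu hua
      exact hQ.exists_tendsto (by positivity) hν
        (laplaceSymbol_bound (measurableSet_dyadicBall J) (norm_dyadicBall J)))
    (fun J δ hδ => norm_tail_sq_le hn h hus.1 hu hua J hδ)
  exact ⟨τ, ⟨u, hus, hτ⟩, lintegral_weight_fourier_sq_le hn
    (norm_lowBand_sq_le hn h hus.1 hu hua hτ) (enorm_highBand_sq_le hn h hus.1 hu hua hτ)⟩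

end BoundaryTrace

end

end TaubWave

namespace TaubWave

noncomputable section

/-! ### Sobolev regularity and continuous dependence -/

section Sobolev

variable {n : ℕ}

-- By Plancherel, finiteness of the weighted integral means that the multiplied transform is in
-- `L²`; its inverse transform is the Bessel potential.
open FourierTransform in
theorem exists_besselPotential_eq {s C : ℝ} {a : ENNReal} (hC : a ≠ ⊤) {τ : L2Horizontal n}
    (h : ∫⁻ ξ, ENNReal.ofReal ((1 + ‖ξ‖ ^ 2) ^ s) * ‖(𝓕 τ : L2Horizontal n) ξ‖ₑ ^ 2
      ≤ ENNReal.ofReal C * a) :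
    ∃ U : L2Horizontal n, TemperedDistribution.besselPotential (Horizontal n) ℂ s
      (τ : 𝓢'(Horizontal n, ℂ)) = (U : 𝓢'(Horizontal n, ℂ)) ∧ ‖U‖ₑ ^ 2 ≤ ENNReal.ofReal C * a := by
  have hsq : ∀ ξ : Horizontal n,
      ‖(((1 + ‖ξ‖ ^ 2) ^ (s / 2) : ℝ) : ℂ) * (𝓕 τ : L2Horizontal n) ξ‖ₑ ^ 2
        = ENNReal.ofReal ((1 + ‖ξ‖ ^ 2) ^ s) * ‖(𝓕 τ : L2Horizontal n) ξ‖ₑ ^ 2 := fun ξ => by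
    rw [enorm_mul, mul_pow]
    congr 1
    rw [← ofReal_norm, Complex.norm_real, Real.norm_of_nonneg (by positivity),
      ← ENNReal.ofReal_pow (by positivity), ← Real.rpow_natCast, ← Real.rpow_mul (by positivity)]
    congr 2
    push_cast; ring
  have hm : AEStronglyMeasurable
      (fun ξ : Horizontal n => (((1 + ‖ξ‖ ^ 2) ^ (s / 2) : ℝ) : ℂ) * (𝓕 τ : L2Horizontal n) ξ)
      volume := by
    refine AEStronglyMeasurable.mul ?_ (Lp.aestronglyMeasurable _)
    exact (Complex.measurable_ofReal.comp
      (((measurable_norm.pow_const 2).const_add 1).pow_const _)).aestronglyMeasurable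
  have hL : MemLp
      (fun ξ : Horizontal n => (((1 + ‖ξ‖ ^ 2) ^ (s / 2) : ℝ) : ℂ) * (𝓕 τ : L2Horizontal n) ξ)
      2 volume := by
    refine (memLp_two_iff_lintegral hm).2 ?_
    simp only [hsq]
    exact h.trans_lt (ENNReal.mul_lt_top ENNReal.ofReal_lt_top hC.lt_top)
  refine ⟨𝓕⁻ (hL.toLp _ : L2Horizontal n), ?_, ?_⟩
  · have hsm : TemperedDistribution.smulLeftCLM ℂ
        (fun ξ : Horizontal n => (((1 + ‖ξ‖ ^ 2) ^ (s / 2) : ℝ) : ℂ))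
        ((𝓕 τ : L2Horizontal n) : 𝓢'(Horizontal n, ℂ))
        = ((hL.toLp _ : L2Horizontal n) : 𝓢'(Horizontal n, ℂ)) := by
      ext g
      have ht : (fun ξ : Horizontal n =>
          (((1 + ‖ξ‖ ^ 2) ^ (s / 2) : ℝ) : ℂ)).HasTemperateGrowth := by fun_prop
      rw [TemperedDistribution.smulLeftCLM_apply_apply, Lp.toTemperedDistribution_apply,
        Lp.toTemperedDistribution_apply]
      refine integral_congr_ae ?_
      filter_upwards [hL.coeFn_toLp] with ξ hξ
      rw [hξ, SchwartzMap.smulLeftCLM_apply_apply ht]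
      simp only [smul_eq_mul]
      ring
    rw [TemperedDistribution.besselPotential, TemperedDistribution.fourierMultiplierCLM_apply,
      Lp.fourier_toTemperedDistribution_eq, hsm, Lp.fourierInv_toTemperedDistribution_eq]
  · rw [← lintegral_fourier_sq, fourier_fourierInv_eq, ← enorm_Lp_sq, enorm_toLp_sq]
    simp only [hsq]
    exact h

theorem IsSliceTrace.sub {φ ψ : H n} {u v : ℝ → L2Horizontal n} (hu : IsSliceTrace n φ u)
    (hv : IsSliceTrace n ψ v) : IsSliceTrace n (φ - ψ) (u - v) := by
  refine ⟨hu.1.sub hv.1, ?_⟩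
  filter_upwards [hu.2, hv.2, ae_halfSpace_sections (ae_halfSpace_of_ae_H (Lp.coeFn_sub φ ψ))]
    with z h1 h2 h3
  filter_upwards [h1, h2, h3, Lp.coeFn_sub (u z) (v z)] with x e1 e2 e3 e4
  rw [e3, Pi.sub_apply, e1, e2, Pi.sub_apply, e4, Pi.sub_apply]

theorem IsBoundaryTrace.sub {φ ψ : H n} {τ σ : L2Horizontal n} (hτ : IsBoundaryTrace n φ τ)
    (hσ : IsBoundaryTrace n ψ σ) : IsBoundaryTrace n (φ - ψ) (τ - σ) := by
  obtain ⟨u, hu, hu'⟩ := hτ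
  obtain ⟨v, hv, hv'⟩ := hσ
  exact ⟨u - v, hu.sub hv, hu'.sub hv'⟩

theorem toTemperedDistribution_sub (u v : L2Horizontal n) :
    ((u - v : L2Horizontal n) : 𝓢'(Horizontal n, ℂ))
      = (u : 𝓢'(Horizontal n, ℂ)) - (v : 𝓢'(Horizontal n, ℂ)) :=
  map_sub (Lp.toTemperedDistributionCLM ℂ (volume : Measure (Horizontal n)) 2) u v

theorem toTemperedDistribution_injective {u v : L2Horizontal n}
    (h : (u : 𝓢'(Horizontal n, ℂ)) = (v : 𝓢'(Horizontal n, ℂ))) : u = v :=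
  (LinearMap.ker_eq_bot.1 (Lp.ker_toTemperedDistributionCLM_eq_bot (F := ℂ)
    (μ := (volume : Measure (Horizontal n))) (p := 2))) h

/-- The boundary trace of `(1 + A)⁻¹ h` depends continuously, in the Sobolev space, on `h`. -/
theorem exists_continuous_boundaryTrace (hn : 2 ≤ n) : ∃ T U : H n → L2Horizontal n,
    Continuous U ∧ ∀ h, IsBoundaryTrace n (energyEmbed n (energyAdjoint n h)) (T h) ∧
      TemperedDistribution.besselPotential (Horizontal n) ℂ (traceExp n)
        (T h : 𝓢'(Horizontal n, ℂ)) = (U h : 𝓢'(Horizontal n, ℂ)) := by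
  set C : ℝ := 2 ^ traceExp n * lowConst + 5 ^ traceExp n with hC
  have hC0 : 0 ≤ C := by have := lowConst_nonneg; positivity
  have hex : ∀ h : H n, ∃ τ U : L2Horizontal n,
      IsBoundaryTrace n (energyEmbed n (energyAdjoint n h)) τ ∧
      TemperedDistribution.besselPotential (Horizontal n) ℂ (traceExp n)
        (τ : 𝓢'(Horizontal n, ℂ)) = (U : 𝓢'(Horizontal n, ℂ)) ∧
      ‖U‖ ^ 2 ≤ C * ‖h‖ ^ 2 := fun h => by
    obtain ⟨τ, hτ, hb⟩ := exists_boundaryTrace hn h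
    obtain ⟨U, hU, hUb⟩ := exists_besselPotential_eq (by finiteness) hb
    refine ⟨τ, U, hτ, hU, ?_⟩
    rw [← ofReal_norm, ← ofReal_norm, ← ENNReal.ofReal_pow (norm_nonneg _),
      ← ENNReal.ofReal_pow (norm_nonneg _), ← ENNReal.ofReal_mul hC0,
      ENNReal.ofReal_le_ofReal_iff (by positivity)] at hUb
    exact hUb
  choose T U hT hU hb using hex
  have hsub : ∀ h k, U h - U k = U (h - k) := fun h k => by
    refine toTemperedDistribution_injective ?_
    have h1 : T (h - k) = T h - T k := by
      refine (hT (h - k)).unique ?_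
      rw [map_sub, map_sub]
      exact (hT h).sub (hT k)
    rw [toTemperedDistribution_sub, ← hU, ← hU, ← hU, h1, toTemperedDistribution_sub, map_sub]
  refine ⟨T, U, ?_, fun h => ⟨hT h, hU h⟩⟩
  refine (LipschitzWith.of_dist_le_mul (K := (√C).toNNReal) fun h k => ?_).continuous
  rw [dist_eq_norm, dist_eq_norm, hsub, Real.coe_toNNReal _ (Real.sqrt_nonneg _)]
  refine le_of_sq_le_sq ?_ (by positivity)
  rw [mul_pow, Real.sq_sqrt hC0]
  exact hb (h - k)

end Sobolev

end

end TaubWave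

/-! ### The theorem: composing the continuous preimage with the continuous trace -/

theorem mainTheorem7 (n : ℕ) (hn : 2 ≤ n) (f g : TaubWave.H n)
    (hf : f ∈ TaubWave.operatorDomain n) (hg : g ∈ TaubWave.energySpace n)
    (φ : ℝ → TaubWave.H n) (hφ : TaubWave.IsSolution n f g φ) :
    ∃ T : ℝ → TaubWave.L2Horizontal n,
      (∀ t : ℝ, 0 ≤ t → TaubWave.IsBoundaryTrace n (φ t) (T t)) ∧
      (∀ t : ℝ, 0 ≤ t → TemperedDistribution.MemSobolev (2 * (n : ℝ) / ((n : ℝ) - 1)) 2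
        (T t : 𝓢'(TaubWave.Horizontal n, ℂ))) ∧
      TaubWave.IsSobolevContinuousOn n (2 * (n : ℝ) / ((n : ℝ) - 1)) T (Set.Ici 0) := by
  obtain ⟨θ, hθ, hφθ⟩ := hφ.exists_continuousOn_resolvent hf hg
  obtain ⟨T, U, hU, hT⟩ := TaubWave.exists_continuous_boundaryTrace hn
  refine ⟨fun t => T (θ t), fun t ht => ?_, fun t _ => ⟨U (θ t), (hT (θ t)).2⟩,
    fun t => U (θ t), hU.comp_continuousOn hθ, fun t _ => (hT (θ t)).2⟩
  rw [hφθ t ht]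
  exact (hT (θ t)).1
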